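/- Let $n\ge 1$, $\alpha\ge n$, and let $h:(0,\infty)\to\mathbb R$ be $C^1$, convex and bounded below, with $h(\delta)=\delta\,h(\delta^{-1})$ for all $\delta>0$ and $h'(1)=-n$. For a real $n\times n$ matrix $A$ with $\det A>0$ and singular values $v_1,\dots,v_n$ put $$\Psi(A)=\sum_{i=1}^n v_i^{\alpha}+\det A\,\Big(\sum_{i=1}^n v_i^{-\alpha}\Big)+h(\det A).$$ For bounded domains $\Omega_1,\Omega_2\subset\mathbb R^n$ let $\mathcal A_n=\mathcal A_n(\Omega_1,\Omega_2)$ be the set of $y\in W^{1,n}(\Omega_1,\mathbb R^n)$ that are homeomorphisms of $\Omega_1$ onto $\Omega_2$ with $\det Dy>0$ a.e. in $\Omega_1$ and $y^{-1}\in W^{1,n}(\Omega_2,\mathbb R^n)$. Then $\Psi\ge 0$, and the following holds for every $\lambda>0$, every $R\in SO(n)$ and every bounded domain $\Omega_1\subset\mathbb R^n$, where $M=\lambda R$ and $\Omega_2=M\Omega_1$. (1) For all $y\in\mathcal A_n(\Omega_1,\Omega_2)$, $$\frac{1}{\mathcal L^n(\Omega_1)}\int_{\Omega_1}\Psi(Dy(x))\,dx\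 \ge\ \Psi(M),$$ where the left-hand side may be $+\infty$. (2) If $\alpha=n$, suppose in addition that $h$ is not affine on any neighbourhood of $\lambda^n=\det M$ (for instance, that $h$ is strictly convex). Let $K\subset\mathbb R^m$ be nonempty, bounded, closed and convex, let $g:\mathbb R^m\times\mathbb R^m\to[0,\infty)$ be continuous and symmetric with $g(c,d)=0$ if and only if $c=d$, and let $c_1\in L^\infty(\Omega_1,K)$, $c_2\in L^\infty(\Omega_2,K)$ satisfy $c_2(Mx)=c_1(x)$ for a.e. $x\in\Omega_1$. Suppose that the following genericity condition holds: if $a\in\mathbb R^n$ and $Q\in SO(n)$ satisfy $$a+\lambda Q\Omega_1=\Omega_2\quad\text{and}\quad c_2(a+\lambda Qx)=c_2(\lambda Rx)\ \text{ for a.e. }x\in\Omega_1,$$ then $a=0$ and $Q=R$. Then $y(x)=\lambda Rx$ is the unique minimiser in $\mathcal A_n(\Omega_1,\Omega_2)$ of $$I_{P_1,P_2}(y)=\int_{\Omega_1}\Big(\Psi(Dy(x))+\big(1+\det Dy(x)\big)\,g\big(c_1(x),c_2(y(x))\big)\Big)\,dx .$$ -/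

import Mathlib

open MeasureTheory Set Filter Topology
open scoped ContDiff ENNReal

namespace ImageMatching

noncomputable section

/-- A bounded domain in `ℝⁿ`: bounded, open, connected and nonempty. -/
structure IsBoundedDomain {n : ℕ} (Ω : Set (EuclideanSpace ℝ (Fin n))) : Prop where
  isOpen : IsOpen Ω
  isConnected : IsConnected Ω
  isBounded : Bornology.IsBounded Ω

/-- `G` is a weak gradient of `y : Ω → ℝⁿ`: both are locally integrable on `Ω` and
`∫_Ω yᵢ ∂ⱼφ = - ∫_Ω Gᵢⱼ φ` for all smooth `φ` with compact support in `Ω`. -/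
structure IsWeakGradient {n : ℕ} (Ω : Set (EuclideanSpace ℝ (Fin n)))
    (y : EuclideanSpace ℝ (Fin n) → EuclideanSpace ℝ (Fin n))
    (G : EuclideanSpace ℝ (Fin n) → Matrix (Fin n) (Fin n) ℝ) : Prop where
  locallyIntegrableOn_map : ∀ i, LocallyIntegrableOn (fun x => y x i) Ω volume
  locallyIntegrableOn_grad : ∀ i j, LocallyIntegrableOn (fun x => G x i j) Ω volume
  integral_eq : ∀ φ : EuclideanSpace ℝ (Fin n) → ℝ,
    ContDiff ℝ ∞ φ → HasCompactSupport φ → tsupport φ ⊆ Ω → ∀ i j : Fin n,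
      ∫ x in Ω, y x i * fderiv ℝ φ x (EuclideanSpace.single j 1) = - ∫ x in Ω, G x i j * φ x

open Classical in
/-- The weak gradient `Dy` of `y` on `Ω` (determined almost everywhere on an open set `Ω`);
the zero matrix field if there is none. -/
def weakGradient {n : ℕ} (Ω : Set (EuclideanSpace ℝ (Fin n)))
    (y : EuclideanSpace ℝ (Fin n) → EuclideanSpace ℝ (Fin n)) :
    EuclideanSpace ℝ (Fin n) → Matrix (Fin n) (Fin n) ℝ :=
  if h : ∃ G, IsWeakGradient Ω y G then h.choose else 0

/-- `y ∈ W^{1,p}(Ω, ℝⁿ)`. -/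
def MemSobolev {n : ℕ} (p : ℝ≥0∞) (Ω : Set (EuclideanSpace ℝ (Fin n)))
    (y : EuclideanSpace ℝ (Fin n) → EuclideanSpace ℝ (Fin n)) : Prop :=
  MemLp y p (volume.restrict Ω) ∧
    ∃ G, IsWeakGradient Ω y G ∧ ∀ i j, MemLp (fun x => G x i j) p (volume.restrict Ω)

/-- The class `𝒜_p(Ω₁, Ω₂)`: maps `y ∈ W^{1,p}(Ω₁, ℝⁿ)` that restrict to a homeomorphism of `Ω₁`
onto `Ω₂`, are orientation preserving (`det Dy > 0` a.e. in `Ω₁`), and whose inverse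
`ξ : Ω₂ → Ω₁` is in `W^{1,p}(Ω₂, ℝⁿ)`. Only the values of `y` on `Ω₁` matter. -/
def admissible {n : ℕ} (p : ℝ≥0∞) (Ω₁ Ω₂ : Set (EuclideanSpace ℝ (Fin n))) :
    Set (EuclideanSpace ℝ (Fin n) → EuclideanSpace ℝ (Fin n)) :=
  {y | MemSobolev p Ω₁ y ∧ ContinuousOn y Ω₁ ∧
    (∀ᵐ x ∂volume.restrict Ω₁, 0 < (weakGradient Ω₁ y x).det) ∧
    ∃ ξ : EuclideanSpace ℝ (Fin n) → EuclideanSpace ℝ (Fin n),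
      MapsTo y Ω₁ Ω₂ ∧ MapsTo ξ Ω₂ Ω₁ ∧ InvOn ξ y Ω₁ Ω₂ ∧ ContinuousOn ξ Ω₂ ∧
        MemSobolev p Ω₂ ξ}

/-- `c ∈ L^∞(Ω, K)` for a bounded set `K`: `c` is (a.e. strongly) measurable on `Ω`, with values in
`K` a.e. in `Ω`. -/
def IsIntensityMap {n m : ℕ} (Ω : Set (EuclideanSpace ℝ (Fin n)))
    (K : Set (EuclideanSpace ℝ (Fin m)))
    (c : EuclideanSpace ℝ (Fin n) → EuclideanSpace ℝ (Fin m)) : Prop :=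
  AEStronglyMeasurable c (volume.restrict Ω) ∧ ∀ᵐ x ∂volume.restrict Ω, c x ∈ K

/-- The singular values `vᵢ(A)`, `i = 1, …, n`, of an `n × n` matrix `A`. -/
def singVal {n : ℕ} (A : Matrix (Fin n) (Fin n) ℝ) (i : Fin n) : ℝ :=
  (Matrix.toEuclideanLin A).singularValues i

/-- `Ψ(A) = ∑ vᵢ^α + det A · ∑ vᵢ^{-α} + h(det A)`. -/
def elasticEnergy {n : ℕ} (α : ℝ) (h : ℝ → ℝ) (A : Matrix (Fin n) (Fin n) ℝ) : ℝ :=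
  ∑ i, singVal A i ^ α + A.det * ∑ i, singVal A i ^ (-α) + h A.det

/-- `ψ(c, d, A) = Ψ(A) + (1 + det A) g(c, d)`. -/
def integrand {n m : ℕ} (Ψ : Matrix (Fin n) (Fin n) ℝ → ℝ)
    (g : EuclideanSpace ℝ (Fin m) → EuclideanSpace ℝ (Fin m) → ℝ)
    (c d : EuclideanSpace ℝ (Fin m)) (A : Matrix (Fin n) (Fin n) ℝ) : ℝ :=
  Ψ A + (1 + A.det) * g c d

/-- `I_{P₁,P₂}(y) = ∫_{Ω₁} ψ(c₁(x), c₂(y(x)), Dy(x)) dx ∈ [0, ∞]`, for `ψ` that is nonnegative on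
matrices of positive determinant and `y` with `det Dy > 0` a.e. -/
def functional {n m : ℕ}
    (ψ : EuclideanSpace ℝ (Fin m) → EuclideanSpace ℝ (Fin m) → Matrix (Fin n) (Fin n) ℝ → ℝ)
    (Ω₁ : Set (EuclideanSpace ℝ (Fin n)))
    (c₁ c₂ : EuclideanSpace ℝ (Fin n) → EuclideanSpace ℝ (Fin m))
    (y : EuclideanSpace ℝ (Fin n) → EuclideanSpace ℝ (Fin n)) : ℝ≥0∞ :=
  ∫⁻ x in Ω₁, ENNReal.ofReal (ψ (c₁ x) (c₂ (y x)) (weakGradient Ω₁ y x))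

/-- `y₀` is the unique minimiser of `I` in `𝒜`, maps being identified when they agree on `Ω`. -/
def IsUniqueMinimiser {n : ℕ} (Ω : Set (EuclideanSpace ℝ (Fin n)))
    (𝒜 : Set (EuclideanSpace ℝ (Fin n) → EuclideanSpace ℝ (Fin n)))
    (I : (EuclideanSpace ℝ (Fin n) → EuclideanSpace ℝ (Fin n)) → ℝ≥0∞)
    (y₀ : EuclideanSpace ℝ (Fin n) → EuclideanSpace ℝ (Fin n)) : Prop :=
  y₀ ∈ 𝒜 ∧ IsMinOn I 𝒜 y₀ ∧ ∀ y ∈ 𝒜, IsMinOn I 𝒜 y → EqOn y y₀ Ω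

end

end ImageMatching

/-!
A power-mean inequality bounds `Ψ(A)` from below by the energy of the dilation with the same
determinant; this is a convex function of `det A`, hence lies above its tangent line at `λⁿ`. That
tangent line is affine in `det Dy`, whose integral over `Ω₁` is `ℒⁿ(Ω₂) = λⁿ ℒⁿ(Ω₁)` for every
admissible `y`, and (1) follows; the tangent line at `1` is zero, so `Ψ ≥ 0`.

The area formula rests on degree theory. The Jacobians of the mollifications of `y` converge to
`det Dy` in `L¹_loc`, because the exponent of the Sobolev space is `n`. Hence the degree of `y` over
a small ball is an integral of `det Dy`, and it is nonzero because `det Dy > 0`. A nonzero degree is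
at least one in absolute value, since the mollified maps cover the ball; applied to `y⁻¹`, whose
degree is the reciprocal, this shows that the degree of `y` is one.

For a competitor with the energy of `M`, all these inequalities are equalities: `det Dy = λⁿ` and
`Dy` is conformal a.e., so `y` is locally `λ`-Lipschitz and multiplies volumes by `λⁿ`. Then the
image of a ball of radius `r` is a ball of radius `λ r`, so `y` is locally a similarity,
`y(x) = a + λ Q x` on the connected set `Ω₁`, and genericity gives `a = 0` and `Q = R`.
-/

namespace ImageMatching

variable {n : ℕ}

local notation "𝔼" => EuclideanSpace ℝ (Fin n)

/-! ### The change of variables formula without injectivity -/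

section Convergence

variable {X : Type*} [MeasurableSpace X] {μ : Measure X}

theorem integral_abs_mul_sub_mul_le {u u₀ d J : X → ℝ} {M η : ℝ}
    (hu : ∀ᵐ x ∂μ, |u x - u₀ x| ≤ η) (hu₀ : ∀ᵐ x ∂μ, |u₀ x| ≤ M)
    (hud : Integrable (fun x => u x * d x) μ) (huJ : Integrable (fun x => u₀ x * J x) μ)
    (hd : Integrable d μ) (hJ : Integrable J μ) :
    ∫ x, |u x * d x - u₀ x * J x| ∂μ ≤ (M + η) * ∫ x, |d x - J x| ∂μ + η * ∫ x, |J x| ∂μ := by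
  have hdJ : Integrable (fun x => |d x - J x|) μ := (hd.sub hJ).abs
  rw [← integral_const_mul, ← integral_const_mul,
    ← integral_add (hdJ.const_mul _) (hJ.abs.const_mul _)]
  refine integral_mono_ae (hud.sub huJ).abs ((hdJ.const_mul _).add (hJ.abs.const_mul _)) ?_
  filter_upwards [hu, hu₀] with x hx hx₀
  have hux : |u x| ≤ M + η := by
    linarith [abs_sub_abs_le_abs_sub (u x) (u₀ x)]
  calc |u x * d x - u₀ x * J x| = |u x * (d x - J x) + (u x - u₀ x) * J x| := by ring_nf
    _ ≤ |u x * (d x - J x)| + |(u x - u₀ x) * J x| := abs_add_le _ _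
    _ ≤ (M + η) * |d x - J x| + η * |J x| := by
      rw [abs_mul, abs_mul]
      gcongr

variable [TopologicalSpace X] [T2Space X] [OpensMeasurableSpace X]

theorem tendsto_setIntegral_abs_mul_sub_mul {ι : Type*} {l : Filter ι} {u : ι → X → ℝ}
    {u₀ : X → ℝ} {d : ι → X → ℝ} {J : X → ℝ} {C : Set X} (hC : IsCompact C)
    (hu : ∀ᶠ k in l, ContinuousOn (u k) C) (hu₀ : ContinuousOn u₀ C)
    (hlim : TendstoUniformlyOn u u₀ l C)
    (hd : ∀ᶠ k in l, IntegrableOn (d k) C μ) (hJ : IntegrableOn J C μ)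
    (hdJ : Tendsto (fun k => ∫ x in C, |d k x - J x| ∂μ) l (𝓝 0)) :
    Tendsto (fun k => ∫ x in C, |u k x * d k x - u₀ x * J x| ∂μ) l (𝓝 0) := by
  obtain ⟨M, hM⟩ := hC.exists_bound_of_continuousOn hu₀
  set I := ∫ x in C, |J x| ∂μ
  have : 0 ≤ I := integral_nonneg fun _ => abs_nonneg _
  rw [Metric.tendsto_nhds]
  intro ε hε
  obtain ⟨η, hη, hηI⟩ : ∃ η > 0, η * I < ε / 2 := by
    refine ⟨ε / (2 * (I + 1)), by positivity, ?_⟩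
    rw [div_mul_eq_mul_div, div_lt_div_iff₀ (by positivity) two_pos]
    nlinarith
  have hsmall : ∀ᶠ k in l, (M + η) * ∫ x in C, |d k x - J x| ∂μ < ε / 2 := by
    have := hdJ.const_mul (M + η)
    rw [mul_zero] at this
    exact this.eventually_lt_const (by positivity)
  filter_upwards [hu, hd, hsmall, Metric.tendstoUniformlyOn_iff.1 hlim η hη] with k huk hdk hk hdist
  rw [Real.dist_0_eq_abs, abs_of_nonneg (integral_nonneg fun _ => abs_nonneg _)]
  calc ∫ x in C, |u k x * d k x - u₀ x * J x| ∂μ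
      ≤ (M + η) * ∫ x in C, |d k x - J x| ∂μ + η * I := by
        refine integral_abs_mul_sub_mul_le ?_ ?_ (hdk.continuousOn_mul huk hC)
          (hJ.continuousOn_mul hu₀ hC) hdk hJ <;>
          refine ae_restrict_of_forall_mem hC.measurableSet fun x hx => ?_
        · rw [← Real.dist_eq, dist_comm]
          exact (hdist x hx).le
        · exact hM x hx
    _ < ε := by linarith

theorem tendsto_setIntegral_mul {ι : Type*} {l : Filter ι} {u : ι → X → ℝ} {u₀ : X → ℝ}
    {d : ι → X → ℝ} {J : X → ℝ} {C V : Set X} (hC : IsCompact C) (hVC : V ⊆ C)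
    (hu : ∀ᶠ k in l, ContinuousOn (u k) C) (hu₀ : ContinuousOn u₀ C)
    (hlim : TendstoUniformlyOn u u₀ l C)
    (hd : ∀ᶠ k in l, IntegrableOn (d k) C μ) (hJ : IntegrableOn J C μ)
    (hdJ : Tendsto (fun k => ∫ x in C, |d k x - J x| ∂μ) l (𝓝 0)) :
    Tendsto (fun k => ∫ x in V, u k x * d k x ∂μ) l (𝓝 (∫ x in V, u₀ x * J x ∂μ)) := by
  rw [tendsto_iff_dist_tendsto_zero]
  refine squeeze_zero' (Eventually.of_forall fun _ => dist_nonneg) ?_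
    (tendsto_setIntegral_abs_mul_sub_mul hC hu hu₀ hlim hd hJ hdJ)
  filter_upwards [hu, hd] with k huk hdk
  have hintk : IntegrableOn (fun x => u k x * d k x) C μ := hdk.continuousOn_mul huk hC
  have hintegrable₀ : IntegrableOn (fun x => u₀ x * J x) C μ := hJ.continuousOn_mul hu₀ hC
  rw [Real.dist_eq, ← integral_sub (hintk.mono_set hVC) (hintegrable₀.mono_set hVC)]
  exact abs_integral_le_integral_abs.trans (setIntegral_mono_set (hintk.sub hintegrable₀).abs
    (Eventually.of_forall fun _ => abs_nonneg _) hVC.eventuallyLE)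

end Convergence

section SmallPerturbation

variable {E : Type*} [NormedAddCommGroup E] [NormedSpace ℝ E]

theorem eventually_det_id_add_pos :
    ∀ᶠ A : E →L[ℝ] E in 𝓝 0, 0 < (ContinuousLinearMap.id ℝ E + A).det := by
  have hcont : Continuous fun A : E →L[ℝ] E => (ContinuousLinearMap.id ℝ E + A).det :=
    ContinuousLinearMap.continuous_det.comp (continuous_const.add continuous_id)
  refine hcont.continuousAt.eventually (lt_mem_nhds ?_)
  simp [ContinuousLinearMap.det]

theorem bijective_id_add_of_lipschitzWith [CompleteSpace E] {g : E → E} {K : NNReal} (hK : K < 1)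
    (hg : LipschitzWith K g) : Function.Bijective fun x => x + g x := by
  have happrox : ApproximatesLinearOn (fun x => x + g x)
      ((ContinuousLinearEquiv.refl ℝ E : E ≃L[ℝ] E) : E →L[ℝ] E) univ K := fun x _ y _ => by
    have hsub : x + g x - (y + g y) - (x - y) = g x - g y := by abel
    simpa [hsub] using hg.norm_sub_le x y
  have hconst : Subsingleton E ∨
      K < ‖((ContinuousLinearEquiv.refl ℝ E).symm : E →L[ℝ] E)‖₊⁻¹ := by
    rcases subsingleton_or_nontrivial E with h | h
    · exact Or.inl h
    · have hnorm : ‖ContinuousLinearMap.id ℝ E‖₊ = 1 := nnnorm_one (G := E →L[ℝ] E)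
      exact Or.inr (by simpa [hnorm] using hK)
  exact ⟨injOn_univ.1 (happrox.injOn hconst), happrox.surjective hconst⟩

theorem image_eq_of_bijective_of_eq_self {X : Type*} {F : X → X} (hF : Function.Bijective F)
    {K : Set X} (h : ∀ x ∉ K, F x = x) : F '' K = K := by
  have hcompl : F '' Kᶜ = Kᶜ := by
    simpa using image_congr (s := Kᶜ) (f := F) (g := id) h
  rw [← compl_inj_iff, ← image_compl_eq hF, hcompl]

theorem eventually_setIntegral_comp_id_add_smul [FiniteDimensional ℝ E] [MeasurableSpace E]
    [BorelSpace E] {μ : Measure E} [μ.IsAddHaarMeasure] {g : E → E} (hg : ContDiff ℝ 1 g)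
    {K : Set E} (hK : IsCompact K) (hgK : ∀ x ∉ K, g x = 0) :
    ∀ᶠ t : ℝ in 𝓝 0, ∀ φ : E → ℝ,
      ∫ x in K, φ (x + t • g x) * (ContinuousLinearMap.id ℝ E + t • fderiv ℝ g x).det ∂μ =
        ∫ x in K, φ x ∂μ := by
  obtain ⟨L, hL⟩ :=
    ContDiff.lipschitzWith_of_hasCompactSupport (HasCompactSupport.intro hK hgK) hg one_ne_zero
  obtain ⟨δ, hδ, hdet⟩ := Metric.eventually_nhds_iff.1 (eventually_det_id_add_pos (E := E))
  have hnorm : Tendsto (fun t : ℝ => ‖t‖₊ * L) (𝓝 0) (𝓝 0) :=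
    (continuous_nnnorm.mul continuous_const).tendsto' 0 0 (by simp)
  filter_upwards [hnorm.eventually_lt_const one_pos,
    hnorm.eventually_lt_const (Real.toNNReal_pos.2 hδ)] with t htL htδ φ
  have hbij : Function.Bijective fun x => x + t • g x :=
    bijective_id_add_of_lipschitzWith htL ((lipschitzWith_smul t).comp hL)
  have hderiv (x : E) : HasFDerivAt (fun x => x + t • g x)
      (ContinuousLinearMap.id ℝ E + t • fderiv ℝ g x) x :=
    (hasFDerivAt_id x).add ((hg.differentiable one_ne_zero x).hasFDerivAt.const_smul t)
  have hpos (x : E) : 0 < (ContinuousLinearMap.id ℝ E + t • fderiv ℝ g x).det := by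
    refine hdet ?_
    calc dist (t • fderiv ℝ g x) 0 = ‖t‖ * ‖fderiv ℝ g x‖ := by rw [dist_zero_right, norm_smul]
      _ ≤ ‖t‖ * L := by gcongr; exact norm_fderiv_le_of_lipschitz ℝ hL
      _ < δ := by simpa using (Real.lt_toNNReal_iff_coe_lt).1 htδ
  calc _ = ∫ x in K,
          |(ContinuousLinearMap.id ℝ E + t • fderiv ℝ g x).det| • φ (x + t • g x) ∂μ := by
        simp only [abs_of_pos (hpos _), smul_eq_mul, mul_comm]
    _ = ∫ x in (fun x => x + t • g x) '' K, φ x ∂μ :=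
        (integral_image_eq_integral_abs_det_fderiv_smul μ hK.measurableSet
          (fun x _ => (hderiv x).hasFDerivWithinAt) hbij.1.injOn φ).symm
    _ = ∫ x in K, φ x ∂μ := by
        rw [image_eq_of_bijective_of_eq_self hbij fun x hx => by simp [hgK x hx]]

end SmallPerturbation

theorem det_eq_matrix_det (A : 𝔼 →L[ℝ] 𝔼) :
    A.det = (Matrix.of fun i j => A (EuclideanSpace.single j 1) i).det := by
  rw [ContinuousLinearMap.det,
    ← LinearMap.det_toMatrix (EuclideanSpace.basisFun (Fin n) ℝ).toBasis]
  congr 1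

theorem continuous_det_fderiv {f : 𝔼 → 𝔼} (hf : ContDiff ℝ 1 f) :
    Continuous fun x => (fderiv ℝ f x).det :=
  ContinuousLinearMap.continuous_det.comp (hf.continuous_fderiv one_ne_zero)

section DegreeFormula

open Polynomial

theorem exists_polynomial_setIntegral_eval {S : Type*} [TopologicalSpace S] [T2Space S]
    [MeasurableSpace S] [OpensMeasurableSpace S] {μ : Measure S} [IsFiniteMeasureOnCompacts μ]
    (q : C(S, ℝ)[X]) {K : Set S} (hK : IsCompact K) :
    ∃ Q : ℝ[X], ∀ t : ℝ, ∫ x in K, (q.eval (ContinuousMap.const S t)) x ∂μ = Q.eval t := by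
  refine ⟨∑ i ∈ Finset.range (q.natDegree + 1), C (∫ x in K, q.coeff i x ∂μ) * X ^ i, fun t => ?_⟩
  rw [eval_finsetSum]
  simp only [eval_eq_sum_range (p := q), ContinuousMap.coe_sum, ContinuousMap.coe_mul,
    Finset.sum_apply, Pi.mul_apply, ContinuousMap.coe_pow, Pi.pow_apply, ContinuousMap.const_apply]
  rw [integral_finsetSum]
  · simp only [eval_mul, eval_C, eval_pow, eval_X, integral_mul_const]
  · intro i _
    exact ((q.coeff i).continuous.mul continuous_const).continuousOn.integrableOn_compact hK

theorem exists_polynomial_eval_comp_id_add_smul_mul_det {g : 𝔼 → 𝔼} (hg : ContDiff ℝ 1 g)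
    (p : MvPolynomial (Fin n) ℝ) :
    ∃ q : C(𝔼, ℝ)[X], ∀ (t : ℝ) (x : 𝔼), (q.eval (ContinuousMap.const 𝔼 t)) x =
      MvPolynomial.eval (fun i => (x + t • g x) i) p *
        (ContinuousLinearMap.id ℝ 𝔼 + t • fderiv ℝ g x).det := by
  have : Continuous (fderiv ℝ g) := hg.continuous_fderiv one_ne_zero
  have := hg.continuous
  let w : Fin n → C(𝔼, ℝ)[X] := fun i =>
    C ⟨fun x => x i, by fun_prop⟩ + X * C ⟨fun x => g x i, by fun_prop⟩
  let D : Matrix (Fin n) (Fin n) C(𝔼, ℝ)[X] := Matrix.of fun i j =>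
    C (ContinuousMap.const 𝔼 ((EuclideanSpace.single j (1 : ℝ) : 𝔼) i)) +
      X * C ⟨fun x => fderiv ℝ g x (EuclideanSpace.single j 1) i, by fun_prop⟩
  refine ⟨MvPolynomial.aeval w p * D.det, fun t x => ?_⟩
  let e : C(𝔼, ℝ)[X] →+* ℝ :=
    (Pi.evalRingHom (fun _ : 𝔼 => ℝ) x).comp
      (ContinuousMap.coeFnRingHom.comp (evalRingHom (ContinuousMap.const 𝔼 t)))
  have he (q : C(𝔼, ℝ)[X]) : (q.eval (ContinuousMap.const 𝔼 t)) x = e q := rfl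
  rw [he, map_mul, det_eq_matrix_det]
  congr 1
  · have halg : e.comp (algebraMap ℝ C(𝔼, ℝ)[X]) = RingHom.id ℝ := Subsingleton.elim _ _
    rw [MvPolynomial.aeval_def, MvPolynomial.hom_eval₂, halg, MvPolynomial.eval,
      MvPolynomial.coe_eval₂Hom]
    congr 1
    ext i
    simp [← he, w]
    ring
  · rw [RingHom.map_det]
    congr 1
    ext i j
    simp [RingHom.mapMatrix_apply, Matrix.map_apply, ← he, D]
    ring

variable {g : EuclideanSpace ℝ (Fin n) → EuclideanSpace ℝ (Fin n)}
  {K : Set (EuclideanSpace ℝ (Fin n))}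

-- Both sides are polynomials in `t` for `x + t • g x`, and they agree for small `t`.
theorem setIntegral_mvPolynomial_comp_id_add (hg : ContDiff ℝ 1 g) (hK : IsCompact K)
    (hgK : ∀ x ∉ K, g x = 0) (p : MvPolynomial (Fin n) ℝ) :
    ∫ x in K, MvPolynomial.eval (fun i => (x + g x) i) p *
        (ContinuousLinearMap.id ℝ 𝔼 + fderiv ℝ g x).det =
      ∫ x in K, MvPolynomial.eval (fun i => x i) p := by
  obtain ⟨q, hq⟩ := exists_polynomial_eval_comp_id_add_smul_mul_det hg p
  obtain ⟨Q, hQ⟩ := exists_polynomial_setIntegral_eval (μ := volume) q hK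
  simp only [hq] at hQ
  have hconst : Q = C (∫ x in K, MvPolynomial.eval (fun i => x i) p) := by
    have hsmall := eventually_setIntegral_comp_id_add_smul (μ := volume) hg hK hgK
    refine eq_of_infinite_eval_eq _ _ ((infinite_of_mem_nhds 0 hsmall).mono fun t ht => ?_)
    rw [mem_ofPred_eq, eval_C, ← hQ t, ht fun x => MvPolynomial.eval (fun i => x i) p]
  simpa [hconst] using hQ 1

theorem exists_mvPolynomial_near (hK : IsCompact K) {φ : 𝔼 → ℝ}
    (hφ : ContinuousOn φ K) {ε : ℝ} (hε : 0 < ε) :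
    ∃ p : MvPolynomial (Fin n) ℝ, ∀ x ∈ K, |MvPolynomial.eval (fun i => x i) p - φ x| < ε := by
  have := isCompact_iff_compactSpace.1 hK
  let coord : Fin n → C(K, ℝ) := fun i => ⟨fun x => (x : 𝔼) i, by fun_prop⟩
  have heval (p : MvPolynomial (Fin n) ℝ) (x : K) : (MvPolynomial.aeval (R := ℝ) coord p) x =
      MvPolynomial.eval (fun i => (x : 𝔼) i) p := by
    induction p using MvPolynomial.induction_on with
    | C a => simp
    | add p q hp hq => simp [hp, hq]
    | mul_X p i hp => simp [hp, coord]
  have hsep : (MvPolynomial.aeval (R := ℝ) coord).range.SeparatesPoints := fun x y hxy => by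
    obtain ⟨i, hi⟩ : ∃ i, (x : 𝔼) i ≠ (y : 𝔼) i := by
      by_contra! hcoord
      exact hxy (Subtype.ext (PiLp.ext hcoord))
    exact ⟨coord i, ⟨coord i, ⟨MvPolynomial.X i, by simp⟩, rfl⟩, hi⟩
  obtain ⟨⟨_, ⟨p, rfl⟩⟩, hp⟩ :=
    ContinuousMap.exists_mem_subalgebra_near_continuous_of_separatesPoints _ hsep
    (K.domRestrict φ) (continuousOn_iff_continuous_domRestrict.1 hφ) ε hε
  exact ⟨p, fun x hx => by simpa [heval] using hp ⟨x, hx⟩⟩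

theorem exists_seq_mvPolynomial_tendstoUniformlyOn (hK : IsCompact K) {φ : 𝔼 → ℝ}
    (hφ : ContinuousOn φ K) :
    ∃ p : ℕ → MvPolynomial (Fin n) ℝ,
      TendstoUniformlyOn (fun k x => MvPolynomial.eval (fun i => x i) (p k)) φ atTop K := by
  choose p hp using fun k : ℕ => exists_mvPolynomial_near hK hφ (ε := 1 / ((k : ℝ) + 1))
    (by positivity)
  refine ⟨p, Metric.tendstoUniformlyOn_iff.2 fun ε hε => ?_⟩
  filter_upwards [tendsto_one_div_add_atTop_nhds_zero_nat.eventually_lt_const hε] with k hk x hx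
  rw [dist_comm, Real.dist_eq]
  exact (hp k x hx).trans hk

theorem setIntegral_comp_id_add_mul_det (hg : ContDiff ℝ 1 g) (hK : IsCompact K)
    (hgK : ∀ x ∉ K, g x = 0) {φ : 𝔼 → ℝ} (hφ : Continuous φ) :
    ∫ x in K, φ (x + g x) * (ContinuousLinearMap.id ℝ 𝔼 + fderiv ℝ g x).det =
      ∫ x in K, φ x := by
  set F : 𝔼 → 𝔼 := fun x => x + g x
  have hF : Continuous F := continuous_id.add hg.continuous
  have hdet : Continuous fun x => (ContinuousLinearMap.id ℝ 𝔼 + fderiv ℝ g x).det :=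
    ContinuousLinearMap.continuous_det.comp
      (continuous_const.add (hg.continuous_fderiv one_ne_zero))
  obtain ⟨p, hp⟩ := exists_seq_mvPolynomial_tendstoUniformlyOn (hK.union (hK.image hF))
    hφ.continuousOn
  have hpcont (k : ℕ) : Continuous fun x : 𝔼 => MvPolynomial.eval (fun i => x i) (p k) :=
    (MvPolynomial.continuous_eval (p k)).comp (by fun_prop)
  have hlim {G : 𝔼 → 𝔼} (hG : Continuous G) (hGK : MapsTo G K (K ∪ F '' K)) {d : 𝔼 → ℝ}
      (hd : Continuous d) : Tendsto
        (fun k => ∫ x in K, MvPolynomial.eval (fun i => G x i) (p k) * d x) atTop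
        (𝓝 (∫ x in K, φ (G x) * d x)) :=
    tendsto_setIntegral_mul hK Subset.rfl
      (Eventually.of_forall fun k => ((hpcont k).comp hG).continuousOn)
      (hφ.comp hG).continuousOn
      ((hp.comp G).mono hGK)
      (Eventually.of_forall fun _ => hd.continuousOn.integrableOn_compact hK)
      (hd.continuousOn.integrableOn_compact hK) (by simp)
  have hlimF := hlim hF (fun x hx => Or.inr ⟨x, hx, rfl⟩) hdet
  have hlimId := hlim continuous_id (fun x hx => Or.inl hx) (continuous_const (y := (1 : ℝ)))
  simp only [mul_one, id] at hlimId
  refine tendsto_nhds_unique hlimF (hlimId.congr fun k => ?_)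
  exact (setIntegral_mvPolynomial_comp_id_add hg hK hgK (p k)).symm

end DegreeFormula

/-! ### Homotopy invariance of the degree -/

theorem setIntegral_eq_iff_of_eqOn_sdiff {X : Type*} [MeasurableSpace X] {μ : Measure X}
    {u v : X → ℝ} {S T : Set X} (hS : MeasurableSet S) (hST : S ⊆ T) (hT : MeasurableSet T)
    (hu : IntegrableOn u T μ) (hv : IntegrableOn v T μ) (huv : EqOn u v (T \ S)) :
    ∫ x in T, u x ∂μ = ∫ x in T, v x ∂μ ↔ ∫ x in S, u x ∂μ = ∫ x in S, v x ∂μ := by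
  rw [← integral_inter_add_sdiff hS hu, ← integral_inter_add_sdiff hS hv, inter_eq_right.2 hST,
    setIntegral_congr_fun (hT.diff hS) huv, add_left_inj]

section Homotopy

theorem exists_contDiff_zero_nhds_one_nhds {s t : Set 𝔼} (hs : IsClosed s) (ht : IsClosed t)
    (hst : Disjoint s t) : ∃ χ : 𝔼 → ℝ, ContDiff ℝ 1 χ ∧ (∀ x ∈ s, χ =ᶠ[𝓝 x] 0) ∧
      (∀ x ∈ t, χ =ᶠ[𝓝 x] 1) ∧ ∀ x, χ x ∈ Icc (0 : ℝ) 1 := by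
  obtain ⟨χ, h0, h1, h01⟩ := exists_contMDiffMap_zero_one_nhds_of_isClosed
    (modelWithCornersSelf ℝ 𝔼) (n := 1) hs ht hst
  exact ⟨χ, χ.contMDiff.contDiff, eventually_nhdsSet_iff_forall.1 h0,
    eventually_nhdsSet_iff_forall.1 h1, h01⟩

variable {f₀ f₁ : EuclideanSpace ℝ (Fin n) → EuclideanSpace ℝ (Fin n)}
  {φ : EuclideanSpace ℝ (Fin n) → ℝ}

theorem comp_mul_det_fderiv_congr {x : 𝔼} (h : f₀ =ᶠ[𝓝 x] f₁) :
    φ (f₀ x) * (fderiv ℝ f₀ x).det = φ (f₁ x) * (fderiv ℝ f₁ x).det := by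
  rw [h.fderiv_eq, h.eq_of_nhds]

theorem continuous_comp_mul_det_fderiv (h₀ : ContDiff ℝ 1 f₀) (hφ : Continuous φ) :
    Continuous fun x => φ (f₀ x) * (fderiv ℝ f₀ x).det :=
  (hφ.comp h₀.continuous).mul (continuous_det_fderiv h₀)

theorem setIntegral_comp_mul_det_congr (h₀ : ContDiff ℝ 1 f₀) (h₁ : ContDiff ℝ 1 f₁)
    {K : Set 𝔼} (hK : IsCompact K) (hf : EqOn f₀ f₁ Kᶜ) (hφ : Continuous φ) :
    ∫ x in K, φ (f₀ x) * (fderiv ℝ f₀ x).det = ∫ x in K, φ (f₁ x) * (fderiv ℝ f₁ x).det := by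
  obtain ⟨L, hL, hKL⟩ := exists_compact_superset hK
  obtain ⟨χ, hχ, hχ0, hχ1, -⟩ := exists_contDiff_zero_nhds_one_nhds
    isOpen_interior.isClosed_compl hK.isClosed (disjoint_compl_left_iff_subset.2 hKL)
  let g : (𝔼 → 𝔼) → 𝔼 → 𝔼 := fun f x => χ x • (f x - x)
  let u : (𝔼 → 𝔼) → 𝔼 → ℝ := fun f x =>
    φ (x + g f x) * (fderiv ℝ (fun x => x + g f x) x).det
  have hg {f : 𝔼 → 𝔼} (h : ContDiff ℝ 1 f) : ContDiff ℝ 1 (g f) := hχ.smul (h.sub contDiff_id)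
  have hLint {f : 𝔼 → 𝔼} (h : ContDiff ℝ 1 f) : ∫ x in L, u f x = ∫ x in L, φ x := by
    have hderiv (x : 𝔼) : fderiv ℝ (fun x => x + g f x) x =
        ContinuousLinearMap.id ℝ 𝔼 + fderiv ℝ (g f) x :=
      ((hasFDerivAt_id x).add ((hg h).differentiable one_ne_zero x).hasFDerivAt).fderiv
    simp only [u, hderiv]
    exact setIntegral_comp_id_add_mul_det (hg h) hL
      (fun x hx => by simp [g, (hχ0 x fun hxL => hx (interior_subset hxL)).eq_of_nhds]) hφ
  have hintegrable {f : 𝔼 → 𝔼} (h : ContDiff ℝ 1 f) : IntegrableOn (u f) L :=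
    (continuous_comp_mul_det_fderiv (contDiff_id.add (hg h)) hφ).continuousOn.integrableOn_compact
      hL
  have hu (f : 𝔼 → 𝔼) : EqOn (u f) (fun x => φ (f x) * (fderiv ℝ f x).det) K := fun x hx =>
    comp_mul_det_fderiv_congr (f₀ := fun x => x + g f x) <| by
      filter_upwards [hχ1 x hx] with z hz
      simp [g, hz]
  have hoff : EqOn (u f₀) (u f₁) (L \ K) := fun x hx => comp_mul_det_fderiv_congr
      (f₀ := fun x => x + g f₀ x) (f₁ := fun x => x + g f₁ x) <| by
    filter_upwards [hK.isClosed.isOpen_compl.mem_nhds hx.2] with z hz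
    simp only [g, hf hz]
  rw [← setIntegral_congr_fun hK.measurableSet (hu f₀),
    ← setIntegral_congr_fun hK.measurableSet (hu f₁),
    ← setIntegral_eq_iff_of_eqOn_sdiff hK.measurableSet (hKL.trans interior_subset)
      hL.measurableSet (hintegrable h₀) (hintegrable h₁) hoff, hLint h₀, hLint h₁]

theorem isClosed_setOf_exists_lineMap_mem (h₀ : Continuous f₀) (h₁ : Continuous f₁) {C T : Set 𝔼}
    (hC : IsCompact C) (hT : IsClosed T) :
    IsClosed {x ∈ C | ∃ a ∈ Icc (0 : ℝ) 1, AffineMap.lineMap (f₀ x) (f₁ x) a ∈ T} := by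
  have hcont : Continuous fun p : 𝔼 × ℝ => AffineMap.lineMap (f₀ p.1) (f₁ p.1) p.2 := by
    simp only [AffineMap.lineMap_apply]
    fun_prop
  have hcompact := (hC.prod (isCompact_Icc (a := (0 : ℝ)) (b := 1))).inter_right (hT.preimage hcont)
  convert (hcompact.image continuous_fst).isClosed using 1
  ext x
  simp [and_assoc]

theorem setIntegral_comp_mul_det_eq_of_homotopy (h₀ : ContDiff ℝ 1 f₀) (h₁ : ContDiff ℝ 1 f₁)
    {C V : Set 𝔼} (hC : IsCompact C) (hV : IsOpen V) (hVC : V ⊆ C) (hφ : Continuous φ)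
    (hmiss : ∀ x ∈ C \ V, ∀ a ∈ Icc (0 : ℝ) 1, AffineMap.lineMap (f₀ x) (f₁ x) a ∉ tsupport φ) :
    ∫ x in V, φ (f₀ x) * (fderiv ℝ f₀ x).det = ∫ x in V, φ (f₁ x) * (fderiv ℝ f₁ x).det := by
  set K := {x ∈ C | ∃ a ∈ Icc (0 : ℝ) 1, AffineMap.lineMap (f₀ x) (f₁ x) a ∈ tsupport φ}
  have hK : IsClosed K := isClosed_setOf_exists_lineMap_mem h₀.continuous h₁.continuous hC
    (isClosed_tsupport φ)
  have hKV : K ⊆ V := fun x ⟨hxC, a, ha, hx⟩ => by_contra fun hxV => hmiss x ⟨hxC, hxV⟩ a ha hx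
  have hφK {x : 𝔼} (hx : x ∈ V \ K) {a : ℝ} (ha : a ∈ Icc (0 : ℝ) 1) :
      φ (AffineMap.lineMap (f₀ x) (f₁ x) a) = 0 :=
    image_eq_zero_of_notMem_tsupport fun h => hx.2 ⟨hVC hx.1, a, ha, h⟩
  obtain ⟨χ, hχ, hχ0, hχ1, hχI⟩ := exists_contDiff_zero_nhds_one_nhds hV.isClosed_compl hK
    (disjoint_compl_left_iff_subset.2 hKV)
  have hχV : tsupport χ ⊆ V := fun x hx => by_contra fun hxV =>
    notMem_tsupport_iff_eventuallyEq.2 (hχ0 x hxV) hx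
  set f : 𝔼 → 𝔼 := fun x => AffineMap.lineMap (f₀ x) (f₁ x) (χ x)
  have hf_apply (x : 𝔼) : f x = χ x • (f₁ x - f₀ x) + f₀ x := AffineMap.lineMap_apply_module' _ _ _
  have hf : ContDiff ℝ 1 f := by
    simp only [funext hf_apply]
    exact (hχ.smul (h₁.sub h₀)).add h₀
  have hff₀ {x : 𝔼} (hx : x ∉ tsupport χ) : f₀ =ᶠ[𝓝 x] f := by
    filter_upwards [notMem_tsupport_iff_eventuallyEq.1 hx] with z hz
    simp [hf_apply, hz]
  have hintegrable {u : 𝔼 → ℝ} (hu : Continuous u) : IntegrableOn u V :=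
    (hu.continuousOn.integrableOn_compact hC).mono_set hVC
  have hχC : IsCompact (tsupport χ) := hC.of_isClosed_subset (isClosed_tsupport χ) (hχV.trans hVC)
  calc _ = ∫ x in V, φ (f x) * (fderiv ℝ f x).det :=
        (setIntegral_eq_iff_of_eqOn_sdiff hχC.measurableSet hχV hV.measurableSet
          (hintegrable (continuous_comp_mul_det_fderiv h₀ hφ))
          (hintegrable (continuous_comp_mul_det_fderiv hf hφ))
          fun x hx => comp_mul_det_fderiv_congr (hff₀ hx.2)).2
          (setIntegral_comp_mul_det_congr h₀ hf hχC (fun x hx => (hff₀ hx).eq_of_nhds) hφ)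
    _ = _ := setIntegral_congr_fun hV.measurableSet fun x hx => by
        by_cases hxK : x ∈ K
        · refine comp_mul_det_fderiv_congr ?_
          filter_upwards [hχ1 x hxK] with z hz
          simp [hf_apply, hz]
        · have hfx : φ (f x) = 0 := hφK ⟨hx, hxK⟩ (hχI x)
          have hf₁x : φ (f₁ x) = 0 := by simpa using hφK ⟨hx, hxK⟩ (right_mem_Icc.2 zero_le_one)
          simp only [hfx, hf₁x, zero_mul]

theorem tsupport_subset_closedBall {X : Type*} [PseudoMetricSpace X] {u : X → ℝ} {z₀ : X} {r : ℝ}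
    (hu : ∀ z, u z ≠ 0 → dist z z₀ ≤ r) : tsupport u ⊆ Metric.closedBall z₀ r :=
  closure_minimal hu Metric.isClosed_closedBall

theorem setIntegral_comp_mul_det_of_near_id {F : 𝔼 → 𝔼} (hF : ContDiff ℝ 1 F) {x₀ : 𝔼} {s : ℝ}
    (hs : 0 < s) (hnear : ∀ x ∈ Metric.sphere x₀ (2 * s), dist (F x) x < s)
    (hφ : Continuous φ) (hsupp : ∀ x, φ x ≠ 0 → dist x x₀ ≤ s) :
    ∫ x in Metric.ball x₀ (2 * s), φ (F x) * (fderiv ℝ F x).det = ∫ x, φ x := by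
  rw [setIntegral_comp_mul_det_eq_of_homotopy hF contDiff_id (isCompact_closedBall x₀ (2 * s))
    Metric.isOpen_ball Metric.ball_subset_closedBall hφ fun x hx a ha hsup => ?_]
  · simp only [id, fderiv_id, ContinuousLinearMap.det, ContinuousLinearMap.coe_id,
      LinearMap.det_id, mul_one]
    refine setIntegral_eq_integral_of_forall_compl_eq_zero fun x hx => by_contra fun hne => hx ?_
    exact Metric.mem_ball.2 ((hsupp x hne).trans_lt (by linarith))
  · rw [Metric.closedBall_sdiff_ball] at hx
    have hdist : dist (AffineMap.lineMap (F x) x a) x < s := by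
      rw [dist_lineMap_right, Real.norm_eq_abs, abs_of_nonneg (sub_nonneg.2 ha.2)]
      nlinarith [hnear x hx, ha.1, dist_nonneg (x := F x) (y := x)]
    have := dist_triangle_left x x₀ (AffineMap.lineMap (F x) x a)
    have hball := tsupport_subset_closedBall hsupp hsup
    simp only [id, Metric.mem_closedBall, Metric.mem_sphere] at hball hx
    linarith

theorem setIntegral_comp_add_mul_det {f : 𝔼 → 𝔼} (hf : ContDiff ℝ 1 f) {C V : Set 𝔼}
    (hC : IsCompact C) (hV : IsOpen V) (hVC : V ⊆ C) {z₀ : 𝔼} {r : ℝ} (hr : 0 < r)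
    (hfar : ∀ x ∈ C \ V, 3 * r ≤ dist (f x) z₀) (hφ : Continuous φ)
    (hsupp : ∀ z, φ z ≠ 0 → dist z z₀ ≤ r) {v : 𝔼} (hv : ‖v‖ ≤ r) :
    ∫ x in V, φ (f x + v) * (fderiv ℝ f x).det = ∫ x in V, φ (f x) * (fderiv ℝ f x).det := by
  rw [setIntegral_comp_mul_det_eq_of_homotopy hf (hf.add (contDiff_const (c := v))) hC hV hVC hφ
    fun x hx a ha hsup => ?_]
  · simp only [fderiv_add_const]
  · have hdist : dist (f x) (AffineMap.lineMap (f x) (f x + v) a) ≤ r := by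
      rw [dist_left_lineMap, dist_self_add_right, Real.norm_eq_abs, abs_of_nonneg ha.1]
      nlinarith [ha.1, ha.2, norm_nonneg v]
    have := dist_triangle (f x) (AffineMap.lineMap (f x) (f x + v) a) z₀
    linarith [hfar x hx, Metric.mem_closedBall.1 (tsupport_subset_closedBall hsupp hsup)]

end Homotopy

/-! ### The degree over a ball -/

section LocalDegree

/-- `F` has degree `c` over the open ball of centre `z₀` and radius `r`, in integral form: on that
ball, the push-forward under `F` of the signed measure `J dx` on `S` is `c` times Lebesgue measure.
If `F` is `C¹` and `J = det DF`, then `c` is the Brouwer degree. -/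
def HasDegreeOn (S : Set 𝔼) (F : 𝔼 → 𝔼) (J : 𝔼 → ℝ) (z₀ : 𝔼) (r c : ℝ) : Prop :=
  ∀ φ : 𝔼 → ℝ, Continuous φ → (∀ z, φ z ≠ 0 → dist z z₀ < r) →
    ∫ x in S, φ (F x) * J x = c * ∫ z, φ z

variable {F : EuclideanSpace ℝ (Fin n) → EuclideanSpace ℝ (Fin n)}
  {J : EuclideanSpace ℝ (Fin n) → ℝ} {S : Set (EuclideanSpace ℝ (Fin n))}
  {z₀ : EuclideanSpace ℝ (Fin n)} {r c : ℝ}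

theorem HasDegreeOn.mono_radius (h : HasDegreeOn S F J z₀ r c) {a : ℝ} (har : a ≤ r) :
    HasDegreeOn S F J z₀ a c :=
  fun φ hφ hs => h φ hφ fun z hz => (hs z hz).trans_le har

theorem HasDegreeOn.of_subset (h : HasDegreeOn S F J z₀ r c) {T : Set 𝔼} (hST : S ⊆ T)
    (hT : MeasurableSet T) (hF : ∀ x ∈ T \ S, r ≤ dist (F x) z₀) : HasDegreeOn T F J z₀ r c :=
  fun φ hφ hs => by
    rw [← h φ hφ hs]
    refine setIntegral_eq_of_subset_of_forall_sdiff_eq_zero hT hST fun x hx => ?_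
    have hφx : φ (F x) = 0 := by_contra fun hne => (hF x hx).not_gt (hs _ hne)
    rw [hφx, zero_mul]

theorem hasCompactSupport_of_forall_dist_le {φ : 𝔼 → ℝ} (hs : ∀ z, φ z ≠ 0 → dist z z₀ ≤ r) :
    HasCompactSupport φ :=
  (isCompact_closedBall z₀ r).of_isClosed_subset (isClosed_tsupport φ)
    (tsupport_subset_closedBall hs)

theorem integral_mul_integral_comp_sub {X : Type*} [MeasurableSpace X] {μ : Measure X} [SFinite μ]
    {F : X → 𝔼} {J : X → ℝ} (hF : AEMeasurable F μ) (hJ : Integrable J μ) {φ ψ : 𝔼 → ℝ}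
    (hφ : Continuous φ) (hφs : HasCompactSupport φ) (hψ : Continuous ψ)
    (hψs : HasCompactSupport ψ) :
    ∫ v, ψ v * ∫ x, φ (F x - v) * J x ∂μ = ∫ x, (∫ v, ψ v * φ (F x - v)) * J x ∂μ := by
  obtain ⟨M, hM⟩ := hφs.exists_bound_of_continuous hφ
  have hintegrable : Integrable (fun p : 𝔼 × X => φ (F p.2 - p.1) * (ψ p.1 * J p.2))
      (volume.prod μ) :=
    ((hψ.integrable_of_hasCompactSupport hψs).mul_prod hJ).bdd_mul
      (hφ.comp_aestronglyMeasurable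
        (hF.comp_snd.sub measurable_fst.aemeasurable).aestronglyMeasurable)
      (Eventually.of_forall fun p => hM _)
  calc ∫ v, ψ v * ∫ x, φ (F x - v) * J x ∂μ
      = ∫ v, ∫ x, φ (F x - v) * (ψ v * J x) ∂μ ∂volume := by
        congr! 2 with v
        rw [← integral_const_mul]
        simp only [mul_left_comm]
    _ = ∫ x, (∫ v, φ (F x - v) * (ψ v * J x)) ∂μ := integral_integral_swap hintegrable
    _ = ∫ x, (∫ v, ψ v * φ (F x - v)) * J x ∂μ := by
        congr! 2 with x
        rw [← integral_mul_const]
        simp only [mul_left_comm, mul_assoc]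

theorem integral_mul_integral_comp_sub_comm {X : Type*} [MeasurableSpace X] {μ : Measure X}
    [SFinite μ] {F : X → 𝔼} {J : X → ℝ} (hF : AEMeasurable F μ) (hJ : Integrable J μ)
    {φ ψ : 𝔼 → ℝ} (hφ : Continuous φ) (hφs : HasCompactSupport φ) (hψ : Continuous ψ)
    (hψs : HasCompactSupport ψ) :
    ∫ v, ψ v * ∫ x, φ (F x - v) * J x ∂μ = ∫ w, φ w * ∫ x, ψ (F x - w) * J x ∂μ := by
  rw [integral_mul_integral_comp_sub hF hJ hφ hφs hψ hψs,
    integral_mul_integral_comp_sub hF hJ hψ hψs hφ hφs]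
  congr! 3 with x
  rw [← integral_sub_left_eq_self (fun w => φ w * ψ (F x - w)) volume (F x)]
  simp only [sub_sub_cancel, mul_comm]

theorem exists_hasDegreeOn_of_translation_invariant (hr : 0 < r)
    (hF : AEMeasurable F (volume.restrict S)) (hJ : IntegrableOn J S)
    (hinv : ∀ φ : 𝔼 → ℝ, Continuous φ → (∀ z, φ z ≠ 0 → dist z z₀ < r) → ∀ v : 𝔼, ‖v‖ < r →
      ∫ x in S, φ (F x - v) * J x = ∫ x in S, φ (F x) * J x) :
    ∃ c, HasDegreeOn S F J z₀ r c := by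
  let b : ContDiffBump (0 : 𝔼) := ⟨r / 2, r, by linarith, by linarith⟩
  set ψ : 𝔼 → ℝ := b.normed volume
  have hψ : Continuous ψ := b.continuous_normed
  have hψs (v : 𝔼) (hv : ψ v ≠ 0) : ‖v‖ < r := by
    have hball : v ∈ Function.support ψ := hv
    rw [b.support_normed_eq] at hball
    exact mem_ball_zero_iff.1 hball
  refine ⟨∫ x in S, ψ (F x - z₀) * J x, fun φ hφ hs => ?_⟩
  calc ∫ x in S, φ (F x) * J x = ∫ v, ψ v * ∫ x in S, φ (F x) * J x := by
        rw [integral_mul_const, b.integral_normed, one_mul]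
    _ = ∫ v, ψ v * ∫ x in S, φ (F x - v) * J x := by
        congr! 2 with v
        by_cases hv : ψ v = 0
        · simp only [hv, zero_mul]
        · rw [hinv φ hφ hs v (hψs v hv)]
    _ = ∫ w, φ w * ∫ x in S, ψ (F x - w) * J x :=
        integral_mul_integral_comp_sub_comm hF hJ hφ
          (hasCompactSupport_of_forall_dist_le fun z hz => (hs z hz).le) hψ
          b.hasCompactSupport_normed
    _ = ∫ w, φ w * ∫ x in S, ψ (F x - z₀) * J x := by
        congr! 2 with w
        by_cases hw : φ w = 0
        · simp only [hw, zero_mul]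
        · rw [← hinv (fun z => ψ (z - z₀)) (by fun_prop)
            (fun z hz => dist_eq_norm z z₀ ▸ hψs _ hz) (w - z₀) (dist_eq_norm w z₀ ▸ hs w hw)]
          simp only [sub_sub, sub_add_cancel]
    _ = (∫ x in S, ψ (F x - z₀) * J x) * ∫ z, φ z := by rw [integral_mul_const, mul_comm]

theorem exists_hasDegreeOn_of_contDiff {f : 𝔼 → 𝔼} (hf : ContDiff ℝ 1 f) {C V : Set 𝔼}
    (hC : IsCompact C) (hV : IsOpen V) (hVC : V ⊆ C) (hr : 0 < r)
    (hfar : ∀ x ∈ C \ V, 3 * r ≤ dist (f x) z₀) :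
    ∃ c, HasDegreeOn V f (fun x => (fderiv ℝ f x).det) z₀ r c := by
  refine exists_hasDegreeOn_of_translation_invariant hr hf.continuous.aemeasurable
    (((continuous_det_fderiv hf).continuousOn.integrableOn_compact hC).mono_set hVC)
    fun φ hφ hs v hv => ?_
  simp only [sub_eq_add_neg]
  exact setIntegral_comp_add_mul_det hf hC hV hVC hr hfar hφ (fun z hz => (hs z hz).le)
    ((norm_neg v).trans_le hv.le)

theorem exists_continuous_supported_integral_pos (z : 𝔼) {ρ : ℝ} (hρ : 0 < ρ) :
    ∃ φ : 𝔼 → ℝ, Continuous φ ∧ 0 ≤ φ ∧ (∀ w, φ w ≠ 0 → dist w z < ρ) ∧ 0 < ∫ w, φ w := by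
  let b : ContDiffBump z := ⟨ρ / 2, ρ, by linarith, by linarith⟩
  exact ⟨b, b.continuous, fun w => b.nonneg, fun w hw => by_contra fun hn =>
    hw (b.zero_of_le_dist (not_lt.1 hn)), b.integral_pos⟩

theorem HasDegreeOn.ball_subset_image (h : HasDegreeOn S F J z₀ r c) (hc : c ≠ 0)
    (hF : Continuous F) {C : Set 𝔼} (hC : IsCompact C) (hSC : S ⊆ C) :
    Metric.ball z₀ r ⊆ F '' C := by
  intro z hz
  by_contra hn
  obtain ⟨ρ, hρ, hρs⟩ := Metric.isOpen_iff.1 (hC.image hF).isClosed.isOpen_compl z hn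
  obtain ⟨φ, hφ, -, hφs, hφpos⟩ := exists_continuous_supported_integral_pos z
    (lt_min hρ (sub_pos.2 (Metric.mem_ball.1 hz)))
  have hdeg := h φ hφ fun w hw => by
    linarith [dist_triangle w z z₀, (hφs w hw).trans_le (min_le_right _ _)]
  rw [setIntegral_eq_zero_of_forall_eq_zero fun x hx => ?_] at hdeg
  · exact mul_ne_zero hc hφpos.ne' hdeg.symm
  · have hφx : φ (F x) = 0 := by_contra fun hne =>
      hρs ((hφs _ hne).trans_le (min_le_left _ _)) ⟨x, hSC hx, rfl⟩
    rw [hφx, zero_mul]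

theorem HasDegreeOn.volume_ball_le_lintegral_abs_det {f : 𝔼 → 𝔼} (hf : ContDiff ℝ 1 f)
    {C V : Set 𝔼} (h : HasDegreeOn V f J z₀ r c) (hc : c ≠ 0) (hC : IsCompact C) (hV : IsOpen V)
    (hVC : V ⊆ C) (hfar : ∀ x ∈ C \ V, r ≤ dist (f x) z₀) :
    volume (Metric.ball z₀ r) ≤
      ∫⁻ x in V ∩ f ⁻¹' Metric.ball z₀ r, ENNReal.ofReal |(fderiv ℝ f x).det| := by
  have hcov : Metric.ball z₀ r ⊆ f '' (V ∩ f ⁻¹' Metric.ball z₀ r) := fun z hz => by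
    obtain ⟨x, hx, rfl⟩ := h.ball_subset_image hc hf.continuous hC hVC hz
    exact ⟨x, ⟨by_contra fun hxV => (hfar x ⟨hx, hxV⟩).not_gt hz, hz⟩, rfl⟩
  exact (measure_mono hcov).trans (addHaar_image_le_lintegral_abs_det_fderiv volume
    (hV.inter (Metric.isOpen_ball.preimage hf.continuous)).measurableSet
    fun x _ => (hf.differentiable one_ne_zero x).hasFDerivAt.hasFDerivWithinAt)

end LocalDegree

/-! ### Strong limits of Jacobians -/

theorem tendstoUniformlyOn_continuous_comp {ι X Y Z : Type*} [TopologicalSpace X]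
    [PseudoMetricSpace Y] [ProperSpace Y] [UniformSpace Z] {l : Filter ι} {f : ι → X → Y}
    {y : X → Y} {g : Y → Z} {C : Set X} (hg : Continuous g) (hC : IsCompact C)
    (hy : ContinuousOn y C) (hf : TendstoUniformlyOn f y l C) :
    TendstoUniformlyOn (fun k x => g (f k x)) (fun x => g (y x)) l C := by
  have hK : IsCompact (Metric.cthickening 1 (y '' C)) := (hC.image_of_continuousOn hy).cthickening
  refine UniformContinuousOn.comp_tendstoUniformlyOn_eventually ?_ ?_
    (hK.uniformContinuousOn_of_continuous hg.continuousOn) hf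
  · filter_upwards [Metric.tendstoUniformlyOn_iff.1 hf 1 one_pos] with k hk x hx
    exact Metric.mem_cthickening_of_dist_le _ (y x) _ _ (mem_image_of_mem y hx)
      ((dist_comm _ _).trans_le (hk x hx).le)
  · exact fun x hx => Metric.self_subset_cthickening _ (mem_image_of_mem y hx)

section Limit

/-- `y : Ω₁ → Ω₂` and `ξ : Ω₂ → Ω₁` are mutually inverse homeomorphisms of open sets. -/
structure IsHomeoPair (Ω₁ Ω₂ : Set 𝔼) (y ξ : 𝔼 → 𝔼) : Prop where
  isOpen_left : IsOpen Ω₁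
  isOpen_right : IsOpen Ω₂
  mapsTo : MapsTo y Ω₁ Ω₂
  mapsTo_inv : MapsTo ξ Ω₂ Ω₁
  invOn : InvOn ξ y Ω₁ Ω₂
  continuousOn : ContinuousOn y Ω₁
  continuousOn_inv : ContinuousOn ξ Ω₂

namespace IsHomeoPair

variable {Ω₁ Ω₂ S : Set (EuclideanSpace ℝ (Fin n))}
  {y ξ : EuclideanSpace ℝ (Fin n) → EuclideanSpace ℝ (Fin n)}

theorem symm (h : IsHomeoPair Ω₁ Ω₂ y ξ) : IsHomeoPair Ω₂ Ω₁ ξ y :=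
  ⟨h.isOpen_right, h.isOpen_left, h.mapsTo_inv, h.mapsTo, h.invOn.symm, h.continuousOn_inv,
    h.continuousOn⟩

theorem image_inv_eq (h : IsHomeoPair Ω₁ Ω₂ y ξ) (hS : S ⊆ Ω₂) : ξ '' S = Ω₁ ∩ y ⁻¹' S := by
  ext x
  constructor
  · rintro ⟨z, hz, rfl⟩
    exact ⟨h.mapsTo_inv (hS hz), by rwa [mem_preimage, h.invOn.2 (hS hz)]⟩
  · rintro ⟨hx, hxS⟩
    exact ⟨y x, hxS, h.invOn.1 hx⟩

theorem isOpen_preimage (h : IsHomeoPair Ω₁ Ω₂ y ξ) (hS : IsOpen S) : IsOpen (Ω₁ ∩ y ⁻¹' S) :=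
  h.continuousOn.isOpen_inter_preimage h.isOpen_left hS

theorem isCompact_preimage (h : IsHomeoPair Ω₁ Ω₂ y ξ) (hS : IsCompact S) (hSΩ : S ⊆ Ω₂) :
    IsCompact (Ω₁ ∩ y ⁻¹' S) := by
  rw [← h.image_inv_eq hSΩ]
  exact hS.image_of_continuousOn (h.continuousOn_inv.mono hSΩ)

theorem aemeasurable (h : IsHomeoPair Ω₁ Ω₂ y ξ) : AEMeasurable y (volume.restrict Ω₁) :=
  h.continuousOn.aemeasurable h.isOpen_left.measurableSet

end IsHomeoPair

/-- The maps `f k` are `C¹`, converge to `y` locally uniformly on `Ω`, and their Jacobians converge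
to `J` in `L¹_loc(Ω)`. -/
structure JacobianApprox (Ω : Set 𝔼) (y : 𝔼 → 𝔼) (J : 𝔼 → ℝ) (f : ℕ → 𝔼 → 𝔼) : Prop where
  contDiff : ∀ k, ContDiff ℝ 1 (f k)
  tendstoUniformlyOn : ∀ C ⊆ Ω, IsCompact C → TendstoUniformlyOn f y atTop C
  integrableOn : ∀ C ⊆ Ω, IsCompact C → IntegrableOn J C
  tendsto_integral : ∀ C ⊆ Ω, IsCompact C →
    Tendsto (fun k => ∫ x in C, |(fderiv ℝ (f k) x).det - J x|) atTop (𝓝 0)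

namespace JacobianApprox

variable {Ω C V : Set (EuclideanSpace ℝ (Fin n))}
  {y : EuclideanSpace ℝ (Fin n) → EuclideanSpace ℝ (Fin n)}
  {J : EuclideanSpace ℝ (Fin n) → ℝ}
  {f : ℕ → EuclideanSpace ℝ (Fin n) → EuclideanSpace ℝ (Fin n)}

theorem integrableOn_det (h : JacobianApprox Ω y J f) (hC : IsCompact C) (k : ℕ) :
    IntegrableOn (fun x => (fderiv ℝ (f k) x).det) C :=
  (continuous_det_fderiv (h.contDiff k)).continuousOn.integrableOn_compact hC

theorem tendsto_setIntegral_comp (h : JacobianApprox Ω y J f) (hy : ContinuousOn y Ω)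
    (hC : IsCompact C) (hCΩ : C ⊆ Ω) (hVC : V ⊆ C) {φ : 𝔼 → ℝ} (hφ : Continuous φ) :
    Tendsto (fun k => ∫ x in V, φ (f k x) * (fderiv ℝ (f k) x).det) atTop
      (𝓝 (∫ x in V, φ (y x) * J x)) :=
  tendsto_setIntegral_mul hC hVC
    (Eventually.of_forall fun k => (hφ.comp (h.contDiff k).continuous).continuousOn)
    (hφ.comp_continuousOn (hy.mono hCΩ))
    (tendstoUniformlyOn_continuous_comp hφ hC (hy.mono hCΩ) (h.tendstoUniformlyOn C hCΩ hC))
    (Eventually.of_forall (h.integrableOn_det hC)) (h.integrableOn C hCΩ hC)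
    (h.tendsto_integral C hCΩ hC)

theorem eventually_forall_dist_lt (h : JacobianApprox Ω y J f) (hC : IsCompact C) (hCΩ : C ⊆ Ω)
    {ε : ℝ} (hε : 0 < ε) : ∀ᶠ k in atTop, ∀ x ∈ C, dist (y x) (f k x) < ε :=
  Metric.tendstoUniformlyOn_iff.1 (h.tendstoUniformlyOn C hCΩ hC) ε hε

theorem eventually_setLIntegral_abs_det_le (h : JacobianApprox Ω y J f) (hC : IsCompact C)
    (hCΩ : C ⊆ Ω) (hVC : V ⊆ C) {ε : ℝ≥0∞} (hε : 0 < ε) :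
    ∀ᶠ k in atTop, ∫⁻ x in V, ENNReal.ofReal |(fderiv ℝ (f k) x).det| ≤
      (∫⁻ x in V, ENNReal.ofReal |J x|) + ε := by
  have hlim := ENNReal.tendsto_ofReal (h.tendsto_integral C hCΩ hC)
  rw [ENNReal.ofReal_zero] at hlim
  filter_upwards [hlim.eventually_lt_const hε] with k hk
  have hdiff : IntegrableOn (fun x => |(fderiv ℝ (f k) x).det - J x|) C :=
    ((h.integrableOn_det hC k).sub (h.integrableOn C hCΩ hC)).abs
  rw [ofReal_integral_eq_lintegral_ofReal hdiff (Eventually.of_forall fun _ => abs_nonneg _)] at hk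
  calc ∫⁻ x in V, ENNReal.ofReal |(fderiv ℝ (f k) x).det|
      ≤ ∫⁻ x in V, (ENNReal.ofReal |J x| + ENNReal.ofReal |(fderiv ℝ (f k) x).det - J x|) := by
        refine lintegral_mono fun x => ?_
        rw [← ENNReal.ofReal_add (abs_nonneg _) (abs_nonneg _)]
        refine ENNReal.ofReal_le_ofReal ?_
        linarith [abs_sub_abs_le_abs_sub (fderiv ℝ (f k) x).det (J x)]
    _ = (∫⁻ x in V, ENNReal.ofReal |J x|) +
          ∫⁻ x in V, ENNReal.ofReal |(fderiv ℝ (f k) x).det - J x| :=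
        lintegral_add_left' (((h.integrableOn C hCΩ hC).mono_set
          hVC).aestronglyMeasurable.aemeasurable.abs.ennreal_ofReal) _
    _ ≤ _ := by
        gcongr
        exact (lintegral_mono_set hVC).trans hk.le

end JacobianApprox

variable {Ω₁ Ω₂ : Set (EuclideanSpace ℝ (Fin n))}
  {y ξ : EuclideanSpace ℝ (Fin n) → EuclideanSpace ℝ (Fin n)}
  {J : EuclideanSpace ℝ (Fin n) → ℝ}
  {f : ℕ → EuclideanSpace ℝ (Fin n) → EuclideanSpace ℝ (Fin n)}
  {z₀ : EuclideanSpace ℝ (Fin n)} {r c : ℝ}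

theorem JacobianApprox.eventually_le_dist (hf : JacobianApprox Ω₁ y J f)
    (hp : IsHomeoPair Ω₁ Ω₂ y ξ) (hr : 0 < r) (hball : Metric.closedBall z₀ (4 * r) ⊆ Ω₂) :
    ∀ᶠ k in atTop, ∀ x ∈ (Ω₁ ∩ y ⁻¹' Metric.closedBall z₀ (4 * r)) \
      (Ω₁ ∩ y ⁻¹' Metric.ball z₀ (4 * r)), 3 * r ≤ dist (f k x) z₀ := by
  filter_upwards [hf.eventually_forall_dist_lt
    (hp.isCompact_preimage (isCompact_closedBall _ _) hball) inter_subset_left hr] with k hk x hx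
  have hyx : 4 * r ≤ dist (y x) z₀ := not_lt.1 fun hlt => hx.2 ⟨hx.1.1, hlt⟩
  linarith [hk x hx.1, dist_triangle (y x) (f k x) z₀]

theorem IsHomeoPair.setIntegral_preimage_ball_comp_mul (hp : IsHomeoPair Ω₁ Ω₂ y ξ) {R : ℝ}
    {φ : 𝔼 → ℝ} (hφ : ∀ z, φ z ≠ 0 → dist z z₀ < R) :
    ∫ x in Ω₁ ∩ y ⁻¹' Metric.ball z₀ R, φ (y x) * J x = ∫ x in Ω₁, φ (y x) * J x := by
  refine (setIntegral_eq_of_subset_of_forall_sdiff_eq_zero hp.isOpen_left.measurableSet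
    inter_subset_left fun x hx => ?_).symm
  have hφx : φ (y x) = 0 := by_contra fun hne => hx.2 ⟨hx.1, hφ _ hne⟩
  rw [hφx, zero_mul]

theorem JacobianApprox.exists_hasDegreeOn (hf : JacobianApprox Ω₁ y J f)
    (hp : IsHomeoPair Ω₁ Ω₂ y ξ) (hr : 0 < r) (hball : Metric.closedBall z₀ (4 * r) ⊆ Ω₂) :
    ∃ c, HasDegreeOn Ω₁ y J z₀ r c := by
  set C := Ω₁ ∩ y ⁻¹' Metric.closedBall z₀ (4 * r)
  set V := Ω₁ ∩ y ⁻¹' Metric.ball z₀ (4 * r)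
  have hC : IsCompact C := hp.isCompact_preimage (isCompact_closedBall _ _) hball
  have hVC : V ⊆ C := inter_subset_inter_right _ (preimage_mono Metric.ball_subset_closedBall)
  have hdeg : ∃ c, HasDegreeOn V y J z₀ r c := by
    refine exists_hasDegreeOn_of_translation_invariant hr
      (hp.aemeasurable.mono_set inter_subset_left)
      ((hf.integrableOn C inter_subset_left hC).mono_set hVC) fun φ hφ hs v hv => ?_
    have hlim {u : 𝔼 → ℝ} (hu : Continuous u) :=
      hf.tendsto_setIntegral_comp hp.continuousOn hC inter_subset_left hVC hu
    refine tendsto_nhds_unique_of_eventuallyEq (hlim (u := fun z => φ (z - v)) (by fun_prop))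
      (hlim hφ) ?_
    filter_upwards [hf.eventually_le_dist hp hr hball] with k hk
    simp only [sub_eq_add_neg]
    exact setIntegral_comp_add_mul_det (hf.contDiff k) hC (hp.isOpen_preimage Metric.isOpen_ball)
      hVC hr hk hφ (fun z hz => (hs z hz).le) ((norm_neg v).trans_le hv.le)
  obtain ⟨c, hc⟩ := hdeg
  refine ⟨c, hc.of_subset inter_subset_left hp.isOpen_left.measurableSet fun x hx => ?_⟩
  have hyx : 4 * r ≤ dist (y x) z₀ := not_lt.1 fun hlt => hx.2 ⟨hx.1, hlt⟩
  linarith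

theorem JacobianApprox.eventually_exists_hasDegreeOn_ne_zero (hf : JacobianApprox Ω₁ y J f)
    (hp : IsHomeoPair Ω₁ Ω₂ y ξ) (hr : 0 < r) (hball : Metric.closedBall z₀ (4 * r) ⊆ Ω₂)
    (hdeg : HasDegreeOn Ω₁ y J z₀ r c) (hc : c ≠ 0) :
    ∀ᶠ k in atTop, ∃ c' ≠ 0, HasDegreeOn (Ω₁ ∩ y ⁻¹' Metric.ball z₀ (4 * r)) (f k)
      (fun x => (fderiv ℝ (f k) x).det) z₀ r c' := by
  have hC := hp.isCompact_preimage (isCompact_closedBall z₀ (4 * r)) hball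
  have hVC : Ω₁ ∩ y ⁻¹' Metric.ball z₀ (4 * r) ⊆ Ω₁ ∩ y ⁻¹' Metric.closedBall z₀ (4 * r) :=
    inter_subset_inter_right _ (preimage_mono Metric.ball_subset_closedBall)
  obtain ⟨φ, hφ, -, hs, hpos⟩ := exists_continuous_supported_integral_pos z₀ hr
  have hlim := hf.tendsto_setIntegral_comp hp.continuousOn hC inter_subset_left hVC hφ
  rw [hp.setIntegral_preimage_ball_comp_mul fun z hz => (hs z hz).trans (by linarith),
    hdeg φ hφ hs] at hlim
  filter_upwards [hlim.eventually_ne (mul_ne_zero hc hpos.ne'),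
    hf.eventually_le_dist hp hr hball] with k hk hfar
  obtain ⟨c', hc'⟩ := exists_hasDegreeOn_of_contDiff (hf.contDiff k) hC
    (hp.isOpen_preimage Metric.isOpen_ball) hVC hr hfar
  refine ⟨c', ?_, hc'⟩
  rintro rfl
  exact hk (by rw [hc' φ hφ hs, zero_mul])

theorem JacobianApprox.volume_ball_le_setLIntegral_abs (hf : JacobianApprox Ω₁ y J f)
    (hp : IsHomeoPair Ω₁ Ω₂ y ξ) (hr : 0 < r) (hball : Metric.closedBall z₀ (4 * r) ⊆ Ω₂)
    (hdeg : HasDegreeOn Ω₁ y J z₀ r c) (hc : c ≠ 0) {a b : ℝ} (hab : a < b) (hbr : b ≤ r) :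
    volume (Metric.ball z₀ a) ≤
      ∫⁻ x in Ω₁ ∩ y ⁻¹' Metric.ball z₀ b, ENNReal.ofReal |J x| := by
  set C := Ω₁ ∩ y ⁻¹' Metric.closedBall z₀ (4 * r)
  have hC : IsCompact C := hp.isCompact_preimage (isCompact_closedBall _ _) hball
  set V := Ω₁ ∩ y ⁻¹' Metric.ball z₀ (4 * r)
  have hV : IsOpen V := hp.isOpen_preimage Metric.isOpen_ball
  have hVC : V ⊆ C :=
    inter_subset_inter_right _ (preimage_mono Metric.ball_subset_closedBall)
  have hbC : Ω₁ ∩ y ⁻¹' Metric.ball z₀ b ⊆ C :=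
    inter_subset_inter_right _ (preimage_mono (Metric.ball_subset_closedBall.trans
      (Metric.closedBall_subset_closedBall (by linarith))))
  refine ENNReal.le_of_forall_pos_le_add fun ε hε _ => ?_
  obtain ⟨k, hk, ⟨c', hc', hdeg'⟩, hfar, hdist⟩ :=
    ((hf.eventually_setLIntegral_abs_det_le hC inter_subset_left hbC
      (ENNReal.coe_pos.2 hε)).and <|
    (hf.eventually_exists_hasDegreeOn_ne_zero hp hr hball hdeg hc).and <|
    (hf.eventually_le_dist hp hr hball).and <|
    hf.eventually_forall_dist_lt hC inter_subset_left (sub_pos.2 hab)).exists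
  have hsub : V ∩ f k ⁻¹' Metric.ball z₀ a ⊆ Ω₁ ∩ y ⁻¹' Metric.ball z₀ b := by
    rintro x ⟨hxV, hxa : dist (f k x) z₀ < a⟩
    exact ⟨hxV.1, (by linarith [hdist x (hVC hxV), dist_triangle (y x) (f k x) z₀] :
      dist (y x) z₀ < b)⟩
  calc volume (Metric.ball z₀ a)
      ≤ ∫⁻ x in V ∩ f k ⁻¹' Metric.ball z₀ a, ENNReal.ofReal |(fderiv ℝ (f k) x).det| :=
        (hdeg'.mono_radius (hab.le.trans hbr)).volume_ball_le_lintegral_abs_det (hf.contDiff k) hc'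
          hC hV hVC fun x hx => (by linarith : a ≤ 3 * r).trans (hfar x hx)
    _ ≤ ∫⁻ x in Ω₁ ∩ y ⁻¹' Metric.ball z₀ b, ENNReal.ofReal |(fderiv ℝ (f k) x).det| :=
        lintegral_mono_set hsub
    _ ≤ _ := hk

end Limit

/-! ### Mollification -/

theorem map_integral_smul_le {X F : Type*} [MeasurableSpace X] {μ : Measure X}
    [NormedAddCommGroup F] [NormedSpace ℝ F] [CompleteSpace F] {g : F → ℝ}
    (hg : ConvexOn ℝ univ g) (hgc : Continuous g) {ρ : X → ℝ} (hρ : ∀ t, 0 ≤ ρ t)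
    (hρi : Integrable ρ μ) (hρ₁ : ∫ t, ρ t ∂μ = 1) {u : X → F}
    (hu : Integrable (fun t => ρ t • u t) μ) (hgu : Integrable (fun t => ρ t • g (u t)) μ) :
    g (∫ t, ρ t • u t ∂μ) ≤ ∫ t, ρ t • g (u t) ∂μ := by
  have hρm : AEMeasurable (fun t => ENNReal.ofReal (ρ t)) μ := hρi.1.aemeasurable.ennreal_ofReal
  have hρfin : ∀ᵐ t ∂μ, ENNReal.ofReal (ρ t) < ⊤ :=
    Eventually.of_forall fun _ => ENNReal.ofReal_lt_top
  have : IsProbabilityMeasure (μ.withDensity fun t => ENNReal.ofReal (ρ t)) := by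
    refine ⟨?_⟩
    rw [withDensity_apply _ .univ, setLIntegral_univ, ← ofReal_integral_eq_lintegral_ofReal hρi
      (Eventually.of_forall hρ), hρ₁, ENNReal.ofReal_one]
  have hjensen := hg.map_integral_le (μ := μ.withDensity fun t => ENNReal.ofReal (ρ t)) (f := u)
    hgc.continuousOn isClosed_univ (Eventually.of_forall fun _ => mem_univ _)
    (by rw [integrable_withDensity_iff_integrable_smul₀' hρm hρfin]
        simpa only [ENNReal.toReal_ofReal (hρ _)] using hu)
    (by rw [integrable_withDensity_iff_integrable_smul₀' hρm hρfin]
        simpa only [ENNReal.toReal_ofReal (hρ _), Function.comp_apply] using hgu)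
  simpa only [integral_withDensity_eq_integral_toReal_smul₀ hρm hρfin,
    ENNReal.toReal_ofReal (hρ _)] using hjensen

section Mollification

variable {F : Type*} [NormedAddCommGroup F] [NormedSpace ℝ F]

/-- Bump functions shrinking to the origin; the ratio `2` of the radii is what the differentiation
theorem behind `ae_tendsto_mollify` needs to be bounded. -/
noncomputable def shrinkingBump (n k : ℕ) : ContDiffBump (0 : EuclideanSpace ℝ (Fin n)) where
  rIn := 1 / (2 * ((k : ℝ) + 1))
  rOut := 1 / ((k : ℝ) + 1)
  rIn_pos := by positivity
  rIn_lt_rOut := one_div_lt_one_div_of_lt (by positivity) (by linarith [k.cast_nonneg (α := ℝ)])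

/-- The standard mollifiers: smooth, nonnegative, of integral one, supported in the ball of radius
`1 / (k + 1)`. -/
noncomputable abbrev mollifier (n k : ℕ) : EuclideanSpace ℝ (Fin n) → ℝ :=
  (shrinkingBump n k).normed volume

/-- The convolution of `u` with the `k`-th mollifier. -/
noncomputable def mollify (k : ℕ) (u : 𝔼 → F) : 𝔼 → F :=
  convolution (mollifier n k) u (ContinuousLinearMap.lsmul ℝ ℝ) volume

theorem contDiff_mollifier (k : ℕ) : ContDiff ℝ ∞ (mollifier n k) :=
  (shrinkingBump n k).contDiff_normed

theorem tsupport_mollifier_sub_subset (k : ℕ) (x : 𝔼) :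
    tsupport (fun t => mollifier n k (x - t)) ⊆ Metric.closedBall x (1 / ((k : ℝ) + 1)) := by
  refine closure_minimal (fun t ht => ?_) Metric.isClosed_closedBall
  have hmem : x - t ∈ tsupport (mollifier n k) := subset_tsupport _ ht
  rw [(shrinkingBump n k).tsupport_normed_eq, mem_closedBall_zero_iff] at hmem
  rwa [Metric.mem_closedBall', dist_eq_norm]

theorem mollify_apply (k : ℕ) (u : 𝔼 → F) (x : 𝔼) :
    mollify k u x = ∫ t, mollifier n k (x - t) • u t :=
  convolution_lsmul_swap

theorem mollify_indicator_apply {Ω : Set 𝔼} (hΩ : MeasurableSet Ω) (k : ℕ) (u : 𝔼 → F) (x : 𝔼) :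
    mollify k (Ω.indicator u) x = ∫ t in Ω, mollifier n k (x - t) • u t := by
  rw [mollify_apply, ← integral_indicator hΩ]
  simp only [indicator_smul]

theorem integrable_mollifier_smul {u : 𝔼 → F} (hu : LocallyIntegrable u) (k : ℕ) (x : 𝔼) :
    Integrable fun t => mollifier n k (x - t) • u t :=
  ((shrinkingBump n k).hasCompactSupport_normed.convolutionExists_left
    (ContinuousLinearMap.lsmul ℝ ℝ) (contDiff_mollifier k).continuous hu x).integrable_swap

theorem contDiff_mollify {u : 𝔼 → F} (hu : LocallyIntegrable u) (k : ℕ) :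
    ContDiff ℝ 1 (mollify k u) :=
  (shrinkingBump n k).hasCompactSupport_normed.contDiff_convolution_left (n := 1) _
    ((contDiff_mollifier k).of_le (by exact_mod_cast le_top)) hu

theorem integrable_mollify {u : 𝔼 → F} (hu : Integrable u) (k : ℕ) : Integrable (mollify k u) :=
  (shrinkingBump n k).integrable_normed.integrable_convolution _ hu

theorem integral_mollify [CompleteSpace F] {u : 𝔼 → F} (hu : Integrable u) (k : ℕ) :
    ∫ x, mollify k u x = ∫ x, u x := by
  unfold mollify
  rw [integral_convolution _ (shrinkingBump n k).integrable_normed hu,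
    (shrinkingBump n k).integral_normed]
  simp

theorem ae_tendsto_mollify [CompleteSpace F] {u : 𝔼 → F} (hu : LocallyIntegrable u) :
    ∀ᵐ x, Tendsto (fun k => mollify k u x) atTop (𝓝 (u x)) := by
  refine ContDiffBump.ae_convolution_tendsto_right_of_locallyIntegrable (K := 2)
    (φ := shrinkingBump n) tendsto_one_div_add_atTop_nhds_zero_nat
    (Eventually.of_forall fun k => le_of_eq ?_) hu
  simp only [shrinkingBump]
  field_simp

theorem map_mollify_le_mollify_comp [CompleteSpace F] {g : F → ℝ} (hg : ConvexOn ℝ univ g)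
    (hgc : Continuous g) {u : 𝔼 → F} (hu : LocallyIntegrable u)
    (hgu : LocallyIntegrable fun t => g (u t)) (k : ℕ) (x : 𝔼) :
    g (mollify k u x) ≤ mollify k (fun t => g (u t)) x := by
  simp only [mollify_apply]
  refine map_integral_smul_le hg hgc (fun t => (shrinkingBump n k).nonneg_normed _)
    ((shrinkingBump n k).integrable_normed.comp_sub_left x) ?_
    (integrable_mollifier_smul hu k x) (integrable_mollifier_smul hgu k x)
  rw [integral_sub_left_eq_self (mollifier n k) volume x, (shrinkingBump n k).integral_normed]

theorem eventually_forall_closedBall_subset {Ω C : Set 𝔼} (hΩ : IsOpen Ω) (hC : IsCompact C)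
    (hCΩ : C ⊆ Ω) :
    ∀ᶠ k : ℕ in atTop, ∀ x ∈ C, Metric.closedBall x (1 / ((k : ℝ) + 1)) ⊆ Ω := by
  obtain ⟨δ, hδ, hδs⟩ := hC.exists_cthickening_subset_open hΩ hCΩ
  filter_upwards [tendsto_one_div_add_atTop_nhds_zero_nat.eventually (gt_mem_nhds hδ)]
    with k hk x hx
  exact (Metric.closedBall_subset_closedBall hk.le).trans
    ((Metric.closedBall_subset_cthickening hx δ).trans hδs)

theorem tendstoUniformlyOn_mollify [CompleteSpace F] {Ω C : Set 𝔼} (hΩ : IsOpen Ω) {y : 𝔼 → F}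
    (hy : ContinuousOn y Ω) (hC : IsCompact C) (hCΩ : C ⊆ Ω) :
    TendstoUniformlyOn (fun k => mollify k (Ω.indicator y)) y atTop C := by
  have hym : AEStronglyMeasurable (Ω.indicator y) :=
    (aestronglyMeasurable_indicator_iff hΩ.measurableSet).2
      (hy.aestronglyMeasurable hΩ.measurableSet)
  obtain ⟨δ, hδ, hδs⟩ := hC.exists_cthickening_subset_open hΩ hCΩ
  have huc := hC.cthickening (r := δ) |>.uniformContinuousOn_of_continuous (hy.mono hδs)
  rw [Metric.tendstoUniformlyOn_iff]
  intro ε hε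
  obtain ⟨η, hη, hηu⟩ := Metric.uniformContinuousOn_iff.1 huc (ε / 2) (half_pos hε)
  filter_upwards [tendsto_one_div_add_atTop_nhds_zero_nat.eventually
    (gt_mem_nhds (lt_min hδ hη))] with k hk x hx
  have hmem : ∀ t ∈ Metric.ball x (1 / ((k : ℝ) + 1)), t ∈ Metric.cthickening δ C := fun t ht =>
    Metric.closedBall_subset_cthickening hx δ
      ((Metric.mem_ball.1 ht).le.trans (hk.le.trans (min_le_left _ _)))
  have hxm : x ∈ Metric.cthickening δ C := Metric.self_subset_cthickening C hx
  have hdist := ContDiffBump.dist_normed_convolution_le (φ := shrinkingBump n k) (x₀ := x)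
    (ε := ε / 2) hym fun t ht => by
      rw [indicator_of_mem (hδs (hmem t ht)), indicator_of_mem (hδs hxm)]
      exact (hηu t (hmem t ht) x hxm
        ((Metric.mem_ball.1 ht).trans (hk.trans_le (min_le_right _ _)))).le
  rw [indicator_of_mem (hδs hxm)] at hdist
  rw [dist_comm]
  exact hdist.trans_lt (half_lt_self hε)

theorem ae_nonneg_of_forall_setIntegral_mul_nonneg {U : Set 𝔼} (hU : IsOpen U) {u : 𝔼 → ℝ}
    (hu : IntegrableOn u U)
    (h : ∀ φ : 𝔼 → ℝ, Continuous φ → 0 ≤ φ → HasCompactSupport φ → tsupport φ ⊆ U →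
      0 ≤ ∫ x in U, φ x * u x) :
    ∀ᵐ x ∂volume.restrict U, 0 ≤ u x := by
  rw [ae_restrict_iff' hU.measurableSet]
  filter_upwards [ae_tendsto_mollify (hu.integrable_indicator hU.measurableSet).locallyIntegrable]
    with x hx hxU
  rw [indicator_of_mem hxU] at hx
  refine ge_of_tendsto hx ?_
  filter_upwards [eventually_forall_closedBall_subset hU isCompact_singleton
    (singleton_subset_iff.2 hxU)] with k hk
  have hsupp := tsupport_mollifier_sub_subset k x
  rw [mollify_indicator_apply hU.measurableSet]
  exact h _ ((contDiff_mollifier k).continuous.comp (continuous_const.sub continuous_id))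
    (fun _ => (shrinkingBump n k).nonneg_normed _)
    ((isCompact_closedBall x _).of_isClosed_subset (isClosed_tsupport _) hsupp)
    (hsupp.trans (hk x (mem_singleton x)))

theorem fderiv_mollifier_sub (k : ℕ) (x t : 𝔼) :
    fderiv ℝ (fun t => mollifier n k (x - t)) t = -fderiv ℝ (mollifier n k) (x - t) := by
  have hsub : HasFDerivAt (fun t : 𝔼 => x - t) (-ContinuousLinearMap.id ℝ 𝔼) t :=
    (hasFDerivAt_id t).const_sub x
  have hφ := ((contDiff_mollifier (n := n) k).differentiable (by simp) (x - t)).hasFDerivAt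
  rw [show (fun t => mollifier n k (x - t)) = mollifier n k ∘ fun t => x - t from rfl,
    (hφ.comp t hsub).fderiv]
  ext v
  simp

theorem IsWeakGradient.fderiv_mollify_apply {Ω : Set 𝔼} (hΩ : MeasurableSet Ω) {y : 𝔼 → 𝔼}
    {G : 𝔼 → Matrix (Fin n) (Fin n) ℝ} (hG : IsWeakGradient Ω y G)
    (hy : LocallyIntegrable (Ω.indicator y)) {k : ℕ} {x : 𝔼}
    (hx : Metric.closedBall x (1 / ((k : ℝ) + 1)) ⊆ Ω) (i j : Fin n) :
    fderiv ℝ (mollify k (Ω.indicator y)) x (EuclideanSpace.single j 1) i =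
      mollify k (Ω.indicator fun t => G t i j) x := by
  have hm : ContDiff ℝ 1 (mollifier n k) := (contDiff_mollifier k).of_le (by exact_mod_cast le_top)
  have hmc := (shrinkingBump n k).hasCompactSupport_normed (μ := volume)
  have hI := ((hmc.fderiv (𝕜 := ℝ)).convolutionExists_left (ContinuousLinearMap.precompL 𝔼
    (ContinuousLinearMap.lsmul ℝ ℝ)) (hm.continuous_fderiv one_ne_zero) hy x).integrable_swap
  let entry : (𝔼 →L[ℝ] 𝔼) →L[ℝ] ℝ := (EuclideanSpace.proj i).comp
    (ContinuousLinearMap.apply ℝ 𝔼 (EuclideanSpace.single j (1 : ℝ) : 𝔼))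
  have hderiv : fderiv ℝ (mollify k (Ω.indicator y)) x (EuclideanSpace.single j 1) i =
      ∫ t, entry ((ContinuousLinearMap.precompL 𝔼 (ContinuousLinearMap.lsmul ℝ ℝ))
        (fderiv ℝ (mollifier n k) (x - t)) (Ω.indicator y t)) := by
    rw [entry.integral_comp_comm hI, ← convolution_eq_swap,
      ← (hmc.hasFDerivAt_convolution_left _ hm hy x).fderiv]
    rfl
  have hentry : ∀ t, entry ((ContinuousLinearMap.precompL 𝔼 (ContinuousLinearMap.lsmul ℝ ℝ))
      (fderiv ℝ (mollifier n k) (x - t)) (Ω.indicator y t)) = Ω.indicator (fun t => -(y t i *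
        fderiv ℝ (fun t => mollifier n k (x - t)) t (EuclideanSpace.single j 1))) t := by
    intro t
    by_cases ht : t ∈ Ω <;>
      simp [entry, ht, fderiv_mollifier_sub, ContinuousLinearMap.precompL_apply, mul_comm]
  have hsupp := tsupport_mollifier_sub_subset k x
  have hweak := hG.integral_eq (fun t => mollifier n k (x - t))
    ((contDiff_mollifier k).comp (contDiff_const.sub contDiff_id))
    ((isCompact_closedBall x _).of_isClosed_subset (isClosed_tsupport _) hsupp)
    (hsupp.trans hx) i j
  rw [hderiv, integral_congr_ae (Eventually.of_forall hentry), integral_indicator hΩ,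
    integral_neg, mollify_indicator_apply hΩ, neg_eq_iff_eq_neg]
  simpa only [mul_comm, smul_eq_mul] using hweak

end Mollification

/-! ### Degrees of a homeomorphism and of its inverse -/

theorem eq_of_forall_integral_smul_eq {X : Type*} [TopologicalSpace X] [HasOuterApproxClosed X]
    [MeasurableSpace X] [BorelSpace X] {μ ν : Measure X} [IsFiniteMeasure μ] [IsFiniteMeasure ν]
    {θ : X → NNReal} (hθ : Continuous θ) {M : NNReal} (hM : ∀ x, θ x ≤ M)
    (hμ : ∀ᵐ x ∂μ, θ x ≠ 0) (hν : ∀ᵐ x ∂ν, θ x ≠ 0)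
    (h : ∀ f : BoundedContinuousFunction X ℝ, ∫ x, θ x • f x ∂μ = ∫ x, θ x • f x ∂ν) : μ = ν := by
  have hfin (ρ : Measure X) [IsFiniteMeasure ρ] : IsFiniteMeasure (ρ.withDensity fun x => θ x) :=
    isFiniteMeasure_withDensity (ne_of_lt <| calc
      ∫⁻ x, θ x ∂ρ ≤ ∫⁻ _, M ∂ρ := lintegral_mono fun x => ENNReal.coe_le_coe.2 (hM x)
      _ < ⊤ := by
        rw [lintegral_const]
        exact ENNReal.mul_lt_top ENNReal.coe_lt_top (measure_lt_top ρ univ))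
  have := hfin μ
  have := hfin ν
  have hdensity : (μ.withDensity fun x => (θ x : ℝ≥0∞)) = ν.withDensity fun x => (θ x : ℝ≥0∞) := by
    refine ext_of_forall_integral_eq_of_IsFiniteMeasure fun f => ?_
    simpa only [integral_withDensity_eq_integral_smul hθ.measurable] using h f
  have hθm : Measurable fun x => (θ x : ℝ≥0∞) := hθ.measurable.coe_nnreal_ennreal
  rw [← withDensity_inv_same hθm (hμ.mono fun x hx => ENNReal.coe_ne_zero.2 hx)
    (Eventually.of_forall fun _ => ENNReal.coe_ne_top), hdensity,
    withDensity_inv_same hθm (hν.mono fun x hx => ENNReal.coe_ne_zero.2 hx)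
    (Eventually.of_forall fun _ => ENNReal.coe_ne_top)]

theorem integral_map_withDensity_ofReal {X Y : Type*} [MeasurableSpace X] [MeasurableSpace Y]
    {μ : Measure X} {y : X → Y} {J : X → ℝ} (hy : AEMeasurable y μ) (hJ : AEMeasurable J μ)
    (hJ₀ : ∀ᵐ x ∂μ, 0 ≤ J x) {φ : Y → ℝ}
    (hφ : AEStronglyMeasurable φ ((μ.withDensity fun x => ENNReal.ofReal (J x)).map y)) :
    ∫ z, φ z ∂(μ.withDensity fun x => ENNReal.ofReal (J x)).map y = ∫ x, φ (y x) * J x ∂μ := by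
  rw [integral_map (hy.mono_ac (withDensity_absolutelyContinuous _ _)) hφ,
    integral_withDensity_eq_integral_toReal_smul₀ hJ.ennreal_ofReal
      (Eventually.of_forall fun _ => ENNReal.ofReal_lt_top)]
  refine integral_congr_ae ?_
  filter_upwards [hJ₀] with x hx
  rw [ENNReal.toReal_ofReal hx, smul_eq_mul, mul_comm]

section Degree

variable {T Ω Ω₁ Ω₂ : Set (EuclideanSpace ℝ (Fin n))}
  {y ξ : EuclideanSpace ℝ (Fin n) → EuclideanSpace ℝ (Fin n)}
  {J J' : EuclideanSpace ℝ (Fin n) → ℝ}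
  {f g : ℕ → EuclideanSpace ℝ (Fin n) → EuclideanSpace ℝ (Fin n)}
  {x₀ z₀ : EuclideanSpace ℝ (Fin n)} {r s c : ℝ}

theorem HasDegreeOn.nonneg (hdeg : HasDegreeOn T y J z₀ r c) (hr : 0 < r)
    (hJ₀ : ∀ᵐ x ∂volume.restrict T, 0 ≤ J x) : 0 ≤ c := by
  obtain ⟨φ, hφ, hφ₀, hφs, hφpos⟩ := exists_continuous_supported_integral_pos z₀ hr
  refine nonneg_of_mul_nonneg_left ?_ hφpos
  rw [← hdeg φ hφ hφs]
  exact integral_nonneg_of_ae (hJ₀.mono fun x hx => mul_nonneg (hφ₀ _) hx)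

theorem HasDegreeOn.map_withDensity_eq (hdeg : HasDegreeOn T y J z₀ r c) (hr : 0 < r)
    (hT : MeasurableSet T) (hy : AEMeasurable y (volume.restrict T)) (hJ : IntegrableOn J T)
    (hJ₀ : ∀ᵐ x ∂volume.restrict T, 0 ≤ J x) (hyT : MapsTo y T (Metric.ball z₀ r)) :
    ((volume.restrict T).withDensity fun x => ENNReal.ofReal (J x)).map y =
      ENNReal.ofReal c • volume.restrict (Metric.ball z₀ r) := by
  have : IsFiniteMeasure ((volume.restrict T).withDensity fun x => ENNReal.ofReal (J x)) :=
    isFiniteMeasure_withDensity_ofReal hJ.2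
  have : IsFiniteMeasure (volume.restrict (Metric.ball z₀ r)) :=
    isFiniteMeasure_restrict.2 measure_ball_lt_top.ne
  have := Measure.smul_finite (volume.restrict (Metric.ball z₀ r)) (ENNReal.ofReal_ne_top (r := c))
  have hθ₀ (z : 𝔼) : (r - dist z z₀).toNNReal ≠ 0 ↔ z ∈ Metric.ball z₀ r := by
    rw [← pos_iff_ne_zero, Real.toNNReal_pos, sub_pos, Metric.mem_ball]
  have hθ : Continuous fun z => (r - dist z z₀).toNNReal := by fun_prop
  refine eq_of_forall_integral_smul_eq hθ (M := r.toNNReal)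
    (fun z => Real.toNNReal_le_toNNReal (sub_le_self _ dist_nonneg)) ?_ ?_ fun φ => ?_
  · simp only [hθ₀]
    exact (ae_map_iff (hy.mono_ac (withDensity_absolutelyContinuous _ _)) measurableSet_ball).2
      ((withDensity_absolutelyContinuous _ _).ae_le (ae_restrict_of_forall_mem hT hyT))
  · simp only [hθ₀]
    exact Measure.smul_absolutelyContinuous.ae_le (ae_restrict_mem measurableSet_ball)
  · have hφ : Continuous fun z => (r - dist z z₀).toNNReal • φ z := hθ.smul φ.continuous
    have hφs (z : 𝔼) (hz : (r - dist z z₀).toNNReal • φ z ≠ 0) : dist z z₀ < r :=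
      (hθ₀ z).1 (left_ne_zero_of_smul hz)
    rw [integral_map_withDensity_ofReal hy hJ.1.aemeasurable hJ₀ hφ.aestronglyMeasurable,
      hdeg _ hφ hφs, integral_smul_measure, ENNReal.toReal_ofReal (hdeg.nonneg hr hJ₀),
      smul_eq_mul, setIntegral_eq_integral_of_forall_compl_eq_zero fun z hz => ?_]
    by_contra hne
    exact hz (hφs z hne)

theorem HasDegreeOn.restrict (hdeg : HasDegreeOn Ω₁ y J z₀ r c) (hp : IsHomeoPair Ω₁ Ω₂ y ξ) :
    HasDegreeOn (Ω₁ ∩ y ⁻¹' Metric.ball z₀ r) y J z₀ r c := fun φ hφ hs => by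
  rw [hp.setIntegral_preimage_ball_comp_mul hs, hdeg φ hφ hs]

theorem JacobianApprox.integrableOn_preimage_ball (hf : JacobianApprox Ω₁ y J f)
    (hp : IsHomeoPair Ω₁ Ω₂ y ξ) (hball : Metric.closedBall z₀ r ⊆ Ω₂) :
    IntegrableOn J (Ω₁ ∩ y ⁻¹' Metric.ball z₀ r) :=
  (hf.integrableOn _ inter_subset_left (hp.isCompact_preimage (isCompact_closedBall _ _)
    hball)).mono_set (inter_subset_inter_right _ (preimage_mono Metric.ball_subset_closedBall))

theorem JacobianApprox.map_withDensity_eq (hf : JacobianApprox Ω₁ y J f)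
    (hp : IsHomeoPair Ω₁ Ω₂ y ξ) (hr : 0 < r) (hball : Metric.closedBall z₀ r ⊆ Ω₂)
    (hdeg : HasDegreeOn Ω₁ y J z₀ r c)
    (hJ₀ : ∀ᵐ x ∂volume.restrict (Ω₁ ∩ y ⁻¹' Metric.ball z₀ r), 0 ≤ J x) :
    ((volume.restrict (Ω₁ ∩ y ⁻¹' Metric.ball z₀ r)).withDensity
      fun x => ENNReal.ofReal (J x)).map y =
      ENNReal.ofReal c • volume.restrict (Metric.ball z₀ r) :=
  (hdeg.restrict hp).map_withDensity_eq hr (hp.isOpen_preimage Metric.isOpen_ball).measurableSet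
    (hp.aemeasurable.mono_set inter_subset_left) (hf.integrableOn_preimage_ball hp hball) hJ₀
    fun _ hx => hx.2

theorem JacobianApprox.setIntegral_preimage_comp_mul (hf : JacobianApprox Ω₁ y J f)
    (hp : IsHomeoPair Ω₁ Ω₂ y ξ) (hr : 0 < r) (hball : Metric.closedBall z₀ r ⊆ Ω₂)
    (hdeg : HasDegreeOn Ω₁ y J z₀ r c)
    (hJ₀ : ∀ᵐ x ∂volume.restrict (Ω₁ ∩ y ⁻¹' Metric.ball z₀ r), 0 ≤ J x) {U : Set 𝔼}
    (hU : IsOpen U) (hUb : U ⊆ Metric.ball z₀ r) {u : 𝔼 → ℝ} (hu : Continuous u) :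
    ∫ x in Ω₁ ∩ y ⁻¹' U, u (y x) * J x = c * ∫ z in U, u z := by
  have hc : 0 ≤ c := (hdeg.restrict hp).nonneg hr hJ₀
  have hW := (hp.isOpen_preimage (Metric.isOpen_ball (x := z₀) (ε := r))).measurableSet
  have hmap := integral_map_withDensity_ofReal (hp.aemeasurable.mono_set inter_subset_left)
    (hf.integrableOn_preimage_ball hp hball).1.aemeasurable hJ₀
    (hu.measurable.indicator hU.measurableSet).aestronglyMeasurable
  rw [hf.map_withDensity_eq hp hr hball hdeg hJ₀, integral_smul_measure,
    ENNReal.toReal_ofReal hc, integral_indicator hU.measurableSet,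
    Measure.restrict_restrict_of_subset hUb, smul_eq_mul] at hmap
  rw [hmap, setIntegral_eq_of_subset_of_forall_sdiff_eq_zero hW (inter_subset_inter_right _
    (preimage_mono hUb)) fun x hx => ?_]
  · refine setIntegral_congr_fun (hp.isOpen_preimage hU).measurableSet fun x hx => ?_
    simp only [indicator_of_mem (show y x ∈ U from hx.2)]
  · have hxU : y x ∉ U := fun hxU => hx.2 ⟨hx.1.1, hxU⟩
    rw [indicator_of_notMem hxU, zero_mul]

theorem det_fderiv_comp {f g : 𝔼 → 𝔼} (hf : ContDiff ℝ 1 f) (hg : ContDiff ℝ 1 g) (x : 𝔼) :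
    (fderiv ℝ (g ∘ f) x).det = (fderiv ℝ g (f x)).det * (fderiv ℝ f x).det := by
  rw [fderiv_comp x (hg.differentiable one_ne_zero _) (hf.differentiable one_ne_zero _)]
  exact LinearMap.det_comp _ _

theorem JacobianApprox.comp_left (hf : JacobianApprox Ω y J f) (hy : ContinuousOn y Ω)
    {h : 𝔼 → 𝔼} (hh : ContDiff ℝ 1 h) :
    JacobianApprox Ω (h ∘ y) (fun x => (fderiv ℝ h (y x)).det * J x) fun k => h ∘ f k where
  contDiff k := hh.comp (hf.contDiff k)
  tendstoUniformlyOn C hCΩ hC := tendstoUniformlyOn_continuous_comp hh.continuous hC (hy.mono hCΩ)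
    (hf.tendstoUniformlyOn C hCΩ hC)
  integrableOn C hCΩ hC := (hf.integrableOn C hCΩ hC).continuousOn_mul
    ((continuous_det_fderiv hh).comp_continuousOn (hy.mono hCΩ)) hC
  tendsto_integral C hCΩ hC := by
    simp only [det_fderiv_comp (hf.contDiff _) hh]
    exact tendsto_setIntegral_abs_mul_sub_mul hC (Eventually.of_forall fun k =>
        ((continuous_det_fderiv hh).comp (hf.contDiff k).continuous).continuousOn)
      ((continuous_det_fderiv hh).comp_continuousOn (hy.mono hCΩ))
      (tendstoUniformlyOn_continuous_comp (g := fun z => (fderiv ℝ h z).det)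
        (continuous_det_fderiv hh) hC (hy.mono hCΩ) (hf.tendstoUniformlyOn C hCΩ hC))
      (Eventually.of_forall (hf.integrableOn_det hC)) (hf.integrableOn C hCΩ hC)
      (hf.tendsto_integral C hCΩ hC)

theorem JacobianApprox.setIntegral_comp_mul_of_near_id (hf : JacobianApprox Ω y J f)
    (hy : ContinuousOn y Ω) (hs : 0 < s) (hball : Metric.closedBall x₀ (2 * s) ⊆ Ω)
    (hnear : ∀ x ∈ Metric.sphere x₀ (2 * s), dist (y x) x ≤ s / 2) {φ : 𝔼 → ℝ}
    (hφ : Continuous φ) (hφs : ∀ x, φ x ≠ 0 → dist x x₀ ≤ s) :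
    ∫ x in Metric.ball x₀ (2 * s), φ (y x) * J x = ∫ x, φ x := by
  have hC : IsCompact (Metric.closedBall x₀ (2 * s)) := isCompact_closedBall _ _
  refine tendsto_nhds_unique_of_eventuallyEq (hf.tendsto_setIntegral_comp hy hC hball
    Metric.ball_subset_closedBall hφ) tendsto_const_nhds ?_
  filter_upwards [hf.eventually_forall_dist_lt hC hball (half_pos hs)] with k hk
  refine setIntegral_comp_mul_det_of_near_id (hf.contDiff k) hs (fun x hx => ?_) hφ hφs
  linarith [hk x (Metric.sphere_subset_closedBall hx), hnear x hx,
    dist_triangle_left (f k x) x (y x)]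

theorem IsHomeoPair.preimage_preimage (hp : IsHomeoPair Ω₁ Ω₂ y ξ) {S : Set 𝔼} (hS : S ⊆ Ω₁) :
    Ω₁ ∩ y ⁻¹' (Ω₂ ∩ ξ ⁻¹' S) = S := by
  ext x
  constructor
  · rintro ⟨hx, -, hxS⟩
    rwa [mem_preimage, hp.invOn.1 hx] at hxS
  · intro hx
    exact ⟨hS hx, hp.mapsTo (hS hx), by rwa [mem_preimage, hp.invOn.1 (hS hx)]⟩

theorem HasDegreeOn.inv (hdeg : HasDegreeOn Ω₁ y J z₀ r c) (hf : JacobianApprox Ω₁ y J f)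
    (hg : JacobianApprox Ω₂ ξ J' g) (hp : IsHomeoPair Ω₁ Ω₂ y ξ) (hr : 0 < r)
    (hball : Metric.closedBall z₀ r ⊆ Ω₂)
    (hJ₀ : ∀ᵐ x ∂volume.restrict (Ω₁ ∩ y ⁻¹' Metric.ball z₀ r), 0 ≤ J x) (hc : c ≠ 0)
    (hs : 0 < s) (hsub : Metric.closedBall x₀ (2 * s) ⊆ Ω₁ ∩ y ⁻¹' Metric.ball z₀ r) :
    HasDegreeOn Ω₂ ξ J' x₀ s c⁻¹ := by
  intro φ hφ hφs
  set C := Metric.closedBall x₀ (2 * s)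
  set B := Metric.ball x₀ (2 * s)
  have hBC : B ⊆ C := Metric.ball_subset_closedBall
  have hCΩ : C ⊆ Ω₁ := fun x hx => (hsub hx).1
  have hY : IsCompact (Ω₂ ∩ ξ ⁻¹' C) := hp.symm.isCompact_preimage (isCompact_closedBall _ _) hCΩ
  have hU : IsOpen (Ω₂ ∩ ξ ⁻¹' B) := hp.symm.isOpen_preimage Metric.isOpen_ball
  have hUY : Ω₂ ∩ ξ ⁻¹' B ⊆ Ω₂ ∩ ξ ⁻¹' C := inter_subset_inter_right _ (preimage_mono hBC)
  have hUb : Ω₂ ∩ ξ ⁻¹' B ⊆ Metric.ball z₀ r := fun z hz => by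
    have hyξ := (hsub (hBC hz.2)).2
    rwa [mem_preimage, hp.invOn.2 hz.1] at hyξ
  -- `g j ∘ y` is close to the identity and has Jacobian `det D(g j) (y x) * J x`
  have hcomp : ∀ᶠ j in atTop,
      c * ∫ z in Ω₂ ∩ ξ ⁻¹' B, φ (g j z) * (fderiv ℝ (g j) z).det = ∫ x, φ x := by
    filter_upwards [hg.eventually_forall_dist_lt hY inter_subset_left (half_pos hs)] with j hj
    have hnear : ∀ x ∈ Metric.sphere x₀ (2 * s), dist ((g j ∘ y) x) x ≤ s / 2 := by
      intro x hx
      have hxC : x ∈ C := Metric.sphere_subset_closedBall hx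
      have hyx := hj (y x) ⟨hp.mapsTo (hCΩ hxC), by rwa [mem_preimage, hp.invOn.1 (hCΩ hxC)]⟩
      rw [hp.invOn.1 (hCΩ hxC), dist_comm] at hyx
      exact hyx.le
    have hu : Continuous fun z => φ (g j z) * (fderiv ℝ (g j) z).det :=
      (hφ.comp (hg.contDiff j).continuous).mul (continuous_det_fderiv (hg.contDiff j))
    rw [← hf.setIntegral_preimage_comp_mul hp hr hball hdeg hJ₀ hU hUb hu,
      hp.preimage_preimage (hBC.trans hCΩ),
      ← (hf.comp_left hp.continuousOn (hg.contDiff j)).setIntegral_comp_mul_of_near_id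
        ((hg.contDiff j).continuous.comp_continuousOn hp.continuousOn) hs hCΩ hnear hφ
        fun x hx => (hφs x hx).le]
    simp only [Function.comp_apply, mul_assoc, B]
  have hlim :=
    (hg.tendsto_setIntegral_comp hp.continuousOn_inv hY inter_subset_left hUY hφ).const_mul c
  rw [hp.symm.setIntegral_preimage_ball_comp_mul fun x hx => (hφs x hx).trans (by linarith)] at hlim
  rw [← tendsto_nhds_unique_of_eventuallyEq hlim tendsto_const_nhds hcomp,
    inv_mul_cancel_left₀ hc]

theorem HasDegreeOn.ae_nonneg (hdeg : HasDegreeOn Ω₁ y J z₀ r c) (hc : 0 ≤ c)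
    (hp : IsHomeoPair Ω₁ Ω₂ y ξ) (hball : Metric.ball z₀ r ⊆ Ω₂)
    (hJ : IntegrableOn J (Ω₁ ∩ y ⁻¹' Metric.ball z₀ r)) :
    ∀ᵐ x ∂volume.restrict (Ω₁ ∩ y ⁻¹' Metric.ball z₀ r), 0 ≤ J x := by
  set B := Metric.ball z₀ r
  set W := Ω₁ ∩ y ⁻¹' B
  have hW : IsOpen W := hp.isOpen_preimage Metric.isOpen_ball
  refine ae_nonneg_of_forall_setIntegral_mul_nonneg hW hJ fun ψ hψ hψ₀ hψc hψW => ?_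
  have hK : IsCompact (Ω₂ ∩ ξ ⁻¹' tsupport ψ) :=
    hp.symm.isCompact_preimage hψc (hψW.trans inter_subset_left)
  have hKB : Ω₂ ∩ ξ ⁻¹' tsupport ψ ⊆ B := fun z hz => by
    have hyξ := (hψW hz.2).2
    rwa [mem_preimage, hp.invOn.2 hz.1] at hyξ
  have hsupp : tsupport (B.indicator (ψ ∘ ξ)) ⊆ B := by
    refine (closure_minimal (fun z hz => ?_) hK.isClosed).trans hKB
    rw [Function.mem_support, indicator_apply_ne_zero] at hz
    exact ⟨hball hz.1, subset_tsupport _ hz.2⟩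
  have hφ : Continuous (B.indicator (ψ ∘ ξ)) :=
    ContinuousOn.continuous_of_tsupport_subset ((hψ.comp_continuousOn
      (hp.continuousOn_inv.mono hball)).congr fun z hz => indicator_of_mem hz _)
      Metric.isOpen_ball hsupp
  have hφs (z : 𝔼) (hz : B.indicator (ψ ∘ ξ) z ≠ 0) : dist z z₀ < r := by
    have hzB : z ∈ B := mem_of_indicator_ne_zero hz
    exact hzB
  calc 0 ≤ c * ∫ z, B.indicator (ψ ∘ ξ) z :=
        mul_nonneg hc (integral_nonneg fun z => indicator_nonneg (fun _ _ => hψ₀ _) z)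
    _ = ∫ x in W, B.indicator (ψ ∘ ξ) (y x) * J x := (hdeg.restrict hp _ hφ hφs).symm
    _ = ∫ x in W, ψ x * J x := by
        refine setIntegral_congr_fun hW.measurableSet fun x hx => ?_
        simp only [indicator_of_mem (show y x ∈ B from hx.2), Function.comp_apply,
          hp.invOn.1 hx.1]

end Degree

/-! ### The area formula -/

section Area

variable {Ω₁ Ω₂ : Set (EuclideanSpace ℝ (Fin n))}
  {y ξ : EuclideanSpace ℝ (Fin n) → EuclideanSpace ℝ (Fin n)}
  {J J' : EuclideanSpace ℝ (Fin n) → ℝ}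
  {f g : ℕ → EuclideanSpace ℝ (Fin n) → EuclideanSpace ℝ (Fin n)}
  {z₀ : EuclideanSpace ℝ (Fin n)} {r c : ℝ}

namespace JacobianApprox

theorem setLIntegral_preimage_ball (hf : JacobianApprox Ω₁ y J f) (hp : IsHomeoPair Ω₁ Ω₂ y ξ)
    (hr : 0 < r) (hball : Metric.closedBall z₀ r ⊆ Ω₂) (hdeg : HasDegreeOn Ω₁ y J z₀ r c)
    (hJ₀ : ∀ᵐ x ∂volume.restrict (Ω₁ ∩ y ⁻¹' Metric.ball z₀ r), 0 ≤ J x) :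
    ∫⁻ x in Ω₁ ∩ y ⁻¹' Metric.ball z₀ r, ENNReal.ofReal (J x) =
      ENNReal.ofReal c * volume (Metric.ball z₀ r) := by
  have huniv := congrArg (· univ) (hf.map_withDensity_eq hp hr hball hdeg hJ₀)
  rwa [Measure.map_apply_of_aemeasurable ((hp.aemeasurable.mono_set inter_subset_left).mono_ac
    (withDensity_absolutelyContinuous _ _)) MeasurableSet.univ, preimage_univ,
    withDensity_apply _ MeasurableSet.univ, setLIntegral_univ, Measure.smul_apply,
    Measure.restrict_apply_univ, smul_eq_mul] at huniv

theorem degree_ne_zero (hf : JacobianApprox Ω₁ y J f) (hp : IsHomeoPair Ω₁ Ω₂ y ξ)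
    (hr : 0 < r) (hball : Metric.closedBall z₀ r ⊆ Ω₂) (hdeg : HasDegreeOn Ω₁ y J z₀ r c)
    (hJ : ∀ᵐ x ∂volume.restrict (Ω₁ ∩ y ⁻¹' Metric.ball z₀ r), 0 < J x) : c ≠ 0 := by
  rintro rfl
  have hlintegral := hf.setLIntegral_preimage_ball hp hr hball hdeg (hJ.mono fun _ hx => hx.le)
  rw [ENNReal.ofReal_zero, zero_mul, lintegral_eq_zero_iff'
    (hf.integrableOn_preimage_ball hp hball).1.aemeasurable.ennreal_ofReal] at hlintegral
  have hz₀ : z₀ ∈ Ω₂ := hball (Metric.mem_closedBall_self hr.le)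
  have hne : (Ω₁ ∩ y ⁻¹' Metric.ball z₀ r).Nonempty :=
    ⟨ξ z₀, hp.mapsTo_inv hz₀, by
      rw [mem_preimage, hp.invOn.2 hz₀]; exact Metric.mem_ball_self hr⟩
  have : (ae (volume.restrict (Ω₁ ∩ y ⁻¹' Metric.ball z₀ r))).NeBot :=
    ae_restrict_neBot.2 ((hp.isOpen_preimage Metric.isOpen_ball).measure_ne_zero volume hne)
  obtain ⟨x, hx, hx₀⟩ := (hJ.and hlintegral).exists
  exact (ENNReal.ofReal_pos.2 hx).ne' hx₀

theorem one_le_degree (hf : JacobianApprox Ω₁ y J f) (hp : IsHomeoPair Ω₁ Ω₂ y ξ)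
    (hr : 0 < r) (hball : Metric.closedBall z₀ (4 * r) ⊆ Ω₂) (hdeg : HasDegreeOn Ω₁ y J z₀ r c)
    (hc : c ≠ 0) (hJ₀ : ∀ᵐ x ∂volume.restrict (Ω₁ ∩ y ⁻¹' Metric.ball z₀ r), 0 ≤ J x) :
    1 ≤ c := by
  have hball' : Metric.closedBall z₀ r ⊆ Ω₂ :=
    (Metric.closedBall_subset_closedBall (by linarith)).trans hball
  have hpow : ∀ t ∈ Ioo (0 : ℝ) 1, t ^ n ≤ c := by
    intro t ht
    have hvol : ENNReal.ofReal (t ^ n) * volume (Metric.ball z₀ r) ≤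
        ENNReal.ofReal c * volume (Metric.ball z₀ r) := calc
      _ = volume (Metric.ball z₀ (t * r)) := by
        rw [Measure.addHaar_ball_mul_of_pos volume z₀ ht.1, finrank_euclideanSpace_fin,
          Measure.addHaar_ball_center]
      _ ≤ ∫⁻ x in Ω₁ ∩ y ⁻¹' Metric.ball z₀ r, ENNReal.ofReal |J x| :=
        hf.volume_ball_le_setLIntegral_abs hp hr hball hdeg hc
          (mul_lt_of_lt_one_left hr ht.2) le_rfl
      _ = ∫⁻ x in Ω₁ ∩ y ⁻¹' Metric.ball z₀ r, ENNReal.ofReal (J x) :=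
        lintegral_congr_ae (hJ₀.mono fun x hx => by simp only [abs_of_nonneg hx])
      _ = _ := hf.setLIntegral_preimage_ball hp hr hball' hdeg hJ₀
    exact (ENNReal.ofReal_le_ofReal_iff ((hdeg.restrict hp).nonneg hr hJ₀)).1
      ((ENNReal.mul_le_mul_iff_left (Metric.measure_ball_pos volume z₀ hr).ne'
        measure_ball_lt_top.ne).1 hvol)
  have hlim : Tendsto (fun t : ℝ => t ^ n) (𝓝[<] 1) (𝓝 1) :=
    ((continuous_pow n).tendsto' 1 1 (one_pow n)).mono_left nhdsWithin_le_nhds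
  exact le_of_tendsto hlim (eventually_of_mem (Ioo_mem_nhdsLT one_pos) hpow)

theorem degree_eq_one (hf : JacobianApprox Ω₁ y J f) (hg : JacobianApprox Ω₂ ξ J' g)
    (hp : IsHomeoPair Ω₁ Ω₂ y ξ) (hr : 0 < r) (hball : Metric.closedBall z₀ (4 * r) ⊆ Ω₂)
    (hdeg : HasDegreeOn Ω₁ y J z₀ r c) (hc : c ≠ 0)
    (hJ₀ : ∀ᵐ x ∂volume.restrict (Ω₁ ∩ y ⁻¹' Metric.ball z₀ r), 0 ≤ J x) : c = 1 := by
  have hball' : Metric.closedBall z₀ r ⊆ Ω₂ :=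
    (Metric.closedBall_subset_closedBall (by linarith)).trans hball
  have hone : 1 ≤ c := hf.one_le_degree hp hr hball hdeg hc hJ₀
  have hz₀ : z₀ ∈ Ω₂ := hball' (Metric.mem_closedBall_self hr.le)
  have hnhds : Ω₁ ∩ y ⁻¹' Metric.ball z₀ r ∈ 𝓝 (ξ z₀) :=
    (hp.isOpen_preimage Metric.isOpen_ball).mem_nhds ⟨hp.mapsTo_inv hz₀, by
      rw [mem_preimage, hp.invOn.2 hz₀]; exact Metric.mem_ball_self hr⟩
  obtain ⟨ρ, hρ, hsub⟩ := Metric.nhds_basis_closedBall.mem_iff.1 hnhds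
  obtain ⟨s, hs, rfl⟩ : ∃ s, 0 < s ∧ ρ = 4 * s := ⟨ρ / 4, by positivity, by ring⟩
  have hsubΩ : Metric.closedBall (ξ z₀) (4 * s) ⊆ Ω₁ := hsub.trans inter_subset_left
  have hdeg' : HasDegreeOn Ω₂ ξ J' (ξ z₀) s c⁻¹ := hdeg.inv hf hg hp hr hball' hJ₀ hc hs
    ((Metric.closedBall_subset_closedBall (by linarith)).trans hsub)
  have hsubs : Metric.closedBall (ξ z₀) s ⊆ Ω₁ :=
    (Metric.closedBall_subset_closedBall (by linarith)).trans hsubΩ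
  have hone' : 1 ≤ c⁻¹ := hg.one_le_degree hp.symm hs hsubΩ hdeg' (inv_ne_zero hc)
    (hdeg'.ae_nonneg (by positivity) hp.symm (Metric.ball_subset_closedBall.trans hsubs)
      (hg.integrableOn_preimage_ball hp.symm hsubs))
  exact le_antisymm ((one_le_inv₀ (by positivity)).1 hone') hone

theorem exists_map_withDensity_eq_volume (hf : JacobianApprox Ω₁ y J f)
    (hg : JacobianApprox Ω₂ ξ J' g) (hp : IsHomeoPair Ω₁ Ω₂ y ξ)
    (hJ : ∀ᵐ x ∂volume.restrict Ω₁, 0 < J x) (hz₀ : z₀ ∈ Ω₂) :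
    ∃ r > 0, Metric.ball z₀ r ⊆ Ω₂ ∧ ((volume.restrict (Ω₁ ∩ y ⁻¹' Metric.ball z₀ r)).withDensity
      fun x => ENNReal.ofReal (J x)).map y = volume.restrict (Metric.ball z₀ r) := by
  obtain ⟨ρ, hρ, hball⟩ := Metric.nhds_basis_closedBall.mem_iff.1 (hp.isOpen_right.mem_nhds hz₀)
  obtain ⟨r, hr, rfl⟩ : ∃ r, 0 < r ∧ ρ = 4 * r := ⟨ρ / 4, by positivity, by ring⟩
  have hball' : Metric.closedBall z₀ r ⊆ Ω₂ :=
    (Metric.closedBall_subset_closedBall (by linarith)).trans hball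
  obtain ⟨c, hdeg⟩ := hf.exists_hasDegreeOn hp hr hball
  have hJW : ∀ᵐ x ∂volume.restrict (Ω₁ ∩ y ⁻¹' Metric.ball z₀ r), 0 < J x :=
    ae_mono (Measure.restrict_mono_set volume inter_subset_left) hJ
  have hJ₀ := hJW.mono fun _ hx => hx.le
  have hc : c = 1 :=
    hf.degree_eq_one hg hp hr hball hdeg (hf.degree_ne_zero hp hr hball' hdeg hJW) hJ₀
  refine ⟨r, hr, Metric.ball_subset_closedBall.trans hball', ?_⟩
  rw [hf.map_withDensity_eq hp hr hball' hdeg hJ₀, hc, ENNReal.ofReal_one, one_smul]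

theorem map_withDensity_eq_volume (hf : JacobianApprox Ω₁ y J f)
    (hg : JacobianApprox Ω₂ ξ J' g) (hp : IsHomeoPair Ω₁ Ω₂ y ξ)
    (hJ : ∀ᵐ x ∂volume.restrict Ω₁, 0 < J x) :
    ((volume.restrict Ω₁).withDensity fun x => ENNReal.ofReal (J x)).map y =
      volume.restrict Ω₂ := by
  set ν := (volume.restrict Ω₁).withDensity fun x => ENNReal.ofReal (J x)
  have hac : ν ≪ volume.restrict Ω₁ := withDensity_absolutelyContinuous _ _
  have hy : AEMeasurable y ν := hp.aemeasurable.mono_ac hac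
  have hrestrict {S : Set 𝔼} (hS : MeasurableSet S) : (ν.map y).restrict S =
      ((volume.restrict (Ω₁ ∩ y ⁻¹' S)).withDensity fun x => ENNReal.ofReal (J x)).map y := by
    rw [Measure.restrict_map_of_aemeasurable hy hS, restrict_withDensity',
      Measure.restrict_restrict₀ (hp.aemeasurable.nullMeasurableSet_preimage hS), inter_comm]
  choose! r hr hrΩ hmap using
    fun z₀ (hz₀ : z₀ ∈ Ω₂) => hf.exists_map_withDensity_eq_volume hg hp hJ hz₀
  obtain ⟨t, htΩ, ht, hcover⟩ := TopologicalSpace.countable_cover_nhdsWithin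
    fun z hz => mem_nhdsWithin_of_mem_nhds (Metric.ball_mem_nhds z (hr z hz))
  have hΩ₂ : Ω₂ = ⋃ z ∈ t, Metric.ball z (r z) :=
    hcover.antisymm (iUnion₂_subset fun z hz => hrΩ z (htΩ hz))
  have hlocal : (ν.map y).restrict Ω₂ = volume.restrict Ω₂ := by
    rw [hΩ₂, Measure.restrict_biUnion_congr ht]
    exact fun z hz => (hrestrict measurableSet_ball).trans (hmap z (htΩ hz))
  rwa [Measure.restrict_eq_self_of_ae_mem] at hlocal
  exact (ae_map_iff hy hp.isOpen_right.measurableSet).2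
    (hac.ae_le (ae_restrict_of_forall_mem hp.isOpen_left.measurableSet hp.mapsTo))

theorem setLIntegral_eq_volume (hf : JacobianApprox Ω₁ y J f) (hg : JacobianApprox Ω₂ ξ J' g)
    (hp : IsHomeoPair Ω₁ Ω₂ y ξ) (hJ : ∀ᵐ x ∂volume.restrict Ω₁, 0 < J x) {S : Set 𝔼}
    (hS : MeasurableSet S) (hSΩ : S ⊆ Ω₂) :
    ∫⁻ x in Ω₁ ∩ y ⁻¹' S, ENNReal.ofReal (J x) = volume S := by
  have hySm : NullMeasurableSet (y ⁻¹' S) (volume.restrict Ω₁) :=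
    hp.aemeasurable.nullMeasurableSet_preimage hS
  rw [← Measure.restrict_eq_self volume hSΩ, ← hf.map_withDensity_eq_volume hg hp hJ,
    Measure.map_apply_of_aemeasurable
      (hp.aemeasurable.mono_ac (withDensity_absolutelyContinuous _ _)) hS,
    withDensity_apply', Measure.restrict_restrict₀ hySm, inter_comm]

end JacobianApprox

end Area

/-! ### Sobolev maps satisfy the area formula -/

theorem tendsto_integral_abs_sub_of_tendsto_integral {X : Type*} [MeasurableSpace X]
    {μ : Measure X} {h : ℕ → X → ℝ} {H : X → ℝ} (hh : ∀ k, Integrable (h k) μ)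
    (hH : Integrable H μ) (hh₀ : ∀ k x, 0 ≤ h k x) (hH₀ : ∀ x, 0 ≤ H x)
    (hlim : ∀ᵐ x ∂μ, Tendsto (fun k => h k x) atTop (𝓝 (H x)))
    (hlim_integral : Tendsto (fun k => ∫ x, h k x ∂μ) atTop (𝓝 (∫ x, H x ∂μ))) :
    Tendsto (fun k => ∫ x, |h k x - H x| ∂μ) atTop (𝓝 0) := by
  have hpos : ∀ k, Integrable (fun x => max (H x - h k x) 0) μ := fun k =>
    (hH.sub (hh k)).pos_part
  have htend : Tendsto (fun k => ∫ x, max (H x - h k x) 0 ∂μ) atTop (𝓝 (∫ _, (0 : ℝ) ∂μ)) := by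
    refine tendsto_integral_of_dominated_convergence H (fun k => (hpos k).1) hH
      (fun k => Eventually.of_forall fun x => ?_) ?_
    · rw [Real.norm_of_nonneg (le_max_right _ _)]
      exact max_le (sub_le_self _ (hh₀ k x)) (hH₀ x)
    · filter_upwards [hlim] with x hx
      simpa using (hx.const_sub (H x)).max (tendsto_const_nhds (x := (0 : ℝ)))
  have hsplit : ∀ k, ∫ x, |h k x - H x| ∂μ =
      (∫ x, h k x ∂μ - ∫ x, H x ∂μ) + 2 * ∫ x, max (H x - h k x) 0 ∂μ := by
    intro k
    have hdiff : Integrable (fun x => h k x - H x) μ := (hh k).sub hH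
    rw [← integral_sub (hh k) hH, ← integral_const_mul,
      ← integral_add hdiff ((hpos k).const_mul 2)]
    refine integral_congr_ae (Eventually.of_forall fun x => ?_)
    dsimp only
    rcases le_total (H x) (h k x) with hle | hle
    · rw [abs_of_nonneg (sub_nonneg.2 hle), max_eq_right (sub_nonpos.2 hle)]
      ring
    · rw [abs_of_nonpos (sub_nonpos.2 hle), max_eq_left (sub_nonneg.2 hle)]
      ring
  simpa [hsplit] using (hlim_integral.sub_const (∫ x, H x ∂μ)).add (htend.const_mul 2)

theorem tendsto_integral_zero_of_le_of_tendsto_integral_abs_sub {X : Type*} [MeasurableSpace X]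
    {μ : Measure X} {D h : ℕ → X → ℝ} {H : X → ℝ} (hD : ∀ k, AEStronglyMeasurable (D k) μ)
    (hD₀ : ∀ k x, 0 ≤ D k x) (hle : ∀ k x, D k x ≤ h k x) (hh : ∀ k, Integrable (h k) μ)
    (hH : Integrable H μ) (hDlim : ∀ᵐ x ∂μ, Tendsto (fun k => D k x) atTop (𝓝 0))
    (hhlim : Tendsto (fun k => ∫ x, |h k x - H x| ∂μ) atTop (𝓝 0)) :
    Tendsto (fun k => ∫ x, D k x ∂μ) atTop (𝓝 0) := by
  have hnorm : ∀ k x, ‖min (D k x) |H x|‖ ≤ |H x| := fun k x => by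
    rw [Real.norm_of_nonneg (le_min (hD₀ k x) (abs_nonneg _))]
    exact min_le_right _ _
  have hminm : ∀ k, AEStronglyMeasurable (fun x => min (D k x) |H x|) μ := fun k =>
    (hD k).inf hH.abs.1
  have hmin : Tendsto (fun k => ∫ x, min (D k x) |H x| ∂μ) atTop (𝓝 (∫ _, (0 : ℝ) ∂μ)) := by
    refine tendsto_integral_of_dominated_convergence (fun x => |H x|) hminm hH.abs
      (fun k => Eventually.of_forall (hnorm k)) ?_
    filter_upwards [hDlim] with x hx
    simpa using hx.min (tendsto_const_nhds (x := |H x|))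
  have hsum := hmin.add hhlim
  rw [integral_zero, add_zero] at hsum
  refine squeeze_zero (fun k => integral_nonneg (hD₀ k)) (fun k => ?_) hsum
  have hmini : Integrable (fun x => min (D k x) |H x|) μ :=
    hH.abs.mono' (hminm k) (Eventually.of_forall (hnorm k))
  have hdiff : Integrable (fun x => |h k x - H x|) μ := ((hh k).sub hH).abs
  rw [← integral_add hmini hdiff]
  refine integral_mono_of_nonneg (Eventually.of_forall (hD₀ k)) (hmini.add hdiff)
    (Eventually.of_forall fun x => ?_)
  rcases le_total (D k x) |H x| with hx | hx
  · simp [min_eq_left hx]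
  · simp only [min_eq_right hx]
    linarith [hle k x, le_abs_self (h k x - H x), le_abs_self (H x)]

theorem abs_det_le_norm_pow {E : Type*} [NormedAddCommGroup E] [NormedSpace ℝ E]
    [FiniteDimensional ℝ E] (L : E →L[ℝ] E) : |L.det| ≤ ‖L‖ ^ Module.finrank ℝ E := by
  borelize E
  let μ : Measure E := Measure.addHaar
  have hsub : L '' Metric.closedBall 0 1 ⊆ Metric.closedBall 0 ‖L‖ := by
    rintro - ⟨x, hx, rfl⟩
    rw [mem_closedBall_zero_iff] at hx ⊢
    exact L.unit_le_opNorm x hx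
  have hvol := measure_mono (μ := μ) hsub
  rw [Measure.addHaar_image_continuousLinearMap, Measure.addHaar_closedBall _ _ (norm_nonneg L),
    Measure.addHaar_closedBall _ _ zero_le_one, one_pow, ENNReal.ofReal_one, one_mul,
    ENNReal.mul_le_mul_iff_left (Metric.measure_ball_pos μ 0 one_pos).ne' measure_ball_lt_top.ne,
    ENNReal.ofReal_le_ofReal_iff (by positivity)] at hvol
  exact hvol

section SobolevApproximation

theorem tendsto_integral_abs_mollify_sub {u : 𝔼 → ℝ} (hu : Integrable u) (hu₀ : ∀ x, 0 ≤ u x) :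
    Tendsto (fun k => ∫ x, |mollify k u x - u x|) atTop (𝓝 0) := by
  refine tendsto_integral_abs_sub_of_tendsto_integral (integrable_mollify hu) hu
    (fun k x => ?_) hu₀ (ae_tendsto_mollify hu.locallyIntegrable) ?_
  · rw [mollify_apply]
    exact integral_nonneg fun t => mul_nonneg ((shrinkingBump n k).nonneg_normed _) (hu₀ t)
  · simp only [integral_mollify hu, tendsto_const_nhds]

theorem norm_mollify_pow_le {F : Type*} [NormedAddCommGroup F] [NormedSpace ℝ F] [CompleteSpace F]
    {u : 𝔼 → F} (hu : LocallyIntegrable u) (p : ℕ) (hup : LocallyIntegrable fun x => ‖u x‖ ^ p)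
    (k : ℕ) (x : 𝔼) : ‖mollify k u x‖ ^ p ≤ mollify k (fun x => ‖u x‖ ^ p) x :=
  map_mollify_le_mollify_comp ((convexOn_norm convex_univ).pow (fun _ _ => norm_nonneg _) p)
    (continuous_norm.pow p) hu hup k x

theorem integrable_det {A : 𝔼 → 𝔼 →L[ℝ] 𝔼} (hA : AEStronglyMeasurable A)
    (hAn : Integrable fun x => ‖A x‖ ^ n) : Integrable fun x => (A x).det :=
  hAn.mono' (ContinuousLinearMap.continuous_det.comp_aestronglyMeasurable hA)
    (Eventually.of_forall fun x => by simpa using abs_det_le_norm_pow (A x))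

theorem integrable_det_mollify {A : 𝔼 → 𝔼 →L[ℝ] 𝔼} (hA : Integrable A)
    (hAn : Integrable fun x => ‖A x‖ ^ n) (k : ℕ) : Integrable fun x => (mollify k A x).det := by
  have hcont := (contDiff_mollify hA.locallyIntegrable k).continuous
  refine integrable_det hcont.aestronglyMeasurable
    ((integrable_mollify hAn k).mono' (hcont.norm.pow n).aestronglyMeasurable
      (Eventually.of_forall fun x => ?_))
  rw [Real.norm_of_nonneg (by positivity)]
  exact norm_mollify_pow_le hA.locallyIntegrable n hAn.locallyIntegrable k x

theorem tendsto_integral_abs_det_mollify_sub {A : 𝔼 → 𝔼 →L[ℝ] 𝔼} (hA : Integrable A)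
    (hAn : Integrable fun x => ‖A x‖ ^ n) :
    Tendsto (fun k => ∫ x, |(mollify k A x).det - (A x).det|) atTop (𝓝 0) := by
  have hdet : ∀ L : 𝔼 →L[ℝ] 𝔼, |L.det| ≤ ‖L‖ ^ n := fun L => by
    simpa using abs_det_le_norm_pow L
  refine tendsto_integral_zero_of_le_of_tendsto_integral_abs_sub
    (h := fun k x => mollify k (fun x => ‖A x‖ ^ n) x + ‖A x‖ ^ n)
    (H := fun x => ‖A x‖ ^ n + ‖A x‖ ^ n)
    (fun k => ((integrable_det_mollify hA hAn k).sub (integrable_det hA.1 hAn)).abs.1)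
    (fun _ _ => abs_nonneg _) (fun k x => ?_)
    (fun k => (integrable_mollify hAn k).add hAn) (hAn.add hAn) ?_ ?_
  · exact (abs_sub _ _).trans (add_le_add ((hdet _).trans
      (norm_mollify_pow_le hA.locallyIntegrable n hAn.locallyIntegrable k x)) (hdet _))
  · filter_upwards [ae_tendsto_mollify hA.locallyIntegrable] with x hx
    have hdetx := (ContinuousLinearMap.continuous_det.tendsto (A x)).comp hx
    simpa using (hdetx.sub_const (A x).det).abs
  · simpa only [add_sub_add_right_eq_sub] using
      tendsto_integral_abs_mollify_sub hAn fun _ => by positivity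

/-- The matrix field `G` on `Ω`, as a field of operators extended by zero outside `Ω`. -/
noncomputable def operatorField (Ω : Set 𝔼) (G : 𝔼 → Matrix (Fin n) (Fin n) ℝ) : 𝔼 → 𝔼 →L[ℝ] 𝔼 :=
  Ω.indicator fun x => Matrix.toEuclideanCLM (𝕜 := ℝ) (G x)

theorem operatorField_single_apply (Ω : Set 𝔼) (G : 𝔼 → Matrix (Fin n) (Fin n) ℝ) (x : 𝔼)
    (i j : Fin n) : operatorField Ω G x (EuclideanSpace.single j 1) i =
      Ω.indicator (fun t => G t i j) x := by
  by_cases hx : x ∈ Ω <;> simp [operatorField, hx, Matrix.ofLp_toEuclideanCLM]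

theorem det_operatorField {Ω : Set 𝔼} {x : 𝔼} (hx : x ∈ Ω) (G : 𝔼 → Matrix (Fin n) (Fin n) ℝ) :
    (operatorField Ω G x).det = (G x).det := by
  simp only [det_eq_matrix_det, operatorField_single_apply, indicator_of_mem hx]
  rfl

theorem memLp_operatorField {p : ℝ≥0∞} {Ω : Set 𝔼} (hΩ : MeasurableSet Ω)
    {G : 𝔼 → Matrix (Fin n) (Fin n) ℝ}
    (hG : ∀ i j, MemLp (fun x => G x i j) p (volume.restrict Ω)) :
    MemLp (operatorField Ω G) p := by
  let T : (Fin n → Fin n → ℝ) →ₗ[ℝ] (𝔼 →L[ℝ] 𝔼) :=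
    (Matrix.toEuclideanCLM (𝕜 := ℝ) (n := Fin n)).toAlgEquiv.toLinearMap
  exact (memLp_indicator_iff_restrict hΩ).2 (T.toContinuousLinearMap.comp_memLp'
    (memLp_pi_iff.2 fun i => memLp_pi_iff.2 fun j => hG i j))

theorem IsWeakGradient.fderiv_mollify {Ω : Set 𝔼} (hΩ : MeasurableSet Ω) {y : 𝔼 → 𝔼}
    {G : 𝔼 → Matrix (Fin n) (Fin n) ℝ} (hG : IsWeakGradient Ω y G)
    (hy : LocallyIntegrable (Ω.indicator y)) (hGi : LocallyIntegrable (operatorField Ω G))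
    {k : ℕ} {x : 𝔼} (hx : Metric.closedBall x (1 / ((k : ℝ) + 1)) ⊆ Ω) :
    fderiv ℝ (mollify k (Ω.indicator y)) x = mollify k (operatorField Ω G) x := by
  refine ContinuousLinearMap.coe_injective
    ((EuclideanSpace.basisFun (Fin n) ℝ).toBasis.ext fun j => ?_)
  ext i
  let entry : (𝔼 →L[ℝ] 𝔼) →L[ℝ] ℝ := (EuclideanSpace.proj i).comp
    (ContinuousLinearMap.apply ℝ 𝔼 (EuclideanSpace.single j (1 : ℝ) : 𝔼))
  have hentry : entry (mollify k (operatorField Ω G) x) =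
      mollify k (Ω.indicator fun t => G t i j) x := by
    simp only [mollify_apply]
    rw [← entry.integral_comp_comm (integrable_mollifier_smul hGi k x)]
    simp [entry, operatorField_single_apply]
  simpa [entry] using (hG.fderiv_mollify_apply hΩ hy hx i j).trans hentry.symm

theorem IsWeakGradient.jacobianApprox (hn : n ≠ 0) {Ω : Set 𝔼} (hΩ : IsOpen Ω)
    (hΩf : volume Ω ≠ ⊤) {y : 𝔼 → 𝔼} {G : 𝔼 → Matrix (Fin n) (Fin n) ℝ}
    (hG : IsWeakGradient Ω y G) (hy : ContinuousOn y Ω) (hyi : Integrable (Ω.indicator y))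
    (hGp : ∀ i j, MemLp (fun x => G x i j) (n : ℝ≥0∞) (volume.restrict Ω)) :
    JacobianApprox Ω y (fun x => (G x).det) fun k => mollify k (Ω.indicator y) := by
  have hΩm := hΩ.measurableSet
  have : IsFiniteMeasure (volume.restrict Ω) := ⟨by simpa using hΩf.lt_top⟩
  have hA : Integrable (operatorField Ω G) := memLp_one_iff_integrable.1
    (memLp_operatorField hΩm fun i j =>
      (hGp i j).mono_exponent (by exact_mod_cast Nat.one_le_iff_ne_zero.2 hn))
  have hAn : Integrable fun x => ‖operatorField Ω G x‖ ^ n :=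
    (memLp_operatorField hΩm hGp).integrable_norm_pow hn
  refine ⟨contDiff_mollify hyi.locallyIntegrable,
    fun C hC hCc => tendstoUniformlyOn_mollify hΩ hy hCc hC,
    fun C hC _ => ((integrable_det hA.1 hAn).integrableOn.congr_fun
      (fun x hx => det_operatorField hx G) hΩm).mono_set hC, fun C hC hCc => ?_⟩
  refine squeeze_zero' (Eventually.of_forall fun k => integral_nonneg fun _ => abs_nonneg _) ?_
    (tendsto_integral_abs_det_mollify_sub hA hAn)
  filter_upwards [eventually_forall_closedBall_subset hΩ hCc hC] with k hk
  calc ∫ x in C, |(fderiv ℝ (mollify k (Ω.indicator y)) x).det - (G x).det|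
      = ∫ x in C, |(mollify k (operatorField Ω G) x).det - (operatorField Ω G x).det| := by
        refine setIntegral_congr_fun hCc.measurableSet fun x hx => ?_
        rw [hG.fderiv_mollify hΩm hyi.locallyIntegrable hA.locallyIntegrable (hk x hx),
          det_operatorField (hC hx)]
    _ ≤ ∫ x, |(mollify k (operatorField Ω G) x).det - (operatorField Ω G x).det| :=
        setIntegral_le_integral
          ((integrable_det_mollify hA hAn k).sub (integrable_det hA.1 hAn)).abs
          (Eventually.of_forall fun _ => abs_nonneg _)

theorem MemSobolev.isWeakGradient_weakGradient {p : ℝ≥0∞} {Ω : Set 𝔼} {y : 𝔼 → 𝔼}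
    (h : MemSobolev p Ω y) : IsWeakGradient Ω y (weakGradient Ω y) := by
  obtain ⟨-, G, hG, -⟩ := h
  have hex : ∃ G, IsWeakGradient Ω y G := ⟨G, hG⟩
  rw [weakGradient, dif_pos hex]
  exact hex.choose_spec

theorem IsWeakGradient.integrableOn_mul {Ω : Set 𝔼} (hΩ : MeasurableSet Ω) {y : 𝔼 → 𝔼}
    {G : 𝔼 → Matrix (Fin n) (Fin n) ℝ} (hG : IsWeakGradient Ω y G) {φ : 𝔼 → ℝ}
    (hφ : Continuous φ) (hφc : HasCompactSupport φ) (hφs : tsupport φ ⊆ Ω) (i j : Fin n) :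
    IntegrableOn (fun x => G x i j * φ x) Ω := by
  have hsupp : IntegrableOn (fun x => G x i j * φ x) (tsupport φ) :=
    ((hG.locallyIntegrableOn_grad i j).integrableOn_compact_subset hφs hφc).mul_continuousOn
      hφ.continuousOn hφc
  refine hsupp.of_forall_sdiff_eq_zero hΩ fun x hx => ?_
  rw [image_eq_zero_of_notMem_tsupport hx.2, mul_zero]

theorem IsWeakGradient.ae_eq {Ω : Set 𝔼} (hΩ : IsOpen Ω) {y : 𝔼 → 𝔼}
    {G G' : 𝔼 → Matrix (Fin n) (Fin n) ℝ} (hG : IsWeakGradient Ω y G)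
    (hG' : IsWeakGradient Ω y G') : ∀ᵐ x ∂volume.restrict Ω, G x = G' x := by
  have hentry : ∀ i j, ∀ᵐ x, x ∈ Ω → G x i j - G' x i j = 0 := by
    intro i j
    refine hΩ.ae_eq_zero_of_integral_contDiff_smul_eq_zero ((hG.locallyIntegrableOn_grad i j).sub
      (hG'.locallyIntegrableOn_grad i j)) fun φ hφ hφc hφs => ?_
    have hsame : ∫ x in Ω, G x i j * φ x = ∫ x in Ω, G' x i j * φ x := neg_injective
      ((hG.integral_eq φ hφ hφc hφs i j).symm.trans (hG'.integral_eq φ hφ hφc hφs i j))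
    rw [← setIntegral_eq_integral_of_forall_compl_eq_zero (s := Ω)]
    · simp only [smul_eq_mul, mul_comm (φ _), sub_mul]
      rw [integral_sub (hG.integrableOn_mul hΩ.measurableSet hφ.continuous hφc hφs i j)
        (hG'.integrableOn_mul hΩ.measurableSet hφ.continuous hφc hφs i j), hsame, sub_self]
    · intro x hx
      rw [image_eq_zero_of_notMem_tsupport fun hmem => hx (hφs hmem), zero_smul]
  rw [ae_restrict_iff' hΩ.measurableSet]
  filter_upwards [ae_all_iff.2 fun i => ae_all_iff.2 fun j => hentry i j] with x hx hxΩ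
  ext i j
  exact sub_eq_zero.1 (hx i j hxΩ)

theorem MemSobolev.memLp_weakGradient {p : ℝ≥0∞} {Ω : Set 𝔼} (hΩ : IsOpen Ω) {y : 𝔼 → 𝔼}
    (h : MemSobolev p Ω y) (i j : Fin n) :
    MemLp (fun x => weakGradient Ω y x i j) p (volume.restrict Ω) := by
  obtain ⟨G, hG, hGp⟩ := h.2
  refine (hGp i j).ae_eq ?_
  filter_upwards [hG.ae_eq hΩ h.isWeakGradient_weakGradient] with x hx
  rw [hx]

theorem MemSobolev.jacobianApprox (hn : n ≠ 0) {Ω : Set 𝔼} (hΩ : IsOpen Ω)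
    (hΩf : volume Ω ≠ ⊤) {y : 𝔼 → 𝔼} (h : MemSobolev (n : ℝ≥0∞) Ω y) (hy : ContinuousOn y Ω) :
    JacobianApprox Ω y (fun x => (weakGradient Ω y x).det) fun k => mollify k (Ω.indicator y) := by
  have : IsFiniteMeasure (volume.restrict Ω) := ⟨by simpa using hΩf.lt_top⟩
  have hyi : IntegrableOn y Ω :=
    h.1.integrable (by exact_mod_cast Nat.one_le_iff_ne_zero.2 hn)
  exact h.isWeakGradient_weakGradient.jacobianApprox hn hΩ hΩf hy
    ((integrable_indicator_iff hΩ.measurableSet).2 hyi) (h.memLp_weakGradient hΩ)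

theorem setLIntegral_det_weakGradient_eq_volume (hn : n ≠ 0) {Ω₁ Ω₂ : Set 𝔼} {y ξ : 𝔼 → 𝔼}
    (hp : IsHomeoPair Ω₁ Ω₂ y ξ) (hΩ₁ : volume Ω₁ ≠ ⊤) (hΩ₂ : volume Ω₂ ≠ ⊤)
    (hy : MemSobolev (n : ℝ≥0∞) Ω₁ y) (hξ : MemSobolev (n : ℝ≥0∞) Ω₂ ξ)
    (hpos : ∀ᵐ x ∂volume.restrict Ω₁, 0 < (weakGradient Ω₁ y x).det) {S : Set 𝔼}
    (hS : MeasurableSet S) (hSΩ : S ⊆ Ω₂) :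
    ∫⁻ x in Ω₁ ∩ y ⁻¹' S, ENNReal.ofReal (weakGradient Ω₁ y x).det = volume S :=
  (hy.jacobianApprox hn hp.isOpen_left hΩ₁ hp.continuousOn).setLIntegral_eq_volume
    (hξ.jacobianApprox hn hp.isOpen_right hΩ₂ hp.continuousOn_inv) hp hpos hS hSΩ

end SobolevApproximation

/-! ### Singular values and conformal matrices -/

section SingularValues

theorem singVal_nonneg (A : Matrix (Fin n) (Fin n) ℝ) (i : Fin n) : 0 ≤ singVal A i :=
  LinearMap.singularValues_nonneg _ _

theorem prod_singVal (A : Matrix (Fin n) (Fin n) ℝ) : ∏ i, singVal A i = |A.det| := by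
  have det_eq : LinearMap.det (Matrix.toEuclideanLin A) = A.det := by
    rw [Matrix.toEuclideanLin_eq_toLin_orthonormal, LinearMap.det_toLin]
  rw [← det_eq, ← LinearMap.normDet_eq_abs_det, LinearMap.normDet_eq_prod_singularValues,
    finrank_euclideanSpace_fin, ← Fin.prod_univ_eq_prod_range]
  rfl

theorem singVal_pos {A : Matrix (Fin n) (Fin n) ℝ} (hA : 0 < A.det) (i : Fin n) :
    0 < singVal A i := by
  have hprod : ∏ i, singVal A i ≠ 0 := by
    rw [prod_singVal]
    exact (abs_pos.2 hA.ne').ne'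
  exact (singVal_nonneg A i).lt_of_ne' (Finset.prod_ne_zero_iff.1 hprod i (Finset.mem_univ i))

/-- The square of the Frobenius norm. -/
noncomputable def frobSq (A : Matrix (Fin n) (Fin n) ℝ) : ℝ := ∑ i, ∑ j, A i j ^ 2

theorem sq_singVal (A : Matrix (Fin n) (Fin n) ℝ) (i : Fin n) : singVal A i ^ 2 =
    (Matrix.toEuclideanLin A).isSymmetric_adjoint_comp_self.eigenvalues
      finrank_euclideanSpace_fin i :=
  LinearMap.sq_singularValues_fin _ finrank_euclideanSpace_fin i

theorem sum_sq_singVal (A : Matrix (Fin n) (Fin n) ℝ) : ∑ i, singVal A i ^ 2 = frobSq A := by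
  have trace_eq :=
    (Matrix.toEuclideanLin A).isSymmetric_adjoint_comp_self.trace_eq_sum_eigenvalues
      (finrank_euclideanSpace_fin (𝕜 := ℝ) (n := n))
  simp only [RCLike.ofReal_real_eq_id, id] at trace_eq
  simp_rw [sq_singVal]
  rw [← trace_eq, LinearMap.trace_eq_sum_inner _ (EuclideanSpace.basisFun (Fin n) ℝ), frobSq,
    Finset.sum_comm]
  refine Finset.sum_congr rfl fun i _ => ?_
  rw [LinearMap.comp_apply, LinearMap.adjoint_inner_right, real_inner_self_eq_norm_sq,
    EuclideanSpace.real_norm_sq_eq]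
  simp [Matrix.toLpLin_apply]

theorem isSymmetric_eq_smul_id {V : Type*} [NormedAddCommGroup V] [InnerProductSpace ℝ V]
    [FiniteDimensional ℝ V] {S : V →ₗ[ℝ] V} (hS : S.IsSymmetric)
    (hn : Module.finrank ℝ V = n) {μ : ℝ} (h : ∀ i, hS.eigenvalues hn i = μ) :
    S = μ • LinearMap.id :=
  (hS.eigenvectorBasis hn).toBasis.ext fun i => by
    simp [h i, hS.apply_eigenvectorBasis hn i]

theorem norm_toEuclideanLin_sq (A : Matrix (Fin n) (Fin n) ℝ) (x : 𝔼) :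
    ‖Matrix.toEuclideanLin A x‖ ^ 2 =
      inner ℝ x (((Matrix.toEuclideanLin A).adjoint ∘ₗ Matrix.toEuclideanLin A) x) := by
  rw [LinearMap.comp_apply, LinearMap.adjoint_inner_right, real_inner_self_eq_norm_sq]

theorem norm_toEuclideanLin_of_singVal_eq {A : Matrix (Fin n) (Fin n) ℝ} {c : ℝ} (hc : 0 ≤ c)
    (h : ∀ i, singVal A i = c) (x : 𝔼) : ‖Matrix.toEuclideanLin A x‖ = c * ‖x‖ := by
  have gram_eq : (Matrix.toEuclideanLin A).adjoint ∘ₗ Matrix.toEuclideanLin A =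
      (c ^ 2) • LinearMap.id :=
    isSymmetric_eq_smul_id _ finrank_euclideanSpace_fin fun i => by rw [← sq_singVal, h i]
  rw [← sq_eq_sq₀ (norm_nonneg _) (by positivity), norm_toEuclideanLin_sq, gram_eq,
    LinearMap.smul_apply, LinearMap.id_apply, real_inner_smul_right, real_inner_self_eq_norm_sq,
    mul_pow]

theorem singVal_eq_of_norm_toEuclideanLin {A : Matrix (Fin n) (Fin n) ℝ} {c : ℝ} (hc : 0 ≤ c)
    (h : ∀ x, ‖Matrix.toEuclideanLin A x‖ = c * ‖x‖) (i : Fin n) : singVal A i = c := by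
  have hi : (i : ℕ) < Module.finrank ℝ 𝔼 := by
    rw [finrank_euclideanSpace_fin]
    exact i.2
  obtain ⟨x, hx⟩ := (LinearMap.hasEigenvalue_adjoint_comp_self_sq_singularValues
    (Matrix.toEuclideanLin A) hi).exists_hasEigenvector
  have norm_sq_eq : (c * ‖x‖) ^ 2 = singVal A i ^ 2 * ‖x‖ ^ 2 := by
    rw [← h x, norm_toEuclideanLin_sq, hx.apply_eq_smul, real_inner_smul_right,
      real_inner_self_eq_norm_sq]
    rfl
  rw [mul_pow] at norm_sq_eq
  have hx_pos : 0 < ‖x‖ := norm_pos_iff.2 hx.2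
  exact ((sq_eq_sq₀ hc (singVal_nonneg A i)).1
    (mul_right_cancel₀ (pow_pos hx_pos 2).ne' norm_sq_eq)).symm

theorem norm_toEuclideanLin_of_mem_orthogonalGroup {R : Matrix (Fin n) (Fin n) ℝ}
    (hR : R ∈ Matrix.orthogonalGroup (Fin n) ℝ) (x : 𝔼) : ‖Matrix.toEuclideanLin R x‖ = ‖x‖ := by
  have hRR : R.conjTranspose * R = 1 := Matrix.mem_unitaryGroup_iff'.1 hR
  rw [← sq_eq_sq₀ (norm_nonneg _) (norm_nonneg _), norm_toEuclideanLin_sq,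
    ← Matrix.toEuclideanLin_conjTranspose_eq_adjoint, LinearMap.comp_apply, Matrix.toLpLin_apply,
    Matrix.toLpLin_apply, Matrix.mulVec_mulVec, hRR, Matrix.one_mulVec,
    real_inner_self_eq_norm_sq]

theorem mem_orthogonalGroup_of_norm_toEuclideanLin {R : Matrix (Fin n) (Fin n) ℝ}
    (h : ∀ x, ‖Matrix.toEuclideanLin R x‖ = ‖x‖) : R ∈ Matrix.orthogonalGroup (Fin n) ℝ := by
  refine Matrix.mem_unitaryGroup_iff'.2 (Matrix.toEuclideanLin.injective ?_)
  refine LinearMap.ext fun x => ext_inner_right ℝ fun z => ?_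
  have star_mul_apply : Matrix.toEuclideanLin (star R * R) x =
      (Matrix.toEuclideanLin R).adjoint (Matrix.toEuclideanLin R x) := by
    rw [← Matrix.toEuclideanLin_conjTranspose_eq_adjoint]
    simp [Matrix.toLpLin_apply, Matrix.mulVec_mulVec, Matrix.star_eq_conjTranspose]
  rw [star_mul_apply, LinearMap.adjoint_inner_left,
    (LinearMap.norm_map_iff_inner_map_map (Matrix.toEuclideanLin R)).1 h]
  simp

theorem det_smul_of_mem_specialOrthogonalGroup {R : Matrix (Fin n) (Fin n) ℝ}
    (hR : R ∈ Matrix.specialOrthogonalGroup (Fin n) ℝ) (c : ℝ) : (c • R).det = c ^ n := by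
  rw [Matrix.det_smul, Fintype.card_fin, (Matrix.mem_specialOrthogonalGroup_iff.1 hR).2, mul_one]

theorem singVal_smul_of_mem_orthogonalGroup {R : Matrix (Fin n) (Fin n) ℝ}
    (hR : R ∈ Matrix.orthogonalGroup (Fin n) ℝ) {c : ℝ} (hc : 0 ≤ c) (i : Fin n) :
    singVal (c • R) i = c := by
  refine singVal_eq_of_norm_toEuclideanLin hc (fun x => ?_) i
  rw [map_smul, LinearMap.smul_apply, norm_smul, Real.norm_of_nonneg hc,
    norm_toEuclideanLin_of_mem_orthogonalGroup hR]

end SingularValues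

/-! ### Lower bounds for the elastic energy -/

section PowerMeans

variable {v : Fin n → ℝ}

theorem prod_rpow_inv (hv : ∀ i, 0 < v i) (r : ℝ) :
    ∏ i, (v i ^ r) ^ ((n : ℝ)⁻¹) = (∏ i, v i) ^ (r / n) := by
  rw [← Real.finsetProd_rpow _ _ fun i _ => (hv i).le]
  exact Finset.prod_congr rfl fun i _ => by rw [← Real.rpow_mul (hv i).le, div_eq_mul_inv]

theorem mul_rpow_prod_le_sum_rpow (hn : n ≠ 0) (hv : ∀ i, 0 < v i) (r : ℝ) :
    n * (∏ i, v i) ^ (r / n) ≤ ∑ i, v i ^ r := by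
  have hn_pos : (0 : ℝ) < n := by positivity
  have amgm := Real.geom_mean_le_arith_mean_weighted Finset.univ (fun _ : Fin n => (n : ℝ)⁻¹)
    (fun i => v i ^ r) (fun _ _ => by positivity) (by simp [hn_pos.ne'])
    fun i _ => (Real.rpow_pos_of_pos (hv i) r).le
  rwa [prod_rpow_inv hv, ← Finset.mul_sum, inv_mul_eq_div, le_div_iff₀ hn_pos, mul_comm] at amgm

theorem eq_of_mul_rpow_prod_eq_sum_rpow (hn : n ≠ 0) (hv : ∀ i, 0 < v i) {r : ℝ}
    (hr : r ≠ 0) (h : n * (∏ i, v i) ^ (r / n) = ∑ i, v i ^ r) (i j : Fin n) : v i = v j := by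
  have hn_pos : (0 : ℝ) < n := by positivity
  have rpow_eq : v i ^ r = v j ^ r :=
    (Real.geom_mean_eq_arith_mean_weighted_iff_of_pos Finset.univ
      (fun _ : Fin n => (n : ℝ)⁻¹) (fun i => v i ^ r) (fun _ _ => by positivity)
      (by simp [hn_pos.ne']) fun i _ => (Real.rpow_pos_of_pos (hv i) r).le).1
      (by rw [prod_rpow_inv hv, ← Finset.mul_sum, ← h, inv_mul_cancel_left₀ hn_pos.ne'])
      i (Finset.mem_univ i) j (Finset.mem_univ j)
  exact (Real.rpow_left_inj (hv i).le (hv j).le hr).1 rpow_eq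

theorem mul_rpow_mean_sq_le_sum_rpow {α : ℝ} (hn : n ≠ 0) (hα : (n : ℝ) ≤ α)
    (hv : ∀ i, 0 ≤ v i) : n * ((∑ i, v i ^ 2) / n) ^ (α / 2) ≤ ∑ i, v i ^ α := by
  have hn_pos : (0 : ℝ) < n := by positivity
  have rpow_sq : ∀ i, (v i ^ 2) ^ (α / 2) = v i ^ α := fun i => by
    rw [← Real.rpow_two, ← Real.rpow_mul (hv i), mul_div_cancel₀ α two_ne_zero]
  obtain rfl | hn_two : n = 1 ∨ 2 ≤ n := by omega
  · simp [rpow_sq]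
  · have hα_half : 1 ≤ α / 2 := by
      have : (2 : ℝ) ≤ n := by exact_mod_cast hn_two
      linarith
    have power_mean := Real.rpow_arith_mean_le_arith_mean_rpow Finset.univ
      (fun _ : Fin n => (n : ℝ)⁻¹) (fun i => v i ^ 2) (fun _ _ => by positivity)
      (by simp [hn_pos.ne']) (fun i _ => by positivity) hα_half
    simp_rw [rpow_sq] at power_mean
    rwa [← Finset.mul_sum, ← Finset.mul_sum, inv_mul_eq_div, inv_mul_eq_div,
      le_div_iff₀ hn_pos, mul_comm] at power_mean

end PowerMeans

section Energy

variable {α : ℝ} {h : ℝ → ℝ} {A : Matrix (Fin n) (Fin n) ℝ}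

/-- The energy `Ψ(δ^{1/n} R)`, `R ∈ SO(n)`, of a dilation with determinant `δ`. -/
noncomputable def dilationEnergy (n : ℕ) (α : ℝ) (h : ℝ → ℝ) (δ : ℝ) : ℝ :=
  n * δ ^ (α / n) + n * δ ^ (1 - α / n) + h δ

/-- A lower bound for `Ψ(A)` that depends on `A` through `|A|` and `det A` only. Unlike `Ψ`, it is
visibly a measurable function of the entries of `A`. -/
noncomputable def isotropicEnergy (α : ℝ) (h : ℝ → ℝ) (A : Matrix (Fin n) (Fin n) ℝ) : ℝ :=
  n * (frobSq A / n) ^ (α / 2) + n * A.det ^ (1 - α / n) + h A.det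

theorem isotropicEnergy_le_elasticEnergy (hn : n ≠ 0) (hα : (n : ℝ) ≤ α) (hA : 0 < A.det) :
    isotropicEnergy α h A ≤ elasticEnergy α h A := by
  have sum_rpow := mul_rpow_mean_sq_le_sum_rpow hn hα (singVal_nonneg A)
  have sum_rpow_neg := mul_rpow_prod_le_sum_rpow hn (singVal_pos hA) (-α)
  have rpow_one_sub : A.det ^ (1 - α / n) = A.det * A.det ^ (-α / n) := by
    rw [sub_eq_add_neg, Real.rpow_add hA, Real.rpow_one, neg_div]
  rw [prod_singVal, abs_of_pos hA] at sum_rpow_neg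
  rw [sum_sq_singVal] at sum_rpow
  rw [isotropicEnergy, elasticEnergy, rpow_one_sub, mul_left_comm]
  gcongr

theorem mul_rpow_det_le_frobSq (hn : n ≠ 0) (hA : 0 < A.det) :
    n * A.det ^ ((2 : ℝ) / n) ≤ frobSq A := by
  simpa only [prod_singVal, abs_of_pos hA, Real.rpow_two, sum_sq_singVal] using
    mul_rpow_prod_le_sum_rpow hn (singVal_pos hA) 2

theorem singVal_eq_of_mul_rpow_det_eq_frobSq (hn : n ≠ 0) (hA : 0 < A.det)
    (heq : n * A.det ^ ((2 : ℝ) / n) = frobSq A) (i j : Fin n) : singVal A i = singVal A j := by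
  refine eq_of_mul_rpow_prod_eq_sum_rpow hn (singVal_pos hA) (two_ne_zero (α := ℝ)) ?_ i j
  simpa only [prod_singVal, abs_of_pos hA, Real.rpow_two, sum_sq_singVal] using heq

theorem rpow_det_eq (hA : 0 < A.det) : A.det ^ (α / n) = (A.det ^ ((2 : ℝ) / n)) ^ (α / 2) := by
  rw [← Real.rpow_mul hA.le]
  congr 1
  field_simp

theorem dilationEnergy_le_isotropicEnergy (hn : n ≠ 0) (hα : 0 ≤ α) (hA : 0 < A.det) :
    dilationEnergy n α h A.det ≤ isotropicEnergy α h A := by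
  have hn_pos : (0 : ℝ) < n := by positivity
  have mean_le : A.det ^ ((2 : ℝ) / n) ≤ frobSq A / n :=
    (le_div_iff₀' hn_pos).2 (mul_rpow_det_le_frobSq hn hA)
  rw [dilationEnergy, isotropicEnergy, rpow_det_eq hA]
  gcongr

theorem singVal_eq_of_isotropicEnergy_eq (hn : n ≠ 0) (hα : 0 < α) (hA : 0 < A.det)
    (heq : isotropicEnergy α h A = dilationEnergy n α h A.det) (i j : Fin n) :
    singVal A i = singVal A j := by
  have hn_pos : (0 : ℝ) < n := by positivity
  have frobSq_nonneg : 0 ≤ frobSq A :=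
    Finset.sum_nonneg fun _ _ => Finset.sum_nonneg fun _ _ => sq_nonneg _
  have rpow_eq : (A.det ^ ((2 : ℝ) / n)) ^ (α / 2) = (frobSq A / n) ^ (α / 2) := by
    rw [dilationEnergy, isotropicEnergy, rpow_det_eq hA] at heq
    exact mul_left_cancel₀ hn_pos.ne' (by linarith)
  refine singVal_eq_of_mul_rpow_det_eq_frobSq hn hA ?_ i j
  rw [(Real.rpow_left_inj (Real.rpow_nonneg hA.le _) (by positivity) (by positivity)).1 rpow_eq,
    mul_div_cancel₀ _ hn_pos.ne']

theorem norm_toEuclideanLin_of_singVal_eq_singVal {c : ℝ} (hc : 0 < c) (hA : A.det = c ^ n)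
    (hs : ∀ i j, singVal A i = singVal A j) (x : 𝔼) :
    ‖Matrix.toEuclideanLin A x‖ = c * ‖x‖ := by
  refine norm_toEuclideanLin_of_singVal_eq hc.le (fun i => ?_) x
  have pow_eq : singVal A i ^ n = c ^ n := by
    rw [← abs_of_pos (pow_pos hc n), ← hA, ← prod_singVal,
      Finset.prod_congr rfl fun j _ => hs j i, Finset.prod_const, Finset.card_univ,
      Fintype.card_fin]
  exact (pow_left_inj₀ (singVal_nonneg A i) hc.le (Fin.pos i).ne').1 pow_eq

theorem elasticEnergy_smul_of_mem_specialOrthogonalGroup (hn : n ≠ 0)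
    {R : Matrix (Fin n) (Fin n) ℝ} (hR : R ∈ Matrix.specialOrthogonalGroup (Fin n) ℝ) {c : ℝ}
    (hc : 0 < c) : elasticEnergy α h (c • R) = dilationEnergy n α h (c ^ n) := by
  have hn_ne : (n : ℝ) ≠ 0 := by positivity
  have rpow_div : (c ^ n) ^ (α / n) = c ^ α := by
    rw [← Real.rpow_natCast, ← Real.rpow_mul hc.le, mul_div_cancel₀ α hn_ne]
  have rpow_one_sub : (c ^ n) ^ (1 - α / n) = c ^ n * c ^ (-α) := by
    rw [Real.rpow_sub (pow_pos hc n), rpow_div, Real.rpow_one, Real.rpow_neg hc.le,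
      div_eq_mul_inv]
  simp only [elasticEnergy, dilationEnergy, det_smul_of_mem_specialOrthogonalGroup hR, rpow_div,
    singVal_smul_of_mem_orthogonalGroup (Matrix.mem_specialOrthogonalGroup_iff.1 hR).1 hc.le,
    rpow_one_sub, Finset.sum_const, Finset.card_univ, Fintype.card_fin, nsmul_eq_mul]
  ring

end Energy

/-! ### Tangent lines -/

section Tangent

theorem tangent_le_of_convexOn {S : Set ℝ} {f : ℝ → ℝ} {f' δ δ₀ : ℝ} (hf : ConvexOn ℝ S f)
    (hδ : δ ∈ S) (hδ₀ : δ₀ ∈ S) (hf' : HasDerivAt f f' δ₀) : f δ₀ + f' * (δ - δ₀) ≤ f δ := by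
  rcases lt_trichotomy δ δ₀ with hlt | rfl | hlt
  · have slope_le := hf.slope_le_of_hasDerivAt hδ hδ₀ hlt hf'
    rw [slope_def_field, div_le_iff₀ (by linarith)] at slope_le
    linarith
  · simp
  · have le_slope := hf.le_slope_of_hasDerivAt hδ₀ hδ hlt hf'
    rw [slope_def_field, le_div_iff₀ (by linarith)] at le_slope
    linarith

theorem tangent_lt_of_strictConvexOn {S : Set ℝ} {f : ℝ → ℝ} {f' δ δ₀ : ℝ}
    (hf : StrictConvexOn ℝ S f) (hδ : δ ∈ S) (hδ₀ : δ₀ ∈ S) (hf' : HasDerivAt f f' δ₀)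
    (hne : δ ≠ δ₀) : f δ₀ + f' * (δ - δ₀) < f δ := by
  rcases hne.lt_or_gt with hlt | hlt
  · have slope_lt := hf.slope_lt_of_hasDerivAt hδ hδ₀ hlt hf'
    rw [slope_def_field, div_lt_iff₀ (by linarith)] at slope_lt
    linarith
  · have lt_slope := hf.lt_slope_of_hasDerivAt hδ₀ hδ hlt hf'
    rw [slope_def_field, lt_div_iff₀ (by linarith)] at lt_slope
    linarith

theorem eventually_eq_affine_of_tangent_eq {S : Set ℝ} {f : ℝ → ℝ} (hf : ConvexOn ℝ S f)
    {f' a b δ₀ : ℝ} (hf' : HasDerivAt f f' δ₀) (ha : a ∈ S) (hb : b ∈ S) (haδ : a < δ₀)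
    (hδb : δ₀ < b) (hfa : f a = f δ₀ + f' * (a - δ₀)) (hfb : f b = f δ₀ + f' * (b - δ₀)) :
    ∃ p q : ℝ, ∀ᶠ δ in 𝓝 δ₀, f δ = p * δ + q := by
  have hab : 0 < b - a := by linarith
  have hS : Icc a b ⊆ S := hf.1.ordConnected.out ha hb
  refine ⟨f', f δ₀ - f' * δ₀, ?_⟩
  filter_upwards [Ioo_mem_nhds haδ hδb] with δ hδ
  have tangent_le := tangent_le_of_convexOn hf (hS ⟨hδ.1.le, hδ.2.le⟩) (hS ⟨haδ.le, hδb.le⟩) hf'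
  have le_secant : f (((b - δ) / (b - a)) • a + ((δ - a) / (b - a)) • b) ≤
      ((b - δ) / (b - a)) • f a + ((δ - a) / (b - a)) • f b :=
    hf.2 ha hb (div_nonneg (sub_nonneg.2 hδ.2.le) hab.le) (div_nonneg (sub_nonneg.2 hδ.1.le) hab.le)
      (by field_simp; ring)
  have combination_eq : ((b - δ) / (b - a)) • a + ((δ - a) / (b - a)) • b = δ := by
    simp only [smul_eq_mul]
    field_simp
    ring
  have secant_eq : ((b - δ) / (b - a)) • f a + ((δ - a) / (b - a)) • f b =
      f' * δ + (f δ₀ - f' * δ₀) := by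
    rw [hfa, hfb]
    simp only [smul_eq_mul]
    field_simp
    ring
  rw [combination_eq, secant_eq] at le_secant
  linarith

variable {s δ δ₀ : ℝ}

theorem rpow_tangent_le (hs : 1 ≤ s) (hδ : 0 ≤ δ) (hδ₀ : 0 ≤ δ₀) :
    δ₀ ^ s + s * δ₀ ^ (s - 1) * (δ - δ₀) ≤ δ ^ s :=
  tangent_le_of_convexOn (convexOn_rpow hs) hδ hδ₀ (Real.hasDerivAt_rpow_const (Or.inr hs))

theorem rpow_tangent_lt (hs : 1 < s) (hδ : 0 ≤ δ) (hδ₀ : 0 ≤ δ₀) (hne : δ ≠ δ₀) :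
    δ₀ ^ s + s * δ₀ ^ (s - 1) * (δ - δ₀) < δ ^ s :=
  tangent_lt_of_strictConvexOn (strictConvexOn_rpow hs) hδ hδ₀
    (Real.hasDerivAt_rpow_const (Or.inr hs.le)) hne

/-- The tangent inequality for `x ↦ x ^ s` passes to its perspective `δ * (δ⁻¹) ^ s`. -/
theorem rpow_one_sub_tangent_le (hs : 1 ≤ s) (hδ : 0 < δ) (hδ₀ : 0 < δ₀) :
    δ₀ ^ (1 - s) + (1 - s) * δ₀ ^ (-s) * (δ - δ₀) ≤ δ ^ (1 - s) := by
  have rpow_one_sub : ∀ x : ℝ, 0 < x → x ^ (1 - s) = x * x⁻¹ ^ s := fun x hx => by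
    rw [Real.rpow_sub hx, Real.rpow_one, Real.inv_rpow hx.le, div_eq_mul_inv]
  calc δ₀ ^ (1 - s) + (1 - s) * δ₀ ^ (-s) * (δ - δ₀)
      = δ * (δ₀⁻¹ ^ s + s * δ₀⁻¹ ^ (s - 1) * (δ⁻¹ - δ₀⁻¹)) := by
        rw [rpow_one_sub δ₀ hδ₀, Real.rpow_neg hδ₀.le, ← Real.inv_rpow hδ₀.le,
          Real.rpow_sub_one (inv_pos.2 hδ₀).ne']
        field_simp
        ring
    _ ≤ δ * δ⁻¹ ^ s := by
        gcongr
        exact rpow_tangent_le hs (inv_pos.2 hδ).le (inv_pos.2 hδ₀).le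
    _ = δ ^ (1 - s) := (rpow_one_sub δ hδ).symm

end Tangent

section DilationTangent

variable {α : ℝ} {h : ℝ → ℝ} {δ δ₀ : ℝ}

/-- The derivative of the energy of dilations. -/
noncomputable def dilationSlope (n : ℕ) (α : ℝ) (h : ℝ → ℝ) (δ : ℝ) : ℝ :=
  n * (α / n * δ ^ (α / n - 1)) + n * ((1 - α / n) * δ ^ (-(α / n))) + deriv h δ

/-- The tangent line at `δ₀` of the energy of dilations. -/
noncomputable def dilationTangent (n : ℕ) (α : ℝ) (h : ℝ → ℝ) (δ₀ δ : ℝ) : ℝ :=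
  dilationEnergy n α h δ₀ + dilationSlope n α h δ₀ * (δ - δ₀)

theorem one_le_div_natCast (hn : n ≠ 0) (hα : (n : ℝ) ≤ α) : 1 ≤ α / n :=
  (one_le_div₀ (by positivity)).2 hα

theorem dilationTangent_le_dilationEnergy (hn : n ≠ 0) (hα : (n : ℝ) ≤ α)
    (h_convex : ConvexOn ℝ (Ioi 0) h) (hδ : 0 < δ) (hδ₀ : 0 < δ₀)
    (h_diff : DifferentiableAt ℝ h δ₀) :
    dilationTangent n α h δ₀ δ ≤ dilationEnergy n α h δ := by
  have hs := one_le_div_natCast hn hα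
  have hn_nonneg : (0 : ℝ) ≤ n := n.cast_nonneg
  have rpow_le := mul_le_mul_of_nonneg_left (rpow_tangent_le hs hδ.le hδ₀.le) hn_nonneg
  have rpow_one_sub_le := mul_le_mul_of_nonneg_left (rpow_one_sub_tangent_le hs hδ hδ₀) hn_nonneg
  have h_le := tangent_le_of_convexOn h_convex hδ hδ₀ h_diff.hasDerivAt
  simp only [dilationTangent, dilationEnergy, dilationSlope]
  linarith

theorem eq_of_dilationEnergy_eq_dilationTangent (hn : n ≠ 0) (hα : (n : ℝ) < α)
    (h_convex : ConvexOn ℝ (Ioi 0) h) (hδ : 0 < δ) (hδ₀ : 0 < δ₀)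
    (h_diff : DifferentiableAt ℝ h δ₀)
    (heq : dilationEnergy n α h δ = dilationTangent n α h δ₀ δ) : δ = δ₀ := by
  have hn_pos : (0 : ℝ) < n := by positivity
  have hs : 1 < α / n := (one_lt_div₀ hn_pos).2 hα
  by_contra hne
  have rpow_lt := mul_lt_mul_of_pos_left (rpow_tangent_lt hs hδ.le hδ₀.le hne) hn_pos
  have rpow_one_sub_le := mul_le_mul_of_nonneg_left (rpow_one_sub_tangent_le hs.le hδ hδ₀) hn_pos.le
  have h_le := tangent_le_of_convexOn h_convex hδ hδ₀ h_diff.hasDerivAt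
  simp only [dilationTangent, dilationEnergy, dilationSlope] at heq
  linarith

theorem apply_eq_tangent_of_dilationEnergy_eq (hn : n ≠ 0) (hα : (n : ℝ) ≤ α)
    (h_convex : ConvexOn ℝ (Ioi 0) h) (hδ : 0 < δ) (hδ₀ : 0 < δ₀)
    (h_diff : DifferentiableAt ℝ h δ₀)
    (heq : dilationEnergy n α h δ = dilationTangent n α h δ₀ δ) :
    h δ = h δ₀ + deriv h δ₀ * (δ - δ₀) := by
  have hs := one_le_div_natCast hn hα
  have hn_nonneg : (0 : ℝ) ≤ n := n.cast_nonneg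
  have rpow_le := mul_le_mul_of_nonneg_left (rpow_tangent_le hs hδ.le hδ₀.le) hn_nonneg
  have rpow_one_sub_le := mul_le_mul_of_nonneg_left (rpow_one_sub_tangent_le hs hδ hδ₀) hn_nonneg
  have h_le := tangent_le_of_convexOn h_convex hδ hδ₀ h_diff.hasDerivAt
  simp only [dilationTangent, dilationEnergy, dilationSlope] at heq
  linarith

theorem dilationTangent_le_isotropicEnergy (hn : n ≠ 0) (hα : (n : ℝ) ≤ α)
    (h_convex : ConvexOn ℝ (Ioi 0) h) (hδ₀ : 0 < δ₀) (h_diff : DifferentiableAt ℝ h δ₀)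
    {A : Matrix (Fin n) (Fin n) ℝ} (hA : 0 < A.det) :
    dilationTangent n α h δ₀ A.det ≤ isotropicEnergy α h A :=
  (dilationTangent_le_dilationEnergy hn hα h_convex hA hδ₀ h_diff).trans
    (dilationEnergy_le_isotropicEnergy hn (n.cast_nonneg.trans hα) hA)

theorem dilationTangent_le_elasticEnergy (hn : n ≠ 0) (hα : (n : ℝ) ≤ α)
    (h_convex : ConvexOn ℝ (Ioi 0) h) (hδ₀ : 0 < δ₀) (h_diff : DifferentiableAt ℝ h δ₀)
    {A : Matrix (Fin n) (Fin n) ℝ} (hA : 0 < A.det) :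
    dilationTangent n α h δ₀ A.det ≤ elasticEnergy α h A :=
  (dilationTangent_le_isotropicEnergy hn hα h_convex hδ₀ h_diff hA).trans
    (isotropicEnergy_le_elasticEnergy hn hα hA)

theorem apply_one_of_symm (h_diff : DifferentiableAt ℝ h 1)
    (h_symm : ∀ δ : ℝ, 0 < δ → h δ = δ * h δ⁻¹) : h 1 = 2 * deriv h 1 := by
  have deriv_inv : HasDerivAt h (deriv h 1) (1 : ℝ)⁻¹ := by
    rw [inv_one]
    exact h_diff.hasDerivAt
  have deriv_symm :=
    (hasDerivAt_id (1 : ℝ)).mul (deriv_inv.comp (1 : ℝ) (hasDerivAt_inv one_ne_zero))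
  have eventually_symm : h =ᶠ[𝓝 1] (id * (h ∘ Inv.inv)) :=
    eventually_of_mem (Ioi_mem_nhds one_pos) h_symm
  have deriv_eq := h_diff.hasDerivAt.unique (deriv_symm.congr_of_eventuallyEq eventually_symm)
  simp only [id_eq, Function.comp_apply, inv_one, one_mul, one_pow, mul_neg, mul_one] at deriv_eq
  linarith

/-- At `δ₀ = 1` both the energy of dilations and its slope vanish. -/
theorem dilationTangent_one_eq_zero (hn : n ≠ 0) (h_diff : DifferentiableAt ℝ h 1)
    (h_symm : ∀ δ : ℝ, 0 < δ → h δ = δ * h δ⁻¹) (h_deriv : deriv h 1 = -(n : ℝ)) (δ : ℝ) :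
    dilationTangent n α h 1 δ = 0 := by
  have hn_ne : (n : ℝ) ≠ 0 := by positivity
  simp only [dilationTangent, dilationEnergy, dilationSlope, apply_one_of_symm h_diff h_symm,
    h_deriv, Real.one_rpow]
  field_simp
  ring

theorem dilationEnergy_nonneg (hn : n ≠ 0) (hα : (n : ℝ) ≤ α) (h_convex : ConvexOn ℝ (Ioi 0) h)
    (h_diff : DifferentiableAt ℝ h 1) (h_symm : ∀ δ : ℝ, 0 < δ → h δ = δ * h δ⁻¹)
    (h_deriv : deriv h 1 = -(n : ℝ)) (hδ : 0 < δ) : 0 ≤ dilationEnergy n α h δ :=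
  (dilationTangent_one_eq_zero hn h_diff h_symm h_deriv δ).symm.trans_le
    (dilationTangent_le_dilationEnergy hn hα h_convex hδ one_pos h_diff)

theorem isotropicEnergy_nonneg (hn : n ≠ 0) (hα : (n : ℝ) ≤ α) (h_convex : ConvexOn ℝ (Ioi 0) h)
    (h_diff : DifferentiableAt ℝ h 1) (h_symm : ∀ δ : ℝ, 0 < δ → h δ = δ * h δ⁻¹)
    (h_deriv : deriv h 1 = -(n : ℝ)) {A : Matrix (Fin n) (Fin n) ℝ} (hA : 0 < A.det) :
    0 ≤ isotropicEnergy α h A :=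
  (dilationEnergy_nonneg hn hα h_convex h_diff h_symm h_deriv hA).trans
    (dilationEnergy_le_isotropicEnergy hn (n.cast_nonneg.trans hα) hA)

theorem elasticEnergy_nonneg (hn : n ≠ 0) (hα : (n : ℝ) ≤ α) (h_convex : ConvexOn ℝ (Ioi 0) h)
    (h_diff : DifferentiableAt ℝ h 1) (h_symm : ∀ δ : ℝ, 0 < δ → h δ = δ * h δ⁻¹)
    (h_deriv : deriv h 1 = -(n : ℝ)) {A : Matrix (Fin n) (Fin n) ℝ} (hA : 0 < A.det) :
    0 ≤ elasticEnergy α h A :=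
  (isotropicEnergy_nonneg hn hα h_convex h_diff h_symm h_deriv hA).trans
    (isotropicEnergy_le_elasticEnergy hn hα hA)

end DilationTangent

/-! ### Rigidity of local similarities -/

section LocalSimilarity

variable {E : Type*} [NormedAddCommGroup E] [InnerProductSpace ℝ E]

theorem inner_eq_inner_of_norm_sub_eq {F : Type*} [NormedAddCommGroup F] [InnerProductSpace ℝ F]
    {a b : E} {a' b' : F} (ha : ‖a'‖ = ‖a‖) (hb : ‖b'‖ = ‖b‖) (hab : ‖a' - b'‖ = ‖a - b‖) :
    inner ℝ a' b' = inner ℝ a b := by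
  rw [real_inner_eq_norm_mul_self_add_norm_mul_self_sub_norm_sub_mul_self_div_two,
    real_inner_eq_norm_mul_self_add_norm_mul_self_sub_norm_sub_mul_self_div_two, ha, hb, hab]

theorem exists_eqOn_affine_of_locally_affine {Ω : Set E} (hΩ : IsOpen Ω) (hΩc : IsConnected Ω)
    {y : E → E} {P : (E →L[ℝ] E) → Prop}
    (hy : ∀ z ∈ Ω, ∃ L : E →L[ℝ] E, P L ∧ ∀ᶠ x in 𝓝 z, y x = y z + L (x - z)) :
    ∃ (a : E) (L : E →L[ℝ] E), P L ∧ EqOn y (fun x => a + L x) Ω := by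
  have hderiv : ∀ z ∈ Ω, ∃ L : E →L[ℝ] E, P L ∧ ∀ᶠ x in 𝓝 z, HasFDerivAt y L x := fun z hz => by
    obtain ⟨L, hL, hLy⟩ := hy z hz
    refine ⟨L, hL, hLy.eventually_nhds.mono fun x hx => HasFDerivAt.congr_of_eventuallyEq ?_ hx⟩
    exact (L.hasFDerivAt.comp x ((hasFDerivAt_id x).sub_const z)).const_add (y z)
  have hdiff : DifferentiableOn ℝ y Ω := fun z hz =>
    (hderiv z hz).choose_spec.2.self_of_nhds.differentiableAt.differentiableWithinAt
  have hconst : ∀ z ∈ Ω, HasFDerivAt (fderiv ℝ y) (0 : E →L[ℝ] E →L[ℝ] E) z := fun z hz => by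
    obtain ⟨L, -, hLy⟩ := hderiv z hz
    exact (hasFDerivAt_const L z).congr_of_eventuallyEq (hLy.mono fun x hx => hx.fderiv)
  obtain ⟨z₀, hz₀⟩ := hΩc.nonempty
  obtain ⟨L, hL, hLy⟩ := hderiv z₀ hz₀
  have hfderiv : ∀ z ∈ Ω, fderiv ℝ y z = L := fun z hz => by
    rw [← hLy.self_of_nhds.fderiv]
    exact hΩ.is_const_of_fderiv_eq_zero hΩc.isPreconnected
      (fun x hx => (hconst x hx).differentiableAt.differentiableWithinAt)
      (fun x hx => (hconst x hx).fderiv) hz hz₀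
  obtain ⟨a, ha⟩ := hΩ.exists_eq_add_of_fderiv_eq hΩc.isPreconnected hdiff
    L.differentiable.differentiableOn fun z hz => by rw [L.fderiv, hfderiv z hz]
  exact ⟨a, L, hL, fun x hx => (ha hx).trans (add_comm _ _)⟩

variable [FiniteDimensional ℝ E]

theorem exists_linearIsometryEquiv_eqOn_ball {f : E → E} {ρ : ℝ} (hρ : 0 < ρ)
    (hf₀ : ∀ x ∈ Metric.ball (0 : E) ρ, ‖f x‖ = ‖x‖)
    (hf : ∀ x ∈ Metric.ball (0 : E) ρ, ∀ z ∈ Metric.ball (0 : E) ρ, ‖f x - f z‖ = ‖x - z‖) :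
    ∃ L : E ≃ₗᵢ[ℝ] E, EqOn f L (Metric.ball 0 ρ) := by
  have hinner : ∀ x ∈ Metric.ball (0 : E) ρ, ∀ z ∈ Metric.ball (0 : E) ρ,
      inner ℝ (f x) (f z) = inner ℝ x z := fun x hx z hz =>
    inner_eq_inner_of_norm_sub_eq (hf₀ x hx) (hf₀ z hz) (hf x hx z hz)
  obtain ⟨t, ht, htρ⟩ := exists_between hρ
  let b := stdOrthonormalBasis ℝ E
  have hmem : ∀ i, t • b i ∈ Metric.ball (0 : E) ρ := fun i => by
    rwa [mem_ball_zero_iff, norm_smul, Real.norm_of_nonneg ht.le, b.norm_eq_one, mul_one]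
  have hon : Orthonormal ℝ fun i => t⁻¹ • f (t • b i) := by
    rw [orthonormal_iff_ite]
    intro i j
    rw [real_inner_smul_left, real_inner_smul_right, hinner _ (hmem i) _ (hmem j),
      real_inner_smul_left, real_inner_smul_right, inv_mul_cancel_left₀ ht.ne',
      inv_mul_cancel_left₀ ht.ne', orthonormal_iff_ite.1 b.orthonormal]
  let b' := OrthonormalBasis.mk hon
    (hon.linearIndependent.span_eq_top_of_card_eq_finrank' (Fintype.card_fin _)).ge
  refine ⟨b.repr.trans b'.repr.symm, fun x hx => ?_⟩
  rw [LinearIsometryEquiv.trans_apply, LinearIsometryEquiv.eq_symm_apply]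
  ext i
  rw [b'.repr_apply_apply, b.repr_apply_apply, OrthonormalBasis.coe_mk, real_inner_smul_left,
    hinner _ (hmem i) _ hx, real_inner_smul_left, inv_mul_cancel_left₀ ht.ne']

theorem exists_eventuallyEq_affine_of_norm_sub_eq {y : E → E} {c ρ : ℝ} (hc : 0 < c) (hρ : 0 < ρ)
    {z : E} (hy : ∀ x₁ ∈ Metric.ball z ρ, ∀ x₂ ∈ Metric.ball z ρ,
      ‖y x₁ - y x₂‖ = c * ‖x₁ - x₂‖) :
    ∃ L : E →L[ℝ] E, (∀ v, ‖L v‖ = c * ‖v‖) ∧ ∀ᶠ x in 𝓝 z, y x = y z + L (x - z) := by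
  let f : E → E := fun x => c⁻¹ • (y (z + x) - y z)
  have hmem : ∀ x ∈ Metric.ball (0 : E) ρ, z + x ∈ Metric.ball z ρ := fun x hx => by
    simpa using hx
  have hf : ∀ x ∈ Metric.ball (0 : E) ρ, ∀ x' ∈ Metric.ball (0 : E) ρ,
      ‖f x - f x'‖ = ‖x - x'‖ := fun x hx x' hx' => by
    rw [← smul_sub, sub_sub_sub_cancel_right, norm_smul, hy _ (hmem x hx) _ (hmem x' hx'),
      norm_inv, Real.norm_of_nonneg hc.le, add_sub_add_left_eq_sub, inv_mul_cancel_left₀ hc.ne']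
  obtain ⟨L, hL⟩ := exists_linearIsometryEquiv_eqOn_ball hρ (f := f)
    (fun x hx => by simpa [f] using hf x hx 0 (Metric.mem_ball_self hρ)) hf
  refine ⟨c • (L.toContinuousLinearEquiv : E →L[ℝ] E), fun v => ?_, ?_⟩
  · rw [smul_apply, norm_smul, Real.norm_of_nonneg hc.le]
    exact congrArg (c * ·) (L.norm_map v)
  · filter_upwards [Metric.ball_mem_nhds z hρ] with x hx
    have hfx : f (x - z) = L (x - z) := hL (by rwa [mem_ball_zero_iff, ← mem_ball_iff_norm])
    have hyx : c • f (x - z) = y x - y z := by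
      simp only [f, add_sub_cancel, smul_inv_smul₀ hc.ne']
    rw [smul_apply, ContinuousLinearEquiv.coe_coe, L.coe_toContinuousLinearEquiv, ← hfx, hyx,
      add_sub_cancel]

theorem exists_eqOn_affine_of_locally_norm_sub_eq {Ω : Set E} (hΩ : IsOpen Ω)
    (hΩc : IsConnected Ω) {y : E → E} {c : ℝ} (hc : 0 < c)
    (hy : ∀ z ∈ Ω, ∃ ρ > 0, ∀ x₁ ∈ Metric.ball z ρ, ∀ x₂ ∈ Metric.ball z ρ,
      ‖y x₁ - y x₂‖ = c * ‖x₁ - x₂‖) :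
    ∃ (a : E) (L : E →L[ℝ] E), (∀ v, ‖L v‖ = c * ‖v‖) ∧ EqOn y (fun x => a + L x) Ω :=
  exists_eqOn_affine_of_locally_affine hΩ hΩc fun z hz =>
    let ⟨_, hρ, h⟩ := hy z hz
    exists_eventuallyEq_affine_of_norm_sub_eq hc hρ h

end LocalSimilarity

section BallImages

theorem mul_norm_sub_le_of_image_closedBall_eq {E : Type*} [NormedAddCommGroup E]
    [NormedSpace ℝ E] {Ω : Set E} {y : E → E} (hy : InjOn y Ω) {c : ℝ} (hc : 0 < c)
    (hball : ∀ x r, 0 < r → Metric.closedBall x r ⊆ Ω →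
      y '' Metric.closedBall x r = Metric.closedBall (y x) (c * r)) {x₁ x₂ : E}
    (h₁ : Metric.closedBall x₁ (‖x₁ - x₂‖ / 2) ⊆ Ω)
    (h₂ : Metric.closedBall x₂ (‖x₁ - x₂‖ / 2) ⊆ Ω) : c * ‖x₁ - x₂‖ ≤ ‖y x₁ - y x₂‖ := by
  by_contra! hlt
  obtain ⟨s, hs, hsx⟩ : ∃ s, ‖y x₁ - y x₂‖ / (2 * c) < s ∧ s < ‖x₁ - x₂‖ / 2 :=
    exists_between (by rw [div_lt_div_iff₀ (by positivity) two_pos]; linarith)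
  have hs₀ : 0 < s := lt_of_le_of_lt (by positivity) hs
  have hys : dist (y x₁) (y x₂) / 2 ≤ c * s := by
    rw [div_lt_iff₀ (by positivity)] at hs
    rw [dist_eq_norm]
    linarith
  have hs₁ := (Metric.closedBall_subset_closedBall hsx.le).trans h₁
  have hs₂ := (Metric.closedBall_subset_closedBall hsx.le).trans h₂
  -- The images of the two disjoint balls of radius `s` both contain the midpoint.
  obtain ⟨a, ha, hya⟩ : midpoint ℝ (y x₁) (y x₂) ∈ y '' Metric.closedBall x₁ s := by
    rw [hball x₁ s hs₀ hs₁, Metric.mem_closedBall, dist_midpoint_left,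
      Real.norm_of_nonneg two_pos.le]
    linarith
  obtain ⟨b, hb, hyb⟩ : midpoint ℝ (y x₁) (y x₂) ∈ y '' Metric.closedBall x₂ s := by
    rw [hball x₂ s hs₀ hs₂, Metric.mem_closedBall, dist_midpoint_right,
      Real.norm_of_nonneg two_pos.le]
    linarith
  obtain rfl : a = b := hy (hs₁ ha) (hs₂ hb) (hya.trans hyb.symm)
  rw [Metric.mem_closedBall'] at ha
  rw [Metric.mem_closedBall] at hb
  linarith [dist_triangle x₁ a x₂, dist_eq_norm x₁ x₂]

theorem image_closedBall_eq_of_volume_eq {y : 𝔼 → 𝔼} {c : ℝ} (hc : 0 < c) {x : 𝔼} {r : ℝ}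
    (hr : 0 < r) (hy : ContinuousOn y (Metric.closedBall x r))
    (hlip : ∀ z ∈ Metric.closedBall x r, ‖y z - y x‖ ≤ c * ‖z - x‖)
    (hvol : volume (y '' Metric.closedBall x r) =
      ENNReal.ofReal (c ^ n) * volume (Metric.closedBall x r)) :
    y '' Metric.closedBall x r = Metric.closedBall (y x) (c * r) := by
  have hsub : y '' Metric.closedBall x r ⊆ Metric.closedBall (y x) (c * r) := by
    rintro _ ⟨z, hz, rfl⟩
    have hzr := mem_closedBall_iff_norm.1 hz
    exact mem_closedBall_iff_norm.2 ((hlip z hz).trans (by gcongr))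
  have hcomp : IsCompact (y '' Metric.closedBall x r) :=
    (isCompact_closedBall x r).image_of_continuousOn hy
  have hvol' : volume (Metric.closedBall (y x) (c * r)) = volume (y '' Metric.closedBall x r) := by
    rw [hvol, Measure.addHaar_closedBall' _ _ (mul_pos hc hr).le,
      Measure.addHaar_closedBall' _ _ hr.le, finrank_euclideanSpace_fin, ← mul_assoc,
      ← ENNReal.ofReal_mul (pow_pos hc n).le, mul_pow]
  have hnull : volume (Metric.ball (y x) (c * r) \ y '' Metric.closedBall x r) = 0 := by
    refine measure_mono_null (sdiff_subset_sdiff_left Metric.ball_subset_closedBall) ?_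
    rw [measure_sdiff hsub hcomp.measurableSet.nullMeasurableSet hcomp.measure_lt_top.ne, hvol',
      tsub_self]
  refine hsub.antisymm ?_
  rw [← closure_ball (y x) (mul_pos hc hr).ne']
  exact closure_minimal (sdiff_eq_empty.1
    ((Metric.isOpen_ball.sdiff hcomp.isClosed).eq_empty_of_measure_zero hnull)) hcomp.isClosed

theorem norm_mollify_le {F : Type*} [NormedAddCommGroup F] [NormedSpace ℝ F] {u : 𝔼 → F} {c : ℝ}
    (hu : ∀ᵐ t, ‖u t‖ ≤ c) (k : ℕ) (x : 𝔼) : ‖mollify k u x‖ ≤ c := by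
  have hbound : ∀ᵐ t, ‖mollifier n k (x - t) • u t‖ ≤ mollifier n k (x - t) * c := by
    filter_upwards [hu] with t ht
    rw [norm_smul, Real.norm_of_nonneg ((shrinkingBump n k).nonneg_normed _)]
    exact mul_le_mul_of_nonneg_left ht ((shrinkingBump n k).nonneg_normed _)
  rw [mollify_apply]
  refine (norm_integral_le_of_norm_le
    (((shrinkingBump n k).integrable_normed.comp_sub_left x).mul_const c) hbound).trans_eq ?_
  rw [integral_mul_const, integral_sub_left_eq_self (mollifier n k) volume x,
    (shrinkingBump n k).integral_normed, one_mul]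

theorem ae_norm_operatorField_le {Ω : Set 𝔼} (hΩ : MeasurableSet Ω)
    {G : 𝔼 → Matrix (Fin n) (Fin n) ℝ} {c : ℝ} (hc : 0 ≤ c)
    (hG : ∀ᵐ x ∂volume.restrict Ω, ∀ v, ‖Matrix.toEuclideanLin (G x) v‖ ≤ c * ‖v‖) :
    ∀ᵐ x, ‖operatorField Ω G x‖ ≤ c := by
  filter_upwards [(ae_restrict_iff' hΩ).1 hG] with x hx
  by_cases hxΩ : x ∈ Ω
  · rw [operatorField, indicator_of_mem hxΩ]
    exact ContinuousLinearMap.opNorm_le_bound _ hc (hx hxΩ)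
  · rwa [operatorField, indicator_of_notMem hxΩ, norm_zero]

theorem IsWeakGradient.norm_sub_le {Ω : Set 𝔼} (hΩ : IsOpen Ω) {y : 𝔼 → 𝔼}
    {G : 𝔼 → Matrix (Fin n) (Fin n) ℝ} (hG : IsWeakGradient Ω y G) (hyc : ContinuousOn y Ω)
    (hy : LocallyIntegrable (Ω.indicator y)) (hGi : LocallyIntegrable (operatorField Ω G))
    {c : ℝ} (hc : 0 ≤ c)
    (hGc : ∀ᵐ x ∂volume.restrict Ω, ∀ v, ‖Matrix.toEuclideanLin (G x) v‖ ≤ c * ‖v‖)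
    {z : 𝔼} {r : ℝ} (hz : Metric.closedBall z r ⊆ Ω) {x₁ x₂ : 𝔼}
    (hx₁ : x₁ ∈ Metric.closedBall z r) (hx₂ : x₂ ∈ Metric.closedBall z r) :
    ‖y x₁ - y x₂‖ ≤ c * ‖x₁ - x₂‖ := by
  have hC := isCompact_closedBall z r
  have hlim := tendstoUniformlyOn_mollify hΩ hyc hC hz
  refine le_of_tendsto ((hlim.tendsto_at hx₁).sub (hlim.tendsto_at hx₂)).norm ?_
  filter_upwards [eventually_forall_closedBall_subset hΩ hC hz] with k hk
  refine (convex_closedBall z r).norm_image_sub_le_of_norm_fderiv_le (𝕜 := ℝ)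
    (fun x _ => ((contDiff_mollify hy k).differentiable one_ne_zero).differentiableAt)
    (fun x hx => ?_) hx₂ hx₁
  rw [IsWeakGradient.fderiv_mollify hΩ.measurableSet hG hy hGi (hk x hx)]
  exact norm_mollify_le (ae_norm_operatorField_le hΩ.measurableSet hc hGc) k x

end BallImages

/-! ### Affine maps -/

section SmoothMaps

theorem integral_mul_fderiv_eq_neg_of_hasCompactSupport {E : Type*} [NormedAddCommGroup E]
    [NormedSpace ℝ E] [FiniteDimensional ℝ E] [MeasurableSpace E] [BorelSpace E] {μ : Measure E}
    [μ.IsAddHaarMeasure] {f φ : E → ℝ} (hf : ContDiff ℝ 1 f) (hφ : ContDiff ℝ 1 φ)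
    (hφc : HasCompactSupport φ) (v : E) :
    ∫ x, f x * fderiv ℝ φ x v ∂μ = -∫ x, fderiv ℝ f x v * φ x ∂μ := by
  have continuous_fderiv_apply : ∀ {g : E → ℝ}, ContDiff ℝ 1 g →
      Continuous fun x => fderiv ℝ g x v :=
    fun hg => (hg.continuous_fderiv one_ne_zero).clm_apply continuous_const
  refine integral_mul_fderiv_eq_neg_fderiv_mul_of_integrable ?_ ?_ ?_
    (fun x _ => (hf.differentiable one_ne_zero).differentiableAt)
    (fun x _ => (hφ.differentiable one_ne_zero).differentiableAt)
  · exact ((continuous_fderiv_apply hf).mul hφ.continuous).integrable_of_hasCompactSupport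
      hφc.mul_left
  · exact (hf.continuous.mul (continuous_fderiv_apply hφ)).integrable_of_hasCompactSupport
      (hφc.fderiv_apply ℝ v).mul_left
  · exact (hf.continuous.mul hφ.continuous).integrable_of_hasCompactSupport hφc.mul_left

theorem isWeakGradient_of_eqOn_contDiff {Ω : Set 𝔼} (hΩ : MeasurableSet Ω) {y u : 𝔼 → 𝔼}
    (hu : ContDiff ℝ 1 u) (hy : EqOn y u Ω) :
    IsWeakGradient Ω y fun x => .of fun i j => fderiv ℝ u x (EuclideanSpace.single j 1) i := by
  have hui : ∀ i, ContDiff ℝ 1 fun x => u x i := fun i =>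
    (EuclideanSpace.proj (𝕜 := ℝ) i).contDiff.comp hu
  have hfderiv : ∀ i x v, fderiv ℝ (fun x => u x i) x v = fderiv ℝ u x v i := fun i x v => by
    have hd := (EuclideanSpace.proj (𝕜 := ℝ) i).hasFDerivAt.comp x
      (hu.differentiable one_ne_zero x).hasFDerivAt
    exact congrArg (fun L : 𝔼 →L[ℝ] ℝ => L v) hd.fderiv
  refine ⟨fun i => ?_, fun i j => ?_, fun φ hφ hφc hφs i j => ?_⟩
  · exact ((hui i).continuous.continuousOn.congr fun x hx => by
      simp only [hy hx]).locallyIntegrableOn hΩ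
  · simp only [Matrix.of_apply, ← hfderiv]
    exact (((hui i).continuous_fderiv one_ne_zero).clm_apply
      continuous_const).continuousOn.locallyIntegrableOn hΩ
  · have hφ₁ : ContDiff ℝ 1 φ := hφ.of_le (by exact_mod_cast le_top)
    have hφ₀ : ∀ x, x ∉ Ω → φ x = 0 := fun x hx =>
      image_eq_zero_of_notMem_tsupport fun h => hx (hφs h)
    have hφ'₀ : ∀ x, x ∉ Ω → fderiv ℝ φ x = 0 := fun x hx =>
      image_eq_zero_of_notMem_tsupport fun h => hx (hφs (tsupport_fderiv_subset ℝ h))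
    simp only [Matrix.of_apply]
    rw [setIntegral_congr_fun hΩ
      (g := fun x => u x i * fderiv ℝ φ x (EuclideanSpace.single j 1))
      fun x hx => by simp only [hy hx],
      setIntegral_eq_integral_of_forall_compl_eq_zero fun x hx => by simp [hφ'₀ x hx],
      setIntegral_eq_integral_of_forall_compl_eq_zero fun x hx => by rw [hφ₀ x hx, mul_zero],
      integral_mul_fderiv_eq_neg_of_hasCompactSupport (hui i) hφ₁ hφc]
    simp only [hfderiv]

theorem memLp_of_eqOn_continuous {X F : Type*} [PseudoMetricSpace X] [ProperSpace X]
    [MeasurableSpace X] [OpensMeasurableSpace X] {μ : Measure X} [IsFiniteMeasureOnCompacts μ]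
    [NormedAddCommGroup F] [SecondCountableTopologyEither X F] {p : ℝ≥0∞} {Ω : Set X}
    (hΩ : MeasurableSet Ω) (hΩb : Bornology.IsBounded Ω) {y u : X → F} (hu : Continuous u)
    (hy : EqOn y u Ω) : MemLp y p (μ.restrict Ω) := by
  have : IsFiniteMeasure (μ.restrict Ω) := ⟨by simpa using hΩb.measure_lt_top⟩
  obtain ⟨C, hC⟩ := hΩb.isCompact_closure.exists_bound_of_continuousOn hu.continuousOn
  refine MemLp.of_bound ((hu.continuousOn.congr hy).aestronglyMeasurable hΩ) C ?_
  filter_upwards [ae_restrict_mem hΩ] with x hx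
  rw [hy hx]
  exact hC x (subset_closure hx)

theorem memSobolev_of_eqOn_contDiff {p : ℝ≥0∞} {Ω : Set 𝔼} (hΩ : MeasurableSet Ω)
    (hΩb : Bornology.IsBounded Ω) {y u : 𝔼 → 𝔼} (hu : ContDiff ℝ 1 u) (hy : EqOn y u Ω) :
    MemSobolev p Ω y :=
  ⟨memLp_of_eqOn_continuous hΩ hΩb hu.continuous hy, _,
    isWeakGradient_of_eqOn_contDiff hΩ hu hy, fun i _ => memLp_of_eqOn_continuous hΩ hΩb
      ((EuclideanSpace.proj (𝕜 := ℝ) i).continuous.comp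
        ((hu.continuous_fderiv one_ne_zero).clm_apply continuous_const)) fun _ _ => rfl⟩

end SmoothMaps

section AffineMaps

theorem continuous_toEuclideanLin (A : Matrix (Fin n) (Fin n) ℝ) :
    Continuous (Matrix.toEuclideanLin A) :=
  LinearMap.continuous_of_finiteDimensional _

theorem contDiff_add_toEuclideanLin (a : 𝔼) (A : Matrix (Fin n) (Fin n) ℝ) :
    ContDiff ℝ 1 fun x => a + Matrix.toEuclideanLin A x :=
  contDiff_const.add (LinearMap.toContinuousLinearMap (Matrix.toEuclideanLin A)).contDiff

theorem weakGradient_ae_eq_of_eqOn_affine {Ω : Set 𝔼} (hΩ : IsOpen Ω)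
    (hΩb : Bornology.IsBounded Ω) {y : 𝔼 → 𝔼} {a : 𝔼} {A : Matrix (Fin n) (Fin n) ℝ}
    (hy : EqOn y (fun x => a + Matrix.toEuclideanLin A x) Ω) :
    ∀ᵐ x ∂volume.restrict Ω, weakGradient Ω y x = A := by
  have hu := contDiff_add_toEuclideanLin a A
  have hyS : MemSobolev 1 Ω y := memSobolev_of_eqOn_contDiff hΩ.measurableSet hΩb hu hy
  have hfderiv : ∀ x, fderiv ℝ (fun x => a + Matrix.toEuclideanLin A x) x =
      LinearMap.toContinuousLinearMap (Matrix.toEuclideanLin A) := fun x =>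
    ((LinearMap.toContinuousLinearMap (Matrix.toEuclideanLin A)).hasFDerivAt.const_add a).fderiv
  filter_upwards [hyS.isWeakGradient_weakGradient.ae_eq hΩ
    (isWeakGradient_of_eqOn_contDiff hΩ.measurableSet hu hy)] with x hx
  ext i j
  rw [hx, Matrix.of_apply, hfderiv]
  simp [Matrix.toLpLin_apply]

variable {R : Matrix (Fin n) (Fin n) ℝ} {c : ℝ}

theorem leftInverse_toEuclideanLin_smul (hR : R ∈ Matrix.orthogonalGroup (Fin n) ℝ) (hc : c ≠ 0) :
    Function.LeftInverse (Matrix.toEuclideanLin (c⁻¹ • R.transpose))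
      (Matrix.toEuclideanLin (c • R)) := fun x => by
  simp [Matrix.toLpLin_apply, Matrix.mulVec_mulVec, (Matrix.mem_orthogonalGroup_iff' (A := R)).1 hR,
    smul_smul, hc]

theorem rightInverse_toEuclideanLin_smul (hR : R ∈ Matrix.orthogonalGroup (Fin n) ℝ)
    (hc : c ≠ 0) :
    Function.RightInverse (Matrix.toEuclideanLin (c⁻¹ • R.transpose))
      (Matrix.toEuclideanLin (c • R)) := fun x => by
  simp [Matrix.toLpLin_apply, Matrix.mulVec_mulVec, (Matrix.mem_orthogonalGroup_iff (A := R)).1 hR,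
    smul_smul, hc]

theorem volume_image_toEuclideanLin_smul (hR : R ∈ Matrix.specialOrthogonalGroup (Fin n) ℝ)
    (hc : 0 < c) (Ω : Set 𝔼) :
    volume (Matrix.toEuclideanLin (c • R) '' Ω) = ENNReal.ofReal (c ^ n) * volume Ω := by
  rw [Measure.addHaar_image_linearMap, Matrix.toEuclideanLin_eq_toLin_orthonormal,
    LinearMap.det_toLin, det_smul_of_mem_specialOrthogonalGroup hR, abs_of_pos (pow_pos hc n)]

theorem image_toEuclideanLin_smul_eq_preimage (hR : R ∈ Matrix.orthogonalGroup (Fin n) ℝ)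
    (hc : c ≠ 0) (Ω : Set 𝔼) :
    Matrix.toEuclideanLin (c • R) '' Ω = Matrix.toEuclideanLin (c⁻¹ • R.transpose) ⁻¹' Ω :=
  congrFun (image_eq_preimage_of_inverse (leftInverse_toEuclideanLin_smul hR hc)
    (rightInverse_toEuclideanLin_smul hR hc)) Ω

theorem isOpen_image_toEuclideanLin_smul (hR : R ∈ Matrix.orthogonalGroup (Fin n) ℝ)
    (hc : c ≠ 0) {Ω : Set 𝔼} (hΩ : IsOpen Ω) : IsOpen (Matrix.toEuclideanLin (c • R) '' Ω) := by
  rw [image_toEuclideanLin_smul_eq_preimage hR hc]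
  exact hΩ.preimage (continuous_toEuclideanLin _)

theorem toEuclideanLin_smul_mem_admissible {p : ℝ≥0∞}
    (hR : R ∈ Matrix.specialOrthogonalGroup (Fin n) ℝ) (hc : 0 < c) {Ω : Set 𝔼} (hΩ : IsOpen Ω)
    (hΩb : Bornology.IsBounded Ω) :
    (fun x => Matrix.toEuclideanLin (c • R) x) ∈
      admissible p Ω (Matrix.toEuclideanLin (c • R) '' Ω) := by
  have hRo := (Matrix.mem_specialOrthogonalGroup_iff.1 hR).1
  have memSobolev : ∀ {U : Set 𝔼}, IsOpen U → Bornology.IsBounded U →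
      ∀ A, MemSobolev p U fun x => Matrix.toEuclideanLin A x := fun hU hUb A =>
    memSobolev_of_eqOn_contDiff hU.measurableSet hUb (contDiff_add_toEuclideanLin 0 A)
      fun x _ => (zero_add _).symm
  have himage_bounded : Bornology.IsBounded (Matrix.toEuclideanLin (c • R) '' Ω) :=
    (LinearMap.toContinuousLinearMap (Matrix.toEuclideanLin (c • R))).lipschitz.isBounded_image hΩb
  refine ⟨memSobolev hΩ hΩb _, (continuous_toEuclideanLin _).continuousOn, ?_,
    fun x => Matrix.toEuclideanLin (c⁻¹ • R.transpose) x, mapsTo_image _ _, ?_,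
    ⟨fun x _ => leftInverse_toEuclideanLin_smul hRo hc.ne' x,
      fun x _ => rightInverse_toEuclideanLin_smul hRo hc.ne' x⟩,
    (continuous_toEuclideanLin _).continuousOn,
    memSobolev (isOpen_image_toEuclideanLin_smul hRo hc.ne' hΩ) himage_bounded _⟩
  · filter_upwards [weakGradient_ae_eq_of_eqOn_affine (a := 0) (A := c • R) hΩ hΩb
      fun x _ => (zero_add _).symm] with x hx
    rw [hx, det_smul_of_mem_specialOrthogonalGroup hR]
    exact pow_pos hc n
  · rw [image_toEuclideanLin_smul_eq_preimage hRo hc.ne']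
    exact mapsTo_preimage _ _

end AffineMaps

/-! ### Admissible maps -/

section Admissible

theorem aestronglyMeasurable_det {ι X : Type*} [Fintype ι] [DecidableEq ι] [MeasurableSpace X]
    {μ : Measure X} {G : X → Matrix ι ι ℝ} (hG : ∀ i j, AEStronglyMeasurable (fun x => G x i j) μ) :
    AEStronglyMeasurable (fun x => (G x).det) μ := by
  simp only [Matrix.det_apply]
  exact Finset.aestronglyMeasurable_fun_sum _ fun σ _ =>
    (Finset.aestronglyMeasurable_fun_prod _ fun i _ => hG (σ i) i).const_smul _

theorem MemSobolev.aestronglyMeasurable_det_weakGradient {p : ℝ≥0∞} {Ω : Set 𝔼} (hΩ : IsOpen Ω)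
    {y : 𝔼 → 𝔼} (h : MemSobolev p Ω y) :
    AEStronglyMeasurable (fun x => (weakGradient Ω y x).det) (volume.restrict Ω) :=
  aestronglyMeasurable_det fun i j => (h.memLp_weakGradient hΩ i j).aestronglyMeasurable

theorem MemSobolev.norm_sub_le {p : ℝ≥0∞} (hp : 1 ≤ p) {Ω : Set 𝔼} (hΩ : IsOpen Ω) {y : 𝔼 → 𝔼}
    (h : MemSobolev p Ω y) (hyc : ContinuousOn y Ω) {c : ℝ} (hc : 0 ≤ c)
    (hconf : ∀ᵐ x ∂volume.restrict Ω, ∀ v,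
      ‖Matrix.toEuclideanLin (weakGradient Ω y x) v‖ ≤ c * ‖v‖)
    {z : 𝔼} {r : ℝ} (hz : Metric.closedBall z r ⊆ Ω) {x₁ x₂ : 𝔼}
    (hx₁ : x₁ ∈ Metric.closedBall z r) (hx₂ : x₂ ∈ Metric.closedBall z r) :
    ‖y x₁ - y x₂‖ ≤ c * ‖x₁ - x₂‖ :=
  h.isWeakGradient_weakGradient.norm_sub_le hΩ hyc
    (((memLp_indicator_iff_restrict hΩ.measurableSet).2 h.1).locallyIntegrable hp)
    ((memLp_operatorField hΩ.measurableSet (h.memLp_weakGradient hΩ)).locallyIntegrable hp)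
    hc hconf hz hx₁ hx₂

variable {Ω₁ Ω₂ : Set (EuclideanSpace ℝ (Fin n))}
  {y : EuclideanSpace ℝ (Fin n) → EuclideanSpace ℝ (Fin n)}

theorem exists_isHomeoPair_of_mem_admissible {p : ℝ≥0∞} (hΩ₁ : IsOpen Ω₁) (hΩ₂ : IsOpen Ω₂)
    (hy : y ∈ admissible p Ω₁ Ω₂) : ∃ ξ, IsHomeoPair Ω₁ Ω₂ y ξ ∧ MemSobolev p Ω₂ ξ := by
  obtain ⟨-, hyc, -, ξ, hmaps, hmaps_inv, hinv, hξc, hξ⟩ := hy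
  exact ⟨ξ, ⟨hΩ₁, hΩ₂, hmaps, hmaps_inv, hinv, hyc, hξc⟩, hξ⟩

theorem image_eq_of_mem_admissible {p : ℝ≥0∞} (hy : y ∈ admissible p Ω₁ Ω₂) : y '' Ω₁ = Ω₂ := by
  obtain ⟨-, -, -, ξ, hmaps, hmaps_inv, hinv, -⟩ := hy
  exact (hinv.bijOn hmaps hmaps_inv).image_eq

theorem setLIntegral_det_of_mem_admissible (hn : n ≠ 0) (hΩ₁ : IsOpen Ω₁) (hΩ₂ : IsOpen Ω₂)
    (hΩ₁f : volume Ω₁ ≠ ⊤) (hΩ₂f : volume Ω₂ ≠ ⊤) (hy : y ∈ admissible (n : ℝ≥0∞) Ω₁ Ω₂)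
    {S : Set 𝔼} (hS : MeasurableSet S) (hSΩ : S ⊆ Ω₂) :
    ∫⁻ x in Ω₁ ∩ y ⁻¹' S, ENNReal.ofReal (weakGradient Ω₁ y x).det = volume S := by
  obtain ⟨ξ, hp, hξ⟩ := exists_isHomeoPair_of_mem_admissible hΩ₁ hΩ₂ hy
  exact setLIntegral_det_weakGradient_eq_volume hn hp hΩ₁f hΩ₂f hy.1 hξ hy.2.2.1 hS hSΩ

theorem integrableOn_det_of_mem_admissible (hn : n ≠ 0) (hΩ₁ : IsOpen Ω₁) (hΩ₂ : IsOpen Ω₂)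
    (hΩ₁f : volume Ω₁ ≠ ⊤) (hΩ₂f : volume Ω₂ ≠ ⊤) (hy : y ∈ admissible (n : ℝ≥0∞) Ω₁ Ω₂) :
    IntegrableOn (fun x => (weakGradient Ω₁ y x).det) Ω₁ ∧
      ∫ x in Ω₁, (weakGradient Ω₁ y x).det = volume.real Ω₂ := by
  have lintegral_det := setLIntegral_det_of_mem_admissible hn hΩ₁ hΩ₂ hΩ₁f hΩ₂f hy
    hΩ₂.measurableSet subset_rfl
  rw [inter_eq_left.2 (image_subset_iff.1 (image_eq_of_mem_admissible hy).subset)]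
    at lintegral_det
  have hdet := hy.1.aestronglyMeasurable_det_weakGradient hΩ₁
  have det_nonneg : 0 ≤ᵐ[volume.restrict Ω₁] fun x => (weakGradient Ω₁ y x).det :=
    hy.2.2.1.mono fun x hx => hx.le
  refine ⟨⟨hdet, ?_⟩, ?_⟩
  · rw [hasFiniteIntegral_iff_ofReal det_nonneg, lintegral_det]
    exact hΩ₂f.lt_top
  · rw [integral_eq_lintegral_of_nonneg_ae det_nonneg hdet, lintegral_det, measureReal_def]

theorem map_absolutelyContinuous_of_mem_admissible (hn : n ≠ 0) (hΩ₁ : IsOpen Ω₁)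
    (hΩ₂ : IsOpen Ω₂) (hΩ₁f : volume Ω₁ ≠ ⊤) (hΩ₂f : volume Ω₂ ≠ ⊤)
    (hy : y ∈ admissible (n : ℝ≥0∞) Ω₁ Ω₂) :
    (volume.restrict Ω₁).map y ≪ volume.restrict Ω₂ := by
  have hym : AEMeasurable y (volume.restrict Ω₁) := hy.2.1.aemeasurable hΩ₁.measurableSet
  refine Measure.AbsolutelyContinuous.mk fun S hS hS₀ => ?_
  rw [Measure.restrict_apply hS] at hS₀
  have hset : Ω₁ ∩ y ⁻¹' (S ∩ Ω₂) = y ⁻¹' S ∩ Ω₁ := by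
    rw [← image_eq_of_mem_admissible hy, preimage_inter, inter_comm, inter_assoc,
      inter_eq_right.2 (subset_preimage_image y Ω₁)]
  have lintegral_det := setLIntegral_det_of_mem_admissible hn hΩ₁ hΩ₂ hΩ₁f hΩ₂f hy
    (hS.inter hΩ₂.measurableSet) inter_subset_right
  have hdet := (hy.1.aestronglyMeasurable_det_weakGradient hΩ₁).aemeasurable.ennreal_ofReal
  rw [hset, hS₀, lintegral_eq_zero_iff' (hdet.mono_measure
    (Measure.restrict_mono inter_subset_right le_rfl))] at lintegral_det
  have det_pos := ae_restrict_of_ae_restrict_of_subset (inter_subset_right (s := y ⁻¹' S)) hy.2.2.1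
  rw [Measure.map_apply_of_aemeasurable hym hS, Measure.restrict_apply' hΩ₁.measurableSet,
    ← Measure.restrict_eq_zero, ← ae_eq_bot, ← eventually_false_iff_eq_bot]
  filter_upwards [lintegral_det, det_pos] with x hx hx_pos
  exact (ENNReal.ofReal_pos.2 hx_pos).ne' hx

theorem volume_image_of_mem_admissible (hn : n ≠ 0) (hΩ₁ : IsOpen Ω₁) (hΩ₂ : IsOpen Ω₂)
    (hΩ₁f : volume Ω₁ ≠ ⊤) (hΩ₂f : volume Ω₂ ≠ ⊤) (hy : y ∈ admissible (n : ℝ≥0∞) Ω₁ Ω₂)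
    {δ : ℝ} (hdet : ∀ᵐ x ∂volume.restrict Ω₁, (weakGradient Ω₁ y x).det = δ) {C : Set 𝔼}
    (hC : IsCompact C) (hCΩ : C ⊆ Ω₁) : volume (y '' C) = ENNReal.ofReal δ * volume C := by
  obtain ⟨ξ, hp, -⟩ := exists_isHomeoPair_of_mem_admissible hΩ₁ hΩ₂ hy
  have hyC : y '' C ⊆ Ω₂ := (hp.mapsTo.mono_left hCΩ).image_subset
  have hmeas := (hC.image_of_continuousOn (hp.continuousOn.mono hCΩ)).measurableSet
  rw [← setLIntegral_det_of_mem_admissible hn hΩ₁ hΩ₂ hΩ₁f hΩ₂f hy hmeas hyC,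
    ← hp.image_inv_eq hyC, (hp.invOn.1.mono hCΩ).image_image, ← setLIntegral_const]
  refine lintegral_congr_ae ?_
  filter_upwards [ae_restrict_of_ae_restrict_of_subset hCΩ hdet] with x hx
  rw [hx]

/-- `y` is locally `c`-Lipschitz and multiplies volumes by `cⁿ`, so the image of a ball of radius
`r` fills a ball of radius `c r`; disjoint balls having disjoint images, `y` does not decrease
distances below the factor `c` either. -/
theorem exists_ball_norm_sub_eq_of_conformal (hn : n ≠ 0) (hΩ₁ : IsOpen Ω₁) (hΩ₂ : IsOpen Ω₂)
    (hΩ₁f : volume Ω₁ ≠ ⊤) (hΩ₂f : volume Ω₂ ≠ ⊤) (hy : y ∈ admissible (n : ℝ≥0∞) Ω₁ Ω₂)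
    {c : ℝ} (hc : 0 < c) (hdet : ∀ᵐ x ∂volume.restrict Ω₁, (weakGradient Ω₁ y x).det = c ^ n)
    (hconf : ∀ᵐ x ∂volume.restrict Ω₁, ∀ v,
      ‖Matrix.toEuclideanLin (weakGradient Ω₁ y x) v‖ = c * ‖v‖) {z : 𝔼} (hz : z ∈ Ω₁) :
    ∃ ρ > 0, ∀ x₁ ∈ Metric.ball z ρ, ∀ x₂ ∈ Metric.ball z ρ, ‖y x₁ - y x₂‖ = c * ‖x₁ - x₂‖ := by
  obtain ⟨ξ, hp, -⟩ := exists_isHomeoPair_of_mem_admissible hΩ₁ hΩ₂ hy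
  have lipschitz {x : 𝔼} {r : ℝ} (hx : Metric.closedBall x r ⊆ Ω₁) {x₁ x₂ : 𝔼} :
      x₁ ∈ Metric.closedBall x r → x₂ ∈ Metric.closedBall x r → ‖y x₁ - y x₂‖ ≤ c * ‖x₁ - x₂‖ :=
    hy.1.norm_sub_le (by exact_mod_cast Nat.one_le_iff_ne_zero.2 hn) hΩ₁ hp.continuousOn hc.le
      (hconf.mono fun x hx v => (hx v).le) hx
  have image_closedBall (x : 𝔼) (r : ℝ) (hr : 0 < r) (hx : Metric.closedBall x r ⊆ Ω₁) :
      y '' Metric.closedBall x r = Metric.closedBall (y x) (c * r) :=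
    image_closedBall_eq_of_volume_eq hc hr (hp.continuousOn.mono hx)
      (fun w hw => lipschitz hx hw (Metric.mem_closedBall_self hr.le))
      (volume_image_of_mem_admissible hn hΩ₁ hΩ₂ hΩ₁f hΩ₂f hy hdet (isCompact_closedBall x r) hx)
  obtain ⟨r, hr, hrΩ⟩ := Metric.isOpen_iff.1 hΩ₁ z hz
  refine ⟨r / 3, by positivity, fun x₁ hx₁ x₂ hx₂ => le_antisymm ?_ ?_⟩
  · exact lipschitz ((Metric.closedBall_subset_ball (by linarith)).trans hrΩ)
      (Metric.ball_subset_closedBall hx₁) (Metric.ball_subset_closedBall hx₂)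
  · have dist_le : ‖x₁ - x₂‖ / 2 ≤ r / 3 := by
      linarith [dist_triangle_right x₁ x₂ z, dist_eq_norm x₁ x₂, Metric.mem_ball.1 hx₁,
        Metric.mem_ball.1 hx₂]
    have closedBall_subset {x : 𝔼} (hx : x ∈ Metric.ball z (r / 3)) :
        Metric.closedBall x (‖x₁ - x₂‖ / 2) ⊆ Ω₁ :=
      (Metric.closedBall_subset_ball' (by linarith [Metric.mem_ball.1 hx])).trans hrΩ
    exact mul_norm_sub_le_of_image_closedBall_eq hp.invOn.1.injOn hc image_closedBall
      (closedBall_subset hx₁) (closedBall_subset hx₂)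

theorem exists_matrix_of_norm_eq_mul {c : ℝ} (hc : 0 < c) {L : 𝔼 →L[ℝ] 𝔼}
    (hL : ∀ v, ‖L v‖ = c * ‖v‖) : ∃ Q ∈ Matrix.orthogonalGroup (Fin n) ℝ,
      ∀ v, L v = Matrix.toEuclideanLin (c • Q) v := by
  set A : Matrix (Fin n) (Fin n) ℝ := Matrix.toEuclideanLin.symm (L : 𝔼 →ₗ[ℝ] 𝔼) with hA
  have apply_eq (v : 𝔼) : Matrix.toEuclideanLin A v = L v := by
    rw [hA, LinearEquiv.apply_symm_apply, ContinuousLinearMap.coe_coe]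
  refine ⟨c⁻¹ • A, mem_orthogonalGroup_of_norm_toEuclideanLin fun v => ?_, fun v => ?_⟩
  · rw [map_smul, LinearMap.smul_apply, norm_smul, apply_eq, hL, norm_inv,
      Real.norm_of_nonneg hc.le, inv_mul_cancel_left₀ hc.ne']
  · rw [smul_inv_smul₀ hc.ne', apply_eq]

theorem exists_eqOn_affine_of_conformal (hn : n ≠ 0) (hΩ₁ : IsBoundedDomain Ω₁)
    (hΩ₂ : IsOpen Ω₂) (hΩ₂f : volume Ω₂ ≠ ⊤) (hy : y ∈ admissible (n : ℝ≥0∞) Ω₁ Ω₂)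
    {c : ℝ} (hc : 0 < c) (hdet : ∀ᵐ x ∂volume.restrict Ω₁, (weakGradient Ω₁ y x).det = c ^ n)
    (hconf : ∀ᵐ x ∂volume.restrict Ω₁, ∀ v,
      ‖Matrix.toEuclideanLin (weakGradient Ω₁ y x) v‖ = c * ‖v‖) :
    ∃ (a : 𝔼) (Q : Matrix (Fin n) (Fin n) ℝ), Q ∈ Matrix.specialOrthogonalGroup (Fin n) ℝ ∧
      EqOn y (fun x => a + Matrix.toEuclideanLin (c • Q) x) Ω₁ := by
  obtain ⟨a, L, hL, hyL⟩ := exists_eqOn_affine_of_locally_norm_sub_eq hΩ₁.isOpen hΩ₁.isConnected hc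
    fun z hz => exists_ball_norm_sub_eq_of_conformal hn hΩ₁.isOpen hΩ₂
      hΩ₁.isBounded.measure_lt_top.ne hΩ₂f hy hc hdet hconf hz
  obtain ⟨Q, hQ, hLQ⟩ := exists_matrix_of_norm_eq_mul hc hL
  simp only [hLQ] at hyL
  refine ⟨a, Q, Matrix.mem_specialOrthogonalGroup_iff.2 ⟨hQ, ?_⟩, hyL⟩
  have : NeZero (volume.restrict Ω₁) := ⟨by
    rw [Ne, Measure.restrict_eq_zero]
    exact (hΩ₁.isOpen.measure_pos _ hΩ₁.isConnected.nonempty).ne'⟩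
  obtain ⟨x, hx, hx_det⟩ :=
    ((weakGradient_ae_eq_of_eqOn_affine hΩ₁.isOpen hΩ₁.isBounded hyL).and hdet).exists
  rw [hx, Matrix.det_smul, Fintype.card_fin] at hx_det
  exact mul_left_cancel₀ (pow_pos hc n).ne' (hx_det.trans (mul_one _).symm)

end Admissible

/-! ### Minimality -/

section Contact

variable {X : Type*} [MeasurableSpace X] {μ : Measure X}

theorem ofReal_integral_le_lintegral_ofReal {f : X → ℝ} (hf : Integrable f μ) :
    ENNReal.ofReal (∫ x, f x ∂μ) ≤ ∫⁻ x, ENNReal.ofReal (f x) ∂μ := by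
  rw [integral_eq_lintegral_pos_part_sub_lintegral_neg_part hf]
  exact (ENNReal.ofReal_le_ofReal (sub_le_self _ ENNReal.toReal_nonneg)).trans
    ENNReal.ofReal_toReal_le

theorem ae_eq_of_lintegral_ofReal_le {f F : X → ℝ} (hf : Integrable f μ) (hF : AEMeasurable F μ)
    (hF₀ : 0 ≤ᵐ[μ] F) (hfF : f ≤ᵐ[μ] F) (hf₀ : 0 ≤ ∫ x, f x ∂μ)
    (hle : ∫⁻ x, ENNReal.ofReal (F x) ∂μ ≤ ENNReal.ofReal (∫ x, f x ∂μ)) : f =ᵐ[μ] F := by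
  have hFi : Integrable F μ := ⟨hF.aestronglyMeasurable, by
    rw [hasFiniteIntegral_iff_ofReal hF₀]
    exact hle.trans_lt ENNReal.ofReal_lt_top⟩
  have integral_le : ∫ x, F x ∂μ ≤ ∫ x, f x ∂μ := by
    rw [integral_eq_lintegral_of_nonneg_ae hF₀ hF.aestronglyMeasurable]
    exact ENNReal.toReal_le_of_le_ofReal hf₀ hle
  exact (integral_eq_iff_of_ae_le hf hFi hfF).1 ((integral_mono_ae hf hFi hfF).antisymm integral_le)

/-- `f` is strictly above its tangent line on one side of `δ₀`, so `J`, which avoids that side, has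
mean `δ₀` only if it is constant. -/
theorem ae_eq_const_of_apply_eq_tangent [IsFiniteMeasure μ] {S : Set ℝ} {f : ℝ → ℝ}
    (hf : ConvexOn ℝ S f) {f' δ₀ : ℝ} (hf' : HasDerivAt f f' δ₀)
    (hna : ¬ ∃ p q : ℝ, ∀ᶠ δ in 𝓝 δ₀, f δ = p * δ + q) {J : X → ℝ} (hJ : Integrable J μ)
    (hmean : ∫ x, J x ∂μ = δ₀ * μ.real univ) (hJS : ∀ᵐ x ∂μ, J x ∈ S)
    (hcontact : ∀ᵐ x ∂μ, f (J x) = f δ₀ + f' * (J x - δ₀)) : ∀ᵐ x ∂μ, J x = δ₀ := by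
  have integral_eq : ∫ x, J x ∂μ = ∫ _, δ₀ ∂μ := by
    rw [hmean, integral_const, smul_eq_mul, mul_comm]
  by_cases hleft : ∃ a ∈ S, a < δ₀ ∧ f a = f δ₀ + f' * (a - δ₀)
  · obtain ⟨a, ha, haδ, hfa⟩ := hleft
    refine (integral_eq_iff_of_ae_le hJ (integrable_const δ₀) ?_).1 integral_eq
    filter_upwards [hcontact, hJS] with x hx hxS
    by_contra! hlt
    exact hna (eventually_eq_affine_of_tangent_eq hf hf' ha hxS haδ hlt hfa hx)
  · refine EventuallyEq.symm
      ((integral_eq_iff_of_ae_le (integrable_const δ₀) hJ ?_).1 integral_eq.symm)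
    filter_upwards [hcontact, hJS] with x hx hxS
    by_contra! hlt
    exact hleft ⟨_, hxS, hlt, hx⟩

theorem aemeasurable_comp_of_continuousOn {S : Set ℝ} (hS : MeasurableSet S) {f : ℝ → ℝ}
    (hf : ContinuousOn f S) {J : X → ℝ} (hJ : AEMeasurable J μ) (hJS : ∀ᵐ x ∂μ, J x ∈ S) :
    AEMeasurable (fun x => f (J x)) μ := by
  classical
  have hmeas : Measurable (S.piecewise f 0) := hf.measurable_piecewise continuousOn_const hS
  refine (hmeas.comp_aemeasurable hJ).congr ?_
  filter_upwards [hJS] with x hx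
  exact piecewise_eq_of_mem _ _ _ hx

variable {α : ℝ} {h : ℝ → ℝ}

theorem aemeasurable_isotropicEnergy (hh : ContinuousOn h (Ioi 0))
    {G : X → Matrix (Fin n) (Fin n) ℝ} (hG : ∀ i j, AEStronglyMeasurable (fun x => G x i j) μ)
    (hpos : ∀ᵐ x ∂μ, 0 < (G x).det) : AEMeasurable (fun x => isotropicEnergy α h (G x)) μ := by
  have hdet := (aestronglyMeasurable_det hG).aemeasurable
  have hfrob : AEMeasurable (fun x => frobSq (G x)) μ :=
    Finset.aemeasurable_fun_sum _ fun i _ => Finset.aemeasurable_fun_sum _ fun j _ =>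
      (hG i j).aemeasurable.pow_const 2
  exact ((((hfrob.div_const _).pow_const _).const_mul _).add
    ((hdet.pow_const _).const_mul _)).add
    (aemeasurable_comp_of_continuousOn measurableSet_Ioi hh hdet hpos)

theorem integrable_dilationTangent [IsFiniteMeasure μ] {J : X → ℝ} {δ₀ : ℝ}
    (hJ : Integrable J μ) : Integrable (fun x => dilationTangent n α h δ₀ (J x)) μ :=
  (integrable_const _).add ((hJ.sub (integrable_const _)).const_mul _)

theorem integral_dilationTangent [IsFiniteMeasure μ] {J : X → ℝ} {δ₀ : ℝ} (hJ : Integrable J μ)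
    (hmean : ∫ x, J x ∂μ = δ₀ * μ.real univ) :
    ∫ x, dilationTangent n α h δ₀ (J x) ∂μ = dilationEnergy n α h δ₀ * μ.real univ := by
  have integrable_slope : Integrable (fun x => dilationSlope n α h δ₀ * (J x - δ₀)) μ :=
    (hJ.sub (integrable_const _)).const_mul _
  simp only [dilationTangent]
  rw [integral_add (integrable_const _) integrable_slope, integral_const_mul,
    integral_sub hJ (integrable_const _), hmean, integral_const, integral_const, smul_eq_mul,
    smul_eq_mul]
  ring

end Contact

section Minimality

variable {α : ℝ} {h : ℝ → ℝ} {Ω : Set (EuclideanSpace ℝ (Fin n))}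
  {R : Matrix (Fin n) (Fin n) ℝ} {c : ℝ} {y : EuclideanSpace ℝ (Fin n) → EuclideanSpace ℝ (Fin n)}
  {γ : EuclideanSpace ℝ (Fin n) → ℝ}

theorem volume_image_toEuclideanLin_smul_ne_top (hR : R ∈ Matrix.specialOrthogonalGroup (Fin n) ℝ)
    (hc : 0 < c) (hΩ : volume Ω ≠ ⊤) : volume (Matrix.toEuclideanLin (c • R) '' Ω) ≠ ⊤ := by
  rw [volume_image_toEuclideanLin_smul hR hc]
  exact ENNReal.mul_ne_top ENNReal.ofReal_ne_top hΩ

theorem integral_det_eq_pow_mul_volume (hn : n ≠ 0) (hΩ : IsOpen Ω) (hΩf : volume Ω ≠ ⊤)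
    (hR : R ∈ Matrix.specialOrthogonalGroup (Fin n) ℝ) (hc : 0 < c)
    (hy : y ∈ admissible (n : ℝ≥0∞) Ω (Matrix.toEuclideanLin (c • R) '' Ω)) :
    IntegrableOn (fun x => (weakGradient Ω y x).det) Ω ∧
      ∫ x in Ω, (weakGradient Ω y x).det = c ^ n * (volume.restrict Ω).real univ := by
  have hRo := (Matrix.mem_specialOrthogonalGroup_iff.1 hR).1
  obtain ⟨integrable_det, integral_det⟩ := integrableOn_det_of_mem_admissible hn hΩ
    (isOpen_image_toEuclideanLin_smul hRo hc.ne' hΩ) hΩf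
    (volume_image_toEuclideanLin_smul_ne_top hR hc hΩf) hy
  refine ⟨integrable_det, integral_det.trans ?_⟩
  rw [measureReal_def, volume_image_toEuclideanLin_smul hR hc, ENNReal.toReal_mul,
    ENNReal.toReal_ofReal (pow_pos hc n).le, measureReal_restrict_apply_univ, measureReal_def]

theorem ofReal_integral_dilationTangent_det (hn : n ≠ 0) (hΩ : IsOpen Ω) (hΩf : volume Ω ≠ ⊤)
    (hR : R ∈ Matrix.specialOrthogonalGroup (Fin n) ℝ) (hc : 0 < c)
    (hy : y ∈ admissible (n : ℝ≥0∞) Ω (Matrix.toEuclideanLin (c • R) '' Ω)) :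
    ENNReal.ofReal (∫ x in Ω, dilationTangent n α h (c ^ n) (weakGradient Ω y x).det) =
      ENNReal.ofReal (dilationEnergy n α h (c ^ n)) * volume Ω := by
  have : IsFiniteMeasure (volume.restrict Ω) := ⟨by simpa using hΩf.lt_top⟩
  obtain ⟨integrable_det, integral_det⟩ := integral_det_eq_pow_mul_volume hn hΩ hΩf hR hc hy
  rw [integral_dilationTangent integrable_det integral_det,
    ENNReal.ofReal_mul' measureReal_nonneg, ofReal_measureReal, Measure.restrict_apply_univ]

theorem ofReal_dilationEnergy_mul_volume_le_lintegral (hn : n ≠ 0) (hΩ : IsOpen Ω)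
    (hΩf : volume Ω ≠ ⊤) (hR : R ∈ Matrix.specialOrthogonalGroup (Fin n) ℝ) (hc : 0 < c)
    (hy : y ∈ admissible (n : ℝ≥0∞) Ω (Matrix.toEuclideanLin (c • R) '' Ω))
    {F : 𝔼 → ℝ} (hF : ∀ᵐ x ∂volume.restrict Ω,
      dilationTangent n α h (c ^ n) (weakGradient Ω y x).det ≤ F x) :
    ENNReal.ofReal (dilationEnergy n α h (c ^ n)) * volume Ω ≤
      ∫⁻ x in Ω, ENNReal.ofReal (F x) := by
  have : IsFiniteMeasure (volume.restrict Ω) := ⟨by simpa using hΩf.lt_top⟩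
  rw [← ofReal_integral_dilationTangent_det hn hΩ hΩf hR hc hy]
  exact (ofReal_integral_le_lintegral_ofReal (integrable_dilationTangent
    (integral_det_eq_pow_mul_volume hn hΩ hΩf hR hc hy).1)).trans
    (lintegral_mono_ae (hF.mono fun x hx => ENNReal.ofReal_le_ofReal hx))

theorem dilationTangent_det_ae_eq_of_lintegral_le (hn : n ≠ 0) (hα : (n : ℝ) ≤ α)
    (h_diff : DifferentiableOn ℝ h (Ioi 0)) (h_convex : ConvexOn ℝ (Ioi 0) h)
    (h_symm : ∀ δ : ℝ, 0 < δ → h δ = δ * h δ⁻¹) (h_deriv : deriv h 1 = -(n : ℝ))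
    (hΩ : IsOpen Ω) (hΩf : volume Ω ≠ ⊤) (hR : R ∈ Matrix.specialOrthogonalGroup (Fin n) ℝ)
    (hc : 0 < c) (hy : y ∈ admissible (n : ℝ≥0∞) Ω (Matrix.toEuclideanLin (c • R) '' Ω))
    (hγ : AEMeasurable γ (volume.restrict Ω)) (hγ₀ : ∀ x, 0 ≤ γ x)
    (hle : ∫⁻ x in Ω, ENNReal.ofReal (elasticEnergy α h (weakGradient Ω y x) +
      (1 + (weakGradient Ω y x).det) * γ x) ≤
        ENNReal.ofReal (dilationEnergy n α h (c ^ n)) * volume Ω) :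
    ∀ᵐ x ∂volume.restrict Ω, dilationTangent n α h (c ^ n) (weakGradient Ω y x).det =
      isotropicEnergy α h (weakGradient Ω y x) + (1 + (weakGradient Ω y x).det) * γ x := by
  have : IsFiniteMeasure (volume.restrict Ω) := ⟨by simpa using hΩf.lt_top⟩
  have diff_at : ∀ {δ : ℝ}, 0 < δ → DifferentiableAt ℝ h δ := fun hδ =>
    h_diff.differentiableAt (Ioi_mem_nhds hδ)
  have hpos := hy.2.2.1
  obtain ⟨integrable_det, integral_det⟩ := integral_det_eq_pow_mul_volume hn hΩ hΩf hR hc hy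
  have measurable_energy := aemeasurable_isotropicEnergy (α := α) h_diff.continuousOn
    (fun i j => (hy.1.memLp_weakGradient hΩ i j).aestronglyMeasurable) hpos
  have mismatch_nonneg : ∀ᵐ x ∂volume.restrict Ω, 0 ≤ (1 + (weakGradient Ω y x).det) * γ x :=
    hpos.mono fun x hx => mul_nonneg (by linarith) (hγ₀ x)
  refine ae_eq_of_lintegral_ofReal_le (integrable_dilationTangent integrable_det)
    (measurable_energy.add ((integrable_det.aemeasurable.const_add 1).mul hγ)) ?_ ?_ ?_ ?_
  · filter_upwards [hpos, mismatch_nonneg] with x hx hγx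
    exact add_nonneg (isotropicEnergy_nonneg hn hα h_convex (diff_at one_pos) h_symm h_deriv hx) hγx
  · filter_upwards [hpos, mismatch_nonneg] with x hx hγx
    exact (dilationTangent_le_isotropicEnergy hn hα h_convex (pow_pos hc n)
      (diff_at (pow_pos hc n)) hx).trans (le_add_of_nonneg_right hγx)
  · rw [integral_dilationTangent integrable_det integral_det]
    exact mul_nonneg (dilationEnergy_nonneg hn hα h_convex (diff_at one_pos) h_symm h_deriv
      (pow_pos hc n)) measureReal_nonneg
  · rw [ofReal_integral_dilationTangent_det hn hΩ hΩf hR hc hy]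
    refine (lintegral_mono_ae ?_).trans hle
    filter_upwards [hpos] with x hx
    exact ENNReal.ofReal_le_ofReal (add_le_add_left (isotropicEnergy_le_elasticEnergy hn hα hx) _)

theorem det_ae_eq_pow_of_dilationEnergy_eq (hn : n ≠ 0) (hα : (n : ℝ) ≤ α)
    (h_convex : ConvexOn ℝ (Ioi 0) h) (hΩ : IsOpen Ω) (hΩf : volume Ω ≠ ⊤)
    (hR : R ∈ Matrix.specialOrthogonalGroup (Fin n) ℝ) (hc : 0 < c)
    (h_diff : DifferentiableAt ℝ h (c ^ n))
    (hna : α = n → ¬ ∃ p q : ℝ, ∀ᶠ δ in 𝓝 (c ^ n), h δ = p * δ + q)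
    (hy : y ∈ admissible (n : ℝ≥0∞) Ω (Matrix.toEuclideanLin (c • R) '' Ω))
    (heq : ∀ᵐ x ∂volume.restrict Ω, dilationEnergy n α h (weakGradient Ω y x).det =
      dilationTangent n α h (c ^ n) (weakGradient Ω y x).det) :
    ∀ᵐ x ∂volume.restrict Ω, (weakGradient Ω y x).det = c ^ n := by
  have : IsFiniteMeasure (volume.restrict Ω) := ⟨by simpa using hΩf.lt_top⟩
  rcases hα.lt_or_eq with hlt | hα_eq
  · filter_upwards [heq, hy.2.2.1] with x hx hx_pos
    exact eq_of_dilationEnergy_eq_dilationTangent hn hlt h_convex hx_pos (pow_pos hc n) h_diff hx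
  · obtain ⟨integrable_det, integral_det⟩ := integral_det_eq_pow_mul_volume hn hΩ hΩf hR hc hy
    refine ae_eq_const_of_apply_eq_tangent h_convex h_diff.hasDerivAt (hna hα_eq.symm)
      integrable_det integral_det hy.2.2.1 ?_
    filter_upwards [heq, hy.2.2.1] with x hx hx_pos
    exact apply_eq_tangent_of_dilationEnergy_eq hn hα h_convex hx_pos (pow_pos hc n) h_diff hx

theorem exists_eqOn_affine_of_lintegral_le (hn : n ≠ 0) (hα : (n : ℝ) ≤ α)
    (h_diff : DifferentiableOn ℝ h (Ioi 0)) (h_convex : ConvexOn ℝ (Ioi 0) h)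
    (h_symm : ∀ δ : ℝ, 0 < δ → h δ = δ * h δ⁻¹) (h_deriv : deriv h 1 = -(n : ℝ))
    (hΩ : IsBoundedDomain Ω) (hR : R ∈ Matrix.specialOrthogonalGroup (Fin n) ℝ) (hc : 0 < c)
    (hna : α = n → ¬ ∃ p q : ℝ, ∀ᶠ δ in 𝓝 (c ^ n), h δ = p * δ + q)
    (hy : y ∈ admissible (n : ℝ≥0∞) Ω (Matrix.toEuclideanLin (c • R) '' Ω))
    (hγ : AEMeasurable γ (volume.restrict Ω)) (hγ₀ : ∀ x, 0 ≤ γ x)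
    (hle : ∫⁻ x in Ω, ENNReal.ofReal (elasticEnergy α h (weakGradient Ω y x) +
      (1 + (weakGradient Ω y x).det) * γ x) ≤
        ENNReal.ofReal (dilationEnergy n α h (c ^ n)) * volume Ω) :
    (∃ (a : 𝔼) (Q : Matrix (Fin n) (Fin n) ℝ),
      Q ∈ Matrix.specialOrthogonalGroup (Fin n) ℝ ∧
        EqOn y (fun x => a + Matrix.toEuclideanLin (c • Q) x) Ω) ∧
      ∀ᵐ x ∂volume.restrict Ω, γ x = 0 := by
  have hΩf : volume Ω ≠ ⊤ := hΩ.isBounded.measure_lt_top.ne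
  have hα_pos : 0 < α := (Nat.cast_pos.2 hn.bot_lt).trans_le hα
  have hpos := hy.2.2.1
  have diff_at := h_diff.differentiableAt (Ioi_mem_nhds (pow_pos hc n))
  have tangent_eq := dilationTangent_det_ae_eq_of_lintegral_le hn hα h_diff h_convex h_symm h_deriv
    hΩ.isOpen hΩf hR hc hy hγ hγ₀ hle
  have equalities : ∀ᵐ x ∂volume.restrict Ω, γ x = 0 ∧
      isotropicEnergy α h (weakGradient Ω y x) = dilationEnergy n α h (weakGradient Ω y x).det ∧
      dilationEnergy n α h (weakGradient Ω y x).det =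
        dilationTangent n α h (c ^ n) (weakGradient Ω y x).det := by
    filter_upwards [tangent_eq, hpos] with x hx hx_pos
    have energy_le := dilationEnergy_le_isotropicEnergy (h := h) hn hα_pos.le hx_pos
    have tangent_le := dilationTangent_le_dilationEnergy hn hα h_convex hx_pos (pow_pos hc n)
      diff_at
    have mismatch_nonneg := mul_nonneg (by linarith : 0 ≤ 1 + (weakGradient Ω y x).det) (hγ₀ x)
    have mismatch_eq : (1 + (weakGradient Ω y x).det) * γ x = 0 := by linarith
    exact ⟨(mul_eq_zero.1 mismatch_eq).resolve_left (by linarith), by linarith, by linarith⟩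
  have det_eq := det_ae_eq_pow_of_dilationEnergy_eq hn hα h_convex hΩ.isOpen hΩf hR hc diff_at hna
    hy (equalities.mono fun x hx => hx.2.2)
  refine ⟨exists_eqOn_affine_of_conformal hn hΩ (isOpen_image_toEuclideanLin_smul
    (Matrix.mem_specialOrthogonalGroup_iff.1 hR).1 hc.ne' hΩ.isOpen)
    (volume_image_toEuclideanLin_smul_ne_top hR hc hΩf) hy hc det_eq ?_,
    equalities.mono fun x hx => hx.1⟩
  filter_upwards [equalities, hpos, det_eq] with x hx hx_pos hx_det
  exact norm_toEuclideanLin_of_singVal_eq_singVal hc hx_det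
    (singVal_eq_of_isotropicEnergy_eq hn hα_pos hx_pos hx.2.1)

variable {m : ℕ} {g : EuclideanSpace ℝ (Fin m) → EuclideanSpace ℝ (Fin m) → ℝ}
  {c₁ c₂ : EuclideanSpace ℝ (Fin n) → EuclideanSpace ℝ (Fin m)}

theorem functional_toEuclideanLin_smul (hn : n ≠ 0) (hΩ : IsOpen Ω) (hΩb : Bornology.IsBounded Ω)
    (hR : R ∈ Matrix.specialOrthogonalGroup (Fin n) ℝ) (hc : 0 < c) (hg : ∀ d, g d d = 0)
    (hcc : ∀ᵐ x ∂volume.restrict Ω, c₂ (Matrix.toEuclideanLin (c • R) x) = c₁ x) :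
    functional (integrand (elasticEnergy α h) g) Ω c₁ c₂
      (fun x => Matrix.toEuclideanLin (c • R) x) =
        ENNReal.ofReal (dilationEnergy n α h (c ^ n)) * volume Ω := by
  rw [functional, ← setLIntegral_const]
  refine lintegral_congr_ae ?_
  filter_upwards [hcc, weakGradient_ae_eq_of_eqOn_affine (a := 0) (A := c • R) hΩ hΩb
    fun x _ => (zero_add _).symm] with x hx hx_grad
  rw [hx_grad, integrand, hx, hg, mul_zero, add_zero,
    elasticEnergy_smul_of_mem_specialOrthogonalGroup hn hR hc]

theorem le_functional (hn : n ≠ 0) (hα : (n : ℝ) ≤ α) (h_convex : ConvexOn ℝ (Ioi 0) h)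
    (hΩ : IsOpen Ω) (hΩf : volume Ω ≠ ⊤) (hR : R ∈ Matrix.specialOrthogonalGroup (Fin n) ℝ)
    (hc : 0 < c) (h_diff : DifferentiableAt ℝ h (c ^ n))
    (hy : y ∈ admissible (n : ℝ≥0∞) Ω (Matrix.toEuclideanLin (c • R) '' Ω))
    (hg₀ : ∀ d e, 0 ≤ g d e) :
    ENNReal.ofReal (dilationEnergy n α h (c ^ n)) * volume Ω ≤
      functional (integrand (elasticEnergy α h) g) Ω c₁ c₂ y :=
  ofReal_dilationEnergy_mul_volume_le_lintegral hn hΩ hΩf hR hc hy <| hy.2.2.1.mono fun x hx =>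
    (dilationTangent_le_elasticEnergy hn hα h_convex (pow_pos hc n) h_diff hx).trans
      (le_add_of_nonneg_right (mul_nonneg (by linarith) (hg₀ _ _)))

theorem aemeasurable_comp_of_mem_admissible {β : Type*} [MeasurableSpace β] (hn : n ≠ 0)
    (hΩ : IsOpen Ω) (hΩf : volume Ω ≠ ⊤) (hR : R ∈ Matrix.specialOrthogonalGroup (Fin n) ℝ)
    (hc : 0 < c) {d : 𝔼 → β}
    (hd : AEMeasurable d (volume.restrict (Matrix.toEuclideanLin (c • R) '' Ω)))
    (hy : y ∈ admissible (n : ℝ≥0∞) Ω (Matrix.toEuclideanLin (c • R) '' Ω)) :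
    AEMeasurable (fun x => d (y x)) (volume.restrict Ω) :=
  (hd.mono_ac (map_absolutelyContinuous_of_mem_admissible hn hΩ
    (isOpen_image_toEuclideanLin_smul (Matrix.mem_specialOrthogonalGroup_iff.1 hR).1 hc.ne' hΩ) hΩf
    (volume_image_toEuclideanLin_smul_ne_top hR hc hΩf) hy)).comp_aemeasurable
    (hy.2.1.aemeasurable hΩ.measurableSet)

theorem exists_eqOn_affine_of_functional_le (hn : n ≠ 0) (hα : (n : ℝ) ≤ α)
    (h_diff : DifferentiableOn ℝ h (Ioi 0)) (h_convex : ConvexOn ℝ (Ioi 0) h)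
    (h_symm : ∀ δ : ℝ, 0 < δ → h δ = δ * h δ⁻¹) (h_deriv : deriv h 1 = -(n : ℝ))
    (hΩ : IsBoundedDomain Ω) (hR : R ∈ Matrix.specialOrthogonalGroup (Fin n) ℝ) (hc : 0 < c)
    (hna : α = n → ¬ ∃ p q : ℝ, ∀ᶠ δ in 𝓝 (c ^ n), h δ = p * δ + q)
    (hg_meas : Measurable (Function.uncurry g)) (hg₀ : ∀ d e, 0 ≤ g d e)
    (hg : ∀ d e, g d e = 0 ↔ d = e)
    (hc₂ : AEMeasurable c₂ (volume.restrict (Matrix.toEuclideanLin (c • R) '' Ω)))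
    (hcc : ∀ᵐ x ∂volume.restrict Ω, c₂ (Matrix.toEuclideanLin (c • R) x) = c₁ x)
    (hy : y ∈ admissible (n : ℝ≥0∞) Ω (Matrix.toEuclideanLin (c • R) '' Ω))
    (hle : functional (integrand (elasticEnergy α h) g) Ω c₁ c₂ y ≤
      ENNReal.ofReal (dilationEnergy n α h (c ^ n)) * volume Ω) :
    ∃ (a : 𝔼) (Q : Matrix (Fin n) (Fin n) ℝ),
      Q ∈ Matrix.specialOrthogonalGroup (Fin n) ℝ ∧
        EqOn y (fun x => a + Matrix.toEuclideanLin (c • Q) x) Ω ∧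
        ∀ᵐ x ∂volume.restrict Ω,
          c₂ (a + Matrix.toEuclideanLin (c • Q) x) = c₂ (Matrix.toEuclideanLin (c • R) x) := by
  have hΩf : volume Ω ≠ ⊤ := hΩ.isBounded.measure_lt_top.ne
  have hc₂y := aemeasurable_comp_of_mem_admissible hn hΩ.isOpen hΩf hR hc hc₂ hy
  have hc₁ : AEMeasurable c₁ (volume.restrict Ω) :=
    (aemeasurable_comp_of_mem_admissible hn hΩ.isOpen hΩf hR hc hc₂
      (toEuclideanLin_smul_mem_admissible hR hc hΩ.isOpen hΩ.isBounded)).congr hcc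
  obtain ⟨⟨a, Q, hQ, hyQ⟩, hmatch⟩ := exists_eqOn_affine_of_lintegral_le hn hα h_diff h_convex
    h_symm h_deriv hΩ hR hc hna hy (γ := fun x => g (c₁ x) (c₂ (y x)))
    (hg_meas.comp_aemeasurable (hc₁.prodMk hc₂y)) (fun x => hg₀ _ _) hle
  refine ⟨a, Q, hQ, hyQ, ?_⟩
  filter_upwards [hmatch, hcc, ae_restrict_mem hΩ.isOpen.measurableSet] with x hx hxc hxΩ
  have hyx : y x = a + Matrix.toEuclideanLin (c • Q) x := hyQ hxΩ
  rw [← hyx, hxc, (hg _ _).1 hx]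

end Minimality

section Main

variable {α : ℝ} {h : ℝ → ℝ} {Ω : Set (EuclideanSpace ℝ (Fin n))}
  {R : Matrix (Fin n) (Fin n) ℝ} {c : ℝ}

theorem elasticEnergy_smul_le_setLAverage (hn : n ≠ 0) (hα : (n : ℝ) ≤ α)
    (h_convex : ConvexOn ℝ (Ioi 0) h) (hΩ : IsBoundedDomain Ω)
    (hR : R ∈ Matrix.specialOrthogonalGroup (Fin n) ℝ) (hc : 0 < c)
    (h_diff : DifferentiableAt ℝ h (c ^ n))
    {y : 𝔼 → 𝔼}
    (hy : y ∈ admissible (n : ℝ≥0∞) Ω (Matrix.toEuclideanLin (c • R) '' Ω)) :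
    ENNReal.ofReal (elasticEnergy α h (c • R)) ≤
      ⨍⁻ x in Ω, ENNReal.ofReal (elasticEnergy α h (weakGradient Ω y x)) ∂volume := by
  have volume_ne_top : volume Ω ≠ ⊤ := hΩ.isBounded.measure_lt_top.ne
  have volume_ne_zero : volume Ω ≠ 0 := (hΩ.isOpen.measure_pos _ hΩ.isConnected.nonempty).ne'
  rw [elasticEnergy_smul_of_mem_specialOrthogonalGroup hn hR hc, setLAverage_eq,
    ENNReal.le_div_iff_mul_le (Or.inl volume_ne_zero) (Or.inl volume_ne_top)]
  exact ofReal_dilationEnergy_mul_volume_le_lintegral hn hΩ.isOpen volume_ne_top hR hc hy <|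
    hy.2.2.1.mono fun x hx =>
      dilationTangent_le_elasticEnergy hn hα h_convex (pow_pos hc n) h_diff hx

theorem isUniqueMinimiser_toEuclideanLin_smul (hn : n ≠ 0) (hα : (n : ℝ) ≤ α)
    (h_diff : DifferentiableOn ℝ h (Ioi 0)) (h_convex : ConvexOn ℝ (Ioi 0) h)
    (h_symm : ∀ δ : ℝ, 0 < δ → h δ = δ * h δ⁻¹) (h_deriv : deriv h 1 = -(n : ℝ))
    (hΩ : IsBoundedDomain Ω) (hR : R ∈ Matrix.specialOrthogonalGroup (Fin n) ℝ) (hc : 0 < c)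
    (hna : α = n → ¬ ∃ p q : ℝ, ∀ᶠ δ in 𝓝 (c ^ n), h δ = p * δ + q) {m : ℕ}
    {g : EuclideanSpace ℝ (Fin m) → EuclideanSpace ℝ (Fin m) → ℝ}
    {c₁ c₂ : 𝔼 → EuclideanSpace ℝ (Fin m)}
    (hg_meas : Measurable (Function.uncurry g)) (hg₀ : ∀ d e, 0 ≤ g d e)
    (hg : ∀ d e, g d e = 0 ↔ d = e)
    (hc₂ : AEMeasurable c₂ (volume.restrict (Matrix.toEuclideanLin (c • R) '' Ω)))
    (hcc : ∀ᵐ x ∂volume.restrict Ω, c₂ (Matrix.toEuclideanLin (c • R) x) = c₁ x)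
    (hgen : ∀ (a : 𝔼) (Q : Matrix (Fin n) (Fin n) ℝ),
      Q ∈ Matrix.specialOrthogonalGroup (Fin n) ℝ →
      (fun x => a + Matrix.toEuclideanLin (c • Q) x) '' Ω =
        Matrix.toEuclideanLin (c • R) '' Ω →
      (∀ᵐ x ∂volume.restrict Ω,
        c₂ (a + Matrix.toEuclideanLin (c • Q) x) = c₂ (Matrix.toEuclideanLin (c • R) x)) →
      a = 0 ∧ Q = R) :
    IsUniqueMinimiser Ω (admissible (n : ℝ≥0∞) Ω (Matrix.toEuclideanLin (c • R) '' Ω))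
      (functional (integrand (elasticEnergy α h) g) Ω c₁ c₂)
      (fun x => Matrix.toEuclideanLin (c • R) x) := by
  have linear_mem := toEuclideanLin_smul_mem_admissible (p := n) hR hc hΩ.isOpen hΩ.isBounded
  have functional_linear := functional_toEuclideanLin_smul (α := α) (h := h) hn hΩ.isOpen
    hΩ.isBounded hR hc (fun d => (hg d d).2 rfl) hcc
  refine ⟨linear_mem, fun y hy => ?_, fun y hy hmin => ?_⟩
  · rw [mem_ofPred_eq, functional_linear]
    exact le_functional hn hα h_convex hΩ.isOpen hΩ.isBounded.measure_lt_top.ne hR hc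
      (h_diff.differentiableAt (Ioi_mem_nhds (pow_pos hc n))) hy hg₀
  · obtain ⟨a, Q, hQ, hyQ, hmatch⟩ := exists_eqOn_affine_of_functional_le hn hα h_diff h_convex
      h_symm h_deriv hΩ hR hc hna hg_meas hg₀ hg hc₂ hcc hy
      ((hmin linear_mem).trans_eq functional_linear)
    obtain ⟨rfl, rfl⟩ := hgen a Q hQ
      ((image_congr hyQ).symm.trans (image_eq_of_mem_admissible hy)) hmatch
    simpa only [zero_add] using hyQ

theorem theorem4p1_general (n : ℕ) (hn : n ≠ 0) (α : ℝ) (hα : (n : ℝ) ≤ α) (h : ℝ → ℝ)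
    (h_diff : DifferentiableOn ℝ h (Ioi 0)) (h_convex : ConvexOn ℝ (Ioi 0) h)
    (h_symm : ∀ δ : ℝ, 0 < δ → h δ = δ * h δ⁻¹) (h_deriv : deriv h 1 = -(n : ℝ)) :
    (∀ A : Matrix (Fin n) (Fin n) ℝ, 0 < A.det → 0 ≤ elasticEnergy α h A) ∧
    ∀ (lam : ℝ) (R : Matrix (Fin n) (Fin n) ℝ) (Ω₁ : Set (EuclideanSpace ℝ (Fin n))),
      0 < lam → R ∈ Matrix.specialOrthogonalGroup (Fin n) ℝ → IsBoundedDomain Ω₁ →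
      (∀ y ∈ admissible (n : ℝ≥0∞) Ω₁ (Matrix.toEuclideanLin (lam • R) '' Ω₁),
        ENNReal.ofReal (elasticEnergy α h (lam • R)) ≤
          ⨍⁻ x in Ω₁, ENNReal.ofReal (elasticEnergy α h (weakGradient Ω₁ y x)) ∂volume) ∧
      ((α = n → ¬ ∃ p q : ℝ, ∀ᶠ δ in 𝓝 (lam ^ n), h δ = p * δ + q) →
        ∀ (m : ℕ) (g : EuclideanSpace ℝ (Fin m) → EuclideanSpace ℝ (Fin m) → ℝ)
          (c₁ c₂ : EuclideanSpace ℝ (Fin n) → EuclideanSpace ℝ (Fin m)),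
          Measurable (Function.uncurry g) → (∀ c d, 0 ≤ g c d) → (∀ c d, g c d = 0 ↔ c = d) →
          AEMeasurable c₂ (volume.restrict (Matrix.toEuclideanLin (lam • R) '' Ω₁)) →
          (∀ᵐ x ∂volume.restrict Ω₁, c₂ (Matrix.toEuclideanLin (lam • R) x) = c₁ x) →
          (∀ (a : EuclideanSpace ℝ (Fin n)) (Q : Matrix (Fin n) (Fin n) ℝ),
            Q ∈ Matrix.specialOrthogonalGroup (Fin n) ℝ →
            (fun x => a + lam • Matrix.toEuclideanLin Q x) '' Ω₁ =
              Matrix.toEuclideanLin (lam • R) '' Ω₁ →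
            (∀ᵐ x ∂volume.restrict Ω₁,
              c₂ (a + lam • Matrix.toEuclideanLin Q x) =
                c₂ (lam • Matrix.toEuclideanLin R x)) →
            a = 0 ∧ Q = R) →
          IsUniqueMinimiser Ω₁
            (admissible (n : ℝ≥0∞) Ω₁ (Matrix.toEuclideanLin (lam • R) '' Ω₁))
            (functional (integrand (elasticEnergy α h) g) Ω₁ c₁ c₂)
            (fun x => lam • Matrix.toEuclideanLin R x)) := by
  have diff_at : ∀ {δ : ℝ}, 0 < δ → DifferentiableAt ℝ h δ := fun hδ =>
    h_diff.differentiableAt (Ioi_mem_nhds hδ)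
  refine ⟨fun A hA =>
    elasticEnergy_nonneg hn hα h_convex (diff_at one_pos) h_symm h_deriv hA,
    fun lam R Ω₁ hlam hR hΩ₁ => ⟨fun y hy =>
      elasticEnergy_smul_le_setLAverage hn hα h_convex hΩ₁ hR hlam (diff_at (pow_pos hlam n)) hy,
    fun hna m g c₁ c₂ hg_meas hg₀ hg hc₂ hcc hgen => ?_⟩⟩
  have smul_apply : ∀ (Q : Matrix (Fin n) (Fin n) ℝ) (x : EuclideanSpace ℝ (Fin n)),
      lam • Matrix.toEuclideanLin Q x = Matrix.toEuclideanLin (lam • Q) x := fun Q x => by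
    rw [map_smul, LinearMap.smul_apply]
  simp only [smul_apply] at hgen ⊢
  exact isUniqueMinimiser_toEuclideanLin_smul hn hα h_diff h_convex h_symm h_deriv hΩ₁ hR hlam hna
    hg_meas hg₀ hg hc₂ hcc hgen

end Main

end ImageMatching

theorem theorem4p1 (n : ℕ) (hn : 1 ≤ n) (α : ℝ) (hα : (n : ℝ) ≤ α) (h : ℝ → ℝ)
    (h_C1 : ContDiffOn ℝ 1 h (Ioi 0))
    (h_convex : ConvexOn ℝ (Ioi 0) h)
    (h_bddBelow : BddBelow (h '' Ioi 0))
    (h_symm : ∀ δ : ℝ, 0 < δ → h δ = δ * h δ⁻¹)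
    (h_deriv : deriv h 1 = -(n : ℝ)) :
    (∀ A : Matrix (Fin n) (Fin n) ℝ, 0 < A.det → 0 ≤ ImageMatching.elasticEnergy α h A) ∧
    ∀ (lam : ℝ) (R M : Matrix (Fin n) (Fin n) ℝ) (Ω₁ Ω₂ : Set (EuclideanSpace ℝ (Fin n))),
      0 < lam → R ∈ Matrix.specialOrthogonalGroup (Fin n) ℝ → M = lam • R →
      ImageMatching.IsBoundedDomain Ω₁ → Ω₂ = Matrix.toEuclideanLin M '' Ω₁ →
      (∀ y ∈ ImageMatching.admissible (n : ℝ≥0∞) Ω₁ Ω₂,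
        ENNReal.ofReal (ImageMatching.elasticEnergy α h M) ≤
          ⨍⁻ x in Ω₁,
            ENNReal.ofReal (ImageMatching.elasticEnergy α h
              (ImageMatching.weakGradient Ω₁ y x)) ∂volume) ∧
      ((α = n → ¬ ∃ p q : ℝ, ∀ᶠ δ in 𝓝 (lam ^ n), h δ = p * δ + q) →
        ∀ (m : ℕ) (K : Set (EuclideanSpace ℝ (Fin m)))
          (g : EuclideanSpace ℝ (Fin m) → EuclideanSpace ℝ (Fin m) → ℝ)
          (c₁ c₂ : EuclideanSpace ℝ (Fin n) → EuclideanSpace ℝ (Fin m)),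
          K.Nonempty → Bornology.IsBounded K → IsClosed K → Convex ℝ K →
          Continuous (fun p : EuclideanSpace ℝ (Fin m) × EuclideanSpace ℝ (Fin m) => g p.1 p.2) →
          (∀ c d, 0 ≤ g c d) → (∀ c d, g c d = g d c) → (∀ c d, g c d = 0 ↔ c = d) →
          ImageMatching.IsIntensityMap Ω₁ K c₁ → ImageMatching.IsIntensityMap Ω₂ K c₂ →
          (∀ᵐ x ∂volume.restrict Ω₁, c₂ (Matrix.toEuclideanLin M x) = c₁ x) →
          (∀ (a : EuclideanSpace ℝ (Fin n)) (Q : Matrix (Fin n) (Fin n) ℝ),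
            Q ∈ Matrix.specialOrthogonalGroup (Fin n) ℝ →
            (fun x => a + lam • Matrix.toEuclideanLin Q x) '' Ω₁ = Ω₂ →
            (∀ᵐ x ∂volume.restrict Ω₁,
              c₂ (a + lam • Matrix.toEuclideanLin Q x) =
                c₂ (lam • Matrix.toEuclideanLin R x)) →
            a = 0 ∧ Q = R) →
          ImageMatching.IsUniqueMinimiser Ω₁
            (ImageMatching.admissible (n : ℝ≥0∞) Ω₁ Ω₂)
            (ImageMatching.functional
              (ImageMatching.integrand (ImageMatching.elasticEnergy α h) g) Ω₁ c₁ c₂)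
            (fun x => lam • Matrix.toEuclideanLin R x)) := by
  obtain ⟨nonneg, main⟩ := ImageMatching.theorem4p1_general n (Nat.one_le_iff_ne_zero.1 hn) α hα h
    (h_C1.differentiableOn one_ne_zero) h_convex h_symm h_deriv
  refine ⟨nonneg, ?_⟩
  rintro lam R _ Ω₁ _ hlam hR rfl hΩ₁ rfl
  obtain ⟨average_le, unique⟩ := main lam R Ω₁ hlam hR hΩ₁
  exact ⟨average_le, fun hna m K g c₁ c₂ _ _ _ _ hg_cont hg₀ _ hg _ hc₂ hcc hgen =>
    unique hna m g c₁ c₂ hg_cont.measurable hg₀ hg hc₂.1.aemeasurable hcc hgen⟩
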